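/- Let $X_1,\dots,X_n$ be i.i.d. random variables with law $P$ on a measurable space $M$, let $2\le m<n/2$, and let $h:M^m\to\mathbb R$ be measurable and symmetric in its $m$ arguments. Write $\mathbb E[t]=\mathbb E[t(X_1,\dots,X_r)]$ for $t:M^r\to\mathbb R$, and put $$g(x)=\mathbb E[h(x,X_2,\dots,X_m)],\quad \sigma_h^2=\operatorname{var}[h(X_1,\dots,X_m)],\quad \sigma_g^2=\operatorname{var}[g(X_1)].$$ Assume $\mathbb E[h]=0$, $0<\sigma_h^2<\infty$, $\sigma_g^2>0$ and $\mathbb E[|h|^3]<\infty$. Let $N$ be a positive integer with $N<\binom nm$, let $p=N/\binom nm$, and let $(Z_{\mathbf i})$, indexed by $I_{n,m}=\{(i_1,\dots,i_m):1\le i_1<\dots<i_m\le n\}$, be i.i.d. Bernoulli$(p)$ variables independent of $(X_1,\dots,X_n)$. Put $$\hat N=\sum_{\mathbf i\in I_{n,m}}Z_{\mathbf i},\qquad U'_{n,N}=\frac1{\hat N}\sum_{\mathbf i\in I_{n,m}}Z_{\mathbf i}\,h(X_{i_1},\dots,X_{i_m})\quad(U'_{n,N}=0\text{ if }\hat N=0),\qquad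 \sigma^2=m^2\sigma_g^2+\frac nN\sigma_h^2.$$ Let $\Psi_1(x)=\mathbb E[h^2(x,X_2,\dots,X_m)]$ and, for $1\le r\le m$, $\tilde\Psi_r(x_1,\dots,x_r)=\mathbb E[h^2(x_1,\dots,x_r,X_{r+1},\dots,X_m)]-\sigma_h^2$. Define $\pi_1(h^2)=\tilde\Psi_1$ and, for $2\le r\le m$, $$\pi_r(h^2)(x_1,\dots,x_r)=\tilde\Psi_r(x_1,\dots,x_r)-\sum_{s=1}^{r-1}\ \sum_{1\le j_1<\dots<j_s\le r}\pi_s(h^2)(x_{j_1},\dots,x_{j_s}),$$ and $$\mathcal R=\sum_{r=2}^m\binom mr\binom nr^{-1}\sum_{1\le j_1<\dots<j_r\le n}\frac{\pi_r(h^2)(X_{j_1},\dots,X_{j_r})}{\sigma_h^2},\qquad \|\mathcal R\|_{3/2}=\big(\mathbb E|\mathcal R|^{3/2}\big)^{2/3}.$$ Finally put $$\mathfrak B_1=\frac{\mathbb E[|h|^3](1-2p+2p^2)}{\sqrt{N(1-p)}\,\sigma_h^3}+\exp\Big(\frac{-n\sigma_h^6}{24m(\mathbb E[|h|^3])^2}\Big),\qquad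 \mathfrak B_2=\frac{\mathbb E[|g|^3]}{\sqrt n\,\sigma_g^3}+\Big(\frac mn\Big(\frac{\sigma_h^2}{m\sigma_g^2}-1\Big)\Big)^{1/2},$$ and let $\Phi$ be the standard normal distribution function. (a) There is an absolute constant $C>0$ such that, in every such situation, $$\sup_{z\in\mathbb R}\Big|P\Big(\frac{\sqrt n\,U'_{n,N}}{\sigma}\le z\Big)-\Phi(z)\Big|\le C\Big\{\mathfrak B_1+\mathfrak B_2+\frac{\sqrt m}{\sqrt{n(1-p)}}+\Big(1+\frac{\sqrt{mN}}{\sqrt{n(1-p)}}\Big)\frac{m^{3/2}\mathbb E[\Psi_1^{3/2}]}{\sqrt n\,\sigma_h^3}+\|\mathcal R\|_{3/2}\Big\},$$ and if, in addition, $\mathbb E[h^4]<\infty$, then $$\sup_{z\in\mathbb R}\Big|P\Big(\frac{\sqrt n\,U'_{n,N}}{\sigma}\le z\Big)-\Phi(z)\Big|\le C\Big\{\mathfrak B_1+\mathfrak B_2+\frac{\sqrt m}{\sqrt{n(1-p)}}+\frac{N}{n^2(1-p)}+\frac{\sqrt{m\,\mathbb E[(h^2-\sigma_h^2)^2]}}{\sqrt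 n\,\sigma_h^2}\Big\}.$$ (b) These bounds are of the rate $n^{-1/2}$ when $n$ and $N$ are comparable: for fixed $m\ge2$, $P$ and $h$ as above and every $K$ there is a constant $K'$ (depending only on $m,P,h,K$) such that, for all integers $n,N$ with $n>2m$, $1\le N<\binom nm$ and $\max(n/N,N/n)<K$, the first sum in braces is at most $K'/\sqrt n$, and so is the second one if $\mathbb E[h^4]<\infty$. -/

import Mathlib

open MeasureTheory ProbabilityTheory

namespace IncompleteU

noncomputable section

/-- The index set of strictly increasing `m`-tuples `i₁ < ⋯ < i_m` in `{1, …, n}`. -/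
abbrev Idx (n m : ℕ) : Type := Fin m ↪o Fin n

/-- The kernel `h` is symmetric in its `m` arguments. -/
def IsSymmKernel {M : Type*} {m : ℕ} (h : (Fin m → M) → ℝ) : Prop :=
  ∀ (τ : Equiv.Perm (Fin m)) (x : Fin m → M), h (x ∘ τ) = h x

section Population

variable {M : Type*} [MeasurableSpace M] (P : Measure M)

/-- `𝔼[f(X₁, …, X_r)]` for independent `X₁, …, X_r` with law `P`. -/
def mean {r : ℕ} (f : (Fin r → M) → ℝ) : ℝ :=
  ∫ x, f x ∂(Measure.pi fun _ : Fin r => P)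

/-- `𝔼[f(x₁, …, x_r, X_{r+1}, …, X_m)]` for independent `X_{r+1}, …, X_m` with law `P`
(the variables `y k` with `k < r` are integrated out trivially). -/
def partialMean {m : ℕ} (f : (Fin m → M) → ℝ) (r : ℕ) (x : Fin r → M) : ℝ :=
  mean P fun y : Fin m → M => f fun k => if hk : (k : ℕ) < r then x ⟨k, hk⟩ else y k

variable {m : ℕ} (h : (Fin m → M) → ℝ)

/-- `g(x) = 𝔼[h(x, X₂, …, X_m)]`. -/
def g (x : M) : ℝ := partialMean P h 1 fun _ => x

/-- `σ_h² = var[h(X₁, …, X_m)]`. -/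
def varH : ℝ := variance h (Measure.pi fun _ : Fin m => P)

/-- `σ_g² = var[g(X₁)]`. -/
def varG : ℝ := variance (g P h) P

/-- `σ_h`. -/
def sigmaH : ℝ := √(varH P h)

/-- `σ_g`. -/
def sigmaG : ℝ := √(varG P h)

/-- `σ = (m² σ_g² + α σ_h²)^{1/2}` with `α = n / N`. -/
def sigma (n N : ℕ) : ℝ := √((m : ℝ) ^ 2 * varG P h + (n : ℝ) / N * varH P h)

/-- `Ψ₁(x) = 𝔼[h²(x, X₂, …, X_m)]`. -/
def Psi1 (x : M) : ℝ := partialMean P (fun y => h y ^ 2) 1 fun _ => x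

/-- `Ψ̃_r(x₁, …, x_r) = 𝔼[h²(x₁, …, x_r, X_{r+1}, …, X_m)] - σ_h²`. -/
def PsiTilde (r : ℕ) (x : Fin r → M) : ℝ := partialMean P (fun y => h y ^ 2) r x - varH P h

/-- The Hoeffding projection kernels `π_r(h²)`:
`π_r(h²)(x₁, …, x_r) = Ψ̃_r(x₁, …, x_r) - ∑_{s=1}^{r-1} ∑_{j₁ < ⋯ < j_s ≤ r} π_s(h²)(x_{j₁}, …, x_{j_s})`.
The summation variable `t` below is `s - 1`. -/
def hoeffdingProj (r : ℕ) (x : Fin r → M) : ℝ :=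
  PsiTilde P h r x -
    ∑ t : Fin (r - 1), ∑ j : Idx r ((t : ℕ) + 1), hoeffdingProj ((t : ℕ) + 1) fun k => x (j k)
termination_by r
decreasing_by omega

/-- The degenerate remainder of the Hoeffding decomposition of `U_{h²}`, as a function of the data:
`ℛ = ∑_{r=2}^m (m choose r) (n choose r)⁻¹ ∑_{j₁ < ⋯ < j_r} π_r(h²)(X_{j₁}, …, X_{j_r}) / σ_h²`. -/
def remainder (n : ℕ) (x : Fin n → M) : ℝ :=
  ∑ r ∈ Finset.Icc 2 m, (m.choose r : ℝ) * ((n.choose r : ℝ))⁻¹ *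
    ∑ j : Idx n r, hoeffdingProj P h r (fun k => x (j k)) / varH P h

/-- `‖ℛ‖_{3/2}`. -/
def remainderNorm (n : ℕ) : ℝ :=
  (mean P fun x : Fin n → M => |remainder P h n x| ^ (3 / 2 : ℝ)) ^ (2 / 3 : ℝ)

/-- The Bernoulli success probability `p = N / (n choose m)`. -/
def samplingProb (n m N : ℕ) : ℝ := (N : ℝ) / (n.choose m : ℝ)

/-- The term `𝔅₁`. -/
def B1 (n N : ℕ) : ℝ :=
  (mean P fun x => |h x| ^ 3) * (1 - 2 * samplingProb n m N + 2 * samplingProb n m N ^ 2) /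
      (√(N * (1 - samplingProb n m N)) * sigmaH P h ^ 3) +
    Real.exp (-((n : ℝ) * sigmaH P h ^ 6) / (24 * m * (mean P fun x => |h x| ^ 3) ^ 2))

/-- The term `𝔅₂`. -/
def B2 (n : ℕ) : ℝ :=
  (∫ x, |g P h x| ^ 3 ∂P) / (√n * sigmaG P h ^ 3) +
    √((m : ℝ) / n * (varH P h / (m * varG P h) - 1))

/-- The sum in braces in the bound under a finite third moment. -/
def bound3 (n N : ℕ) : ℝ :=
  B1 P h n N + B2 P h n + √m / √(n * (1 - samplingProb n m N)) +
    (1 + √(m * N) / √(n * (1 - samplingProb n m N))) *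
      ((m : ℝ) ^ (3 / 2 : ℝ) * (∫ x, Psi1 P h x ^ (3 / 2 : ℝ) ∂P) / (√n * sigmaH P h ^ 3)) +
    remainderNorm P h n

/-- The sum in braces in the bound under a finite fourth moment. -/
def bound4 (n N : ℕ) : ℝ :=
  B1 P h n N + B2 P h n + √m / √(n * (1 - samplingProb n m N)) +
    (N : ℝ) / ((n : ℝ) ^ 2 * (1 - samplingProb n m N)) +
    √(m * mean P fun x => (h x ^ 2 - varH P h) ^ 2) / (√n * varH P h)

/-- The standing assumptions on the kernel: it is measurable, symmetric, `𝔼[h] = 0`,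
`0 < σ_h² < ∞`, `σ_g² > 0` and `𝔼|h|³ < ∞`. -/
structure Admissible : Prop where
  measurable : Measurable h
  symm : IsSymmKernel h
  mean_zero : mean P h = 0
  memLp_two : MemLp h 2 (Measure.pi fun _ : Fin m => P)
  varH_pos : 0 < varH P h
  varG_pos : 0 < varG P h
  third_moment : Integrable (fun x => |h x| ^ 3) (Measure.pi fun _ : Fin m => P)

end Population

section Sampling

variable {M Ω : Type*} [MeasurableSpace M] [MeasurableSpace Ω]

/-- Under `μ`, the data `X₁, …, X_n` are i.i.d. with law `P`, the samplers `Z_i`, `i ∈ I_{n,m}`,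
are i.i.d. Bernoulli variables with success probability `N / (n choose m)`, and the samplers are
independent of the data. -/
structure IsBernoulliSampling (P : Measure M) (μ : Measure Ω) {n m : ℕ} (N : ℕ)
    (X : Fin n → Ω → M) (Z : Idx n m → Ω → ℝ) : Prop where
  measurable_X : ∀ i, Measurable (X i)
  measurable_Z : ∀ i, Measurable (Z i)
  law_X : ∀ i, μ.map (X i) = P
  law_Z_one : ∀ i, μ.real {ω | Z i ω = 1} = samplingProb n m N
  law_Z_zero : ∀ i, μ.real {ω | Z i ω = 0} = 1 - samplingProb n m N
  indep_X : iIndepFun X μ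
  indep_Z : iIndepFun Z μ
  indep_X_Z : IndepFun (fun ω i => X i ω) (fun ω i => Z i ω) μ

/-- The incomplete U-statistic `U'_{n,N} = N̂⁻¹ ∑_i Z_i h(X_i)` with `N̂ = ∑_i Z_i`
(equal to `0` when `N̂ = 0`). -/
def incompleteU {n m : ℕ} (h : (Fin m → M) → ℝ) (X : Fin n → Ω → M) (Z : Idx n m → Ω → ℝ)
    (ω : Ω) : ℝ :=
  (∑ i, Z i ω)⁻¹ * ∑ i, Z i ω * h fun k => X (i k) ω

/-- The Kolmogorov distance `sup_z |P(Y ≤ z) - Φ(z)|` of a random variable from `𝒩(0, 1)`. -/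
def kolmogorovDistNormal (μ : Measure Ω) (Y : Ω → ℝ) : ℝ :=
  ⨆ z : ℝ, |μ.real {ω | Y ω ≤ z} - cdf (gaussianReal 0 1) z|

end Sampling

end

end IncompleteU

namespace IncompleteU

/-! The argument conditions on the data. Put `c = zσ/√n`. Off the event `N̂ = 0`, of probability at
most `exp (-N) ≤ 1/√N`, the inequality `√n U' / σ ≤ z` says `∑ Z_i (h(X_i) - c) ≤ 0`, so the random
normalisation disappears (`IsBernoulliSampling.cdf_sub_le`). Given the data this is a weighted
Bernoulli sum, and Berry-Esseen (`bernoulli_berryEsseen`) approximates the conditional probability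
by `Φ((c - U_n) / √((1-p)V/N))`, where `U_n` is the complete U-statistic of `h` and `V` that of `(h
- c)²`.

The next step replaces `V` by `σ_h²`. Write `V/σ_h² = 1 + L + ρ` and `s₂² = (1-p)σ_h²/N`, `a = (c -
U_n)/s₂`. By `abs_Phi_scale_le` the probability is `Φ(a) - ½ a φ(a) L + O(|L|^{3/2} + |ρ|)`,
uniformly in `a`. The main term `𝔼 Φ((c - U_n)/s₂)` is the distribution function of `U_n` plus an
independent Gaussian. Smoothing does not increase the distance to the normal law, so the
Berry-Esseen bound for complete U-statistics (`ustat_berryEsseen`) turns it into `Φ(c/√(s₁² + s₂²))`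
with `s₁ = mσ_g/√n` (`abs_integral_Phi_sub_le`). Since `s₁² + s₂² = σ²/n - σ_h²/(n choose m)`, a
last change of scale gives `Φ(z)` (`abs_Phi_rescale_le`). The shift by `c` contributes to `ρ`; it is
small for `z² ≤ 1/ε` with `ε² = m/n + 1/N`, and the remaining `z` are handled by monotonicity and
Chebyshev. All this is collected in `kolmogorovDist_le_of_conditional`, which leaves only the choice
of `L` and `ρ`.

With a fourth moment one takes `L = 0`: the variance of the U-statistic of `h²` bounds `𝔼|ρ|`. With
a third moment only, `h²` lies in `L^{3/2}`. Then `L` is the linear Hoeffding term of the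
U-statistic of `h²`, and `ρ` is `ℛ` plus the shift. A von Bahr-Esseen inequality makes `𝔼|L|^{3/2}`
of order `n^{-1/2}`; `𝔼|L|` itself need not be that small, which is why `L` is kept to first order.
The term `𝔼[a φ(a) L]` is small by decoupling: `L` is a sum of centred functions of single
observations, and removing from `U_n` the kernels that contain `X_i` costs little because `w φ(w)`
is Lipschitz (`abs_integral_comp_ustat_mul_le`).

Both Berry-Esseen theorems are proved by Stein's method: `berryEsseen` for independent sums, and
`berryEsseen_add` for a perturbed sum, through the randomized concentration inequality
`concentration_of_le`. The U-statistic is a sum of independent projections perturbed by its higher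
Hoeffding components, which `integral_sq_sum_weight_le` controls.

For the rate, `1 - p` is bounded below when `N ≤ K n` (`one_le_mul_one_sub_samplingProb`), and the
von Bahr-Esseen inequality for degenerate families gives `‖ℛ‖_{3/2} = O(n^{-2/3})`. -/

/-! ### Truncation and the randomized concentration inequality -/

/-- `u` truncated to `[-r, r]`. -/
def clamp (r u : ℝ) : ℝ := max (-r) (min u r)

lemma abs_clamp_le {r : ℝ} (hr : 0 ≤ r) (u : ℝ) : |clamp r u| ≤ r := by
  rw [abs_le]
  exact ⟨le_max_left _ _, max_le (by linarith) (min_le_right _ _)⟩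

lemma abs_clamp_sub_le (r r' u : ℝ) :
    |clamp r u - clamp r' u| ≤ |r - r'| := by
  unfold clamp
  refine (abs_max_sub_max_le_max _ _ _ _).trans (max_le ?_ ?_)
  · rw [← abs_neg]; apply le_of_eq; congr 1; ring
  · refine (abs_min_sub_min_le_max _ _ _ _).trans (max_le ?_ le_rfl)
    simp

lemma clamp_mono (r : ℝ) : Monotone (clamp r) := fun _ _ h =>
  max_le_max le_rfl (min_le_min h le_rfl)

lemma clamp_of_abs_le {r u : ℝ} (h : |u| ≤ r) : clamp r u = u := by
  rw [abs_le] at h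
  rw [clamp, min_eq_left h.2, max_eq_right h.1]

lemma measurable_clamp : Measurable fun q : ℝ × ℝ => clamp q.1 q.2 := by
  unfold clamp; fun_prop

/-- For `|u| ≤ D` there is room `δ` on either side before truncation at radius `D + δ` sets in, so a
move by `x` changes the truncated value by at least `min |x| δ` in the direction of `x`. -/
lemma mul_clamp_sub_clamp_ge {x u D δ : ℝ} (hδ : 0 < δ) (hu : |u| ≤ D) :
    |x| * min |x| δ ≤ x * (clamp (D + δ) u - clamp (D + δ) (u - x)) := by
  rw [clamp_of_abs_le (by linarith : |u| ≤ D + δ)]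
  rw [abs_le] at hu
  unfold clamp
  rcases le_total 0 x with hx | hx
  · rw [abs_of_nonneg hx]
    refine mul_le_mul_of_nonneg_left ?_ hx
    rw [le_sub_comm]
    refine max_le ?_ ((min_le_left _ _).trans ?_)
    · linarith [min_le_right x δ]
    · linarith [min_le_left x δ]
  · rw [abs_of_nonpos hx, ← neg_mul_neg, neg_mul_neg, ← neg_mul_neg x]
    refine mul_le_mul_of_nonneg_left ?_ (by linarith)
    rw [neg_sub, le_sub_iff_add_le]
    refine le_max_of_le_right (le_min ?_ ?_)
    · linarith [min_le_left (-x) δ]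
    · linarith [min_le_right (-x) δ]

lemma mul_clamp_sub_clamp_nonneg (x u r : ℝ) : 0 ≤ x * (clamp r u - clamp r (u - x)) := by
  rcases le_total 0 x with hx | hx
  · exact mul_nonneg hx (sub_nonneg.2 (clamp_mono r (by linarith)))
  · exact mul_nonneg_of_nonpos_of_nonpos hx (sub_nonpos.2 (clamp_mono r (by linarith)))

/-- The pointwise inequality behind the concentration bound. The clamp is 1-Lipschitz in its radius,
so the random width `D` may be exchanged for a width `D'` that will be independent of `x`, at the
cost `|x| |D - D'|`. -/
lemma indicator_mul_le_mul_clamp_sub {x u D D' δ : ℝ} (hδ : 0 < δ) :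
    ({v : ℝ | |v| ≤ D}.indicator (fun _ => |x| * min |x| δ) u) - |x| * |D - D'| ≤
      x * (clamp (D + δ) u - clamp (D' + δ) (u - x)) := by
  have h1 : ({v : ℝ | |v| ≤ D}.indicator (fun _ => |x| * min |x| δ) u) ≤
      x * (clamp (D + δ) u - clamp (D + δ) (u - x)) := by
    by_cases hu : |u| ≤ D
    · rw [Set.indicator_of_mem (by exact hu)]
      exact mul_clamp_sub_clamp_ge hδ hu
    · rw [Set.indicator_of_notMem (by exact hu)]
      exact mul_clamp_sub_clamp_nonneg _ _ _
  have h2 : -(|x| * |D - D'|) ≤ x * (clamp (D + δ) (u - x) - clamp (D' + δ) (u - x)) := by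
    refine le_trans (neg_le_neg ?_) (neg_abs_le _)
    rw [abs_mul]
    refine mul_le_mul_of_nonneg_left ?_ (abs_nonneg _)
    refine (abs_clamp_sub_le _ _ _).trans (le_of_eq ?_)
    congr 1; ring
  calc _ ≤ x * (clamp (D + δ) u - clamp (D + δ) (u - x)) +
        x * (clamp (D + δ) (u - x) - clamp (D' + δ) (u - x)) := by linarith
    _ = _ := by ring

/-- From `(x - 2δ)² ≥ 0`. It converts a third-moment bound into a lower bound for the truncated
second moment. -/
lemma mul_min_ge {x δ : ℝ} (hx : 0 ≤ x) (hδ : 0 < δ) : x ^ 2 - x ^ 3 / (4 * δ) ≤ x * min x δ := by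
  have h : x - x ^ 2 / (4 * δ) ≤ min x δ := by
    refine le_min (by have : 0 ≤ x ^ 2 / (4 * δ) := by positivity
                      linarith) ?_
    rw [sub_le_iff_le_add, ← sub_le_iff_le_add', le_div_iff₀ (by positivity)]
    nlinarith [sq_nonneg (x - 2 * δ)]
  calc _ = x * (x - x ^ 2 / (4 * δ)) := by ring
    _ ≤ _ := mul_le_mul_of_nonneg_left h hx

section Concentration

variable {Ω ι : Type*} [MeasurableSpace Ω] {μ : Measure Ω} [IsProbabilityMeasure μ]
  {ξ : ι → Ω → ℝ} {s : Finset ι}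

lemma integral_sq_sum_of_indep (hL : ∀ i ∈ s, MemLp (ξ i) 2 μ) (h0 : ∀ i ∈ s, ∫ ω, ξ i ω ∂μ = 0)
    (hind : Set.Pairwise (s : Set ι) fun i j => ξ i ⟂ᵢ[μ] ξ j) :
    ∫ ω, (∑ i ∈ s, ξ i ω) ^ 2 ∂μ = ∑ i ∈ s, ∫ ω, ξ i ω ^ 2 ∂μ := by
  have h1 := IndepFun.variance_sum hL hind
  rw [variance_eq_integral (by
    exact (memLp_finsetSum' s hL).aestronglyMeasurable.aemeasurable)] at h1
  have h2 : ∫ ω, (∑ i ∈ s, ξ i) ω ∂μ = 0 := by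
    simp only [Finset.sum_apply]
    rw [integral_finsetSum _ fun i hi => (hL i hi).integrable (by norm_num)]
    exact Finset.sum_eq_zero h0
  rw [h2] at h1
  simp only [Finset.sum_apply, sub_zero] at h1
  rw [h1]
  refine Finset.sum_congr rfl fun i hi => ?_
  rw [variance_of_integral_eq_zero (hL i hi).aestronglyMeasurable.aemeasurable (h0 i hi)]

lemma integral_abs_le_of_integral_sq_le {W : Ω → ℝ} {c : ℝ} (hc : 0 < c) (hW : MemLp W 2 μ)
    (h : ∫ ω, W ω ^ 2 ∂μ ≤ c ^ 2) : ∫ ω, |W ω| ∂μ ≤ c := by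
  have h1 : ∫ ω, |W ω| ∂μ ≤ ∫ ω, (c + W ω ^ 2 / c) / 2 ∂μ := by
    refine integral_mono (hW.integrable (by norm_num)).abs
      (((integrable_const c).add (hW.integrable_sq.div_const c)).div_const 2) fun ω => ?_
    have : 0 ≤ (|W ω| - c) ^ 2 / c := by positivity
    have h3 : (|W ω| - c) ^ 2 / c = W ω ^ 2 / c - 2 * |W ω| + c := by
      rw [← sq_abs (W ω)]; field_simp; ring
    simp only
    linarith
  rw [integral_div, integral_add (integrable_const c) (hW.integrable_sq.div_const c),
    integral_div] at h1
  have h2 : (∫ ω, W ω ^ 2 ∂μ) / c ≤ c := by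
    rw [div_le_iff₀ hc]; nlinarith
  simp at h1
  linarith

/-- A randomized concentration inequality for sums of independent random variables. -/
theorem concentration_of_le (hL : ∀ i ∈ s, MemLp (ξ i) 3 μ) (h0 : ∀ i ∈ s, ∫ ω, ξ i ω ∂μ = 0)
    (hind : Set.Pairwise (s : Set ι) fun i j => ξ i ⟂ᵢ[μ] ξ j)
    (hv : 3 / 4 ≤ ∑ i ∈ s, ∫ ω, ξ i ω ^ 2 ∂μ) (hv1 : ∑ i ∈ s, ∫ ω, ξ i ω ^ 2 ∂μ ≤ 1)
    {D : Ω → ℝ} {D' : ι → Ω → ℝ} (hD : MemLp D 2 μ) (hD' : ∀ i ∈ s, MemLp (D' i) 2 μ)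
    (hDn : ∀ ω, 0 ≤ D ω) (hDn' : ∀ i ω, 0 ≤ D' i ω)
    (hind' : ∀ i ∈ s, ξ i ⟂ᵢ[μ] fun ω => (∑ j ∈ s, ξ j ω - ξ i ω, D' i ω))
    {δ : ℝ} (hδ : 0 < δ) (hδγ : ∑ i ∈ s, ∫ ω, |ξ i ω| ^ 3 ∂μ ≤ δ) (z : ℝ) :
    μ.real {ω | |∑ i ∈ s, ξ i ω - z| ≤ D ω} ≤
      2 * (∫ ω, |∑ i ∈ s, ξ i ω| * D ω ∂μ + 2 * δ +
        ∑ i ∈ s, ∫ ω, |ξ i ω| * |D ω - D' i ω| ∂μ) := by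
  have hL2 : ∀ i ∈ s, MemLp (ξ i) 2 μ := fun i hi => (hL i hi).mono_exponent (by norm_num)
  set W : Ω → ℝ := fun ω => ∑ i ∈ s, ξ i ω with hWdef
  have hW : MemLp W 2 μ := memLp_finsetSum s hL2
  have hWabs : ∫ ω, |W ω| ∂μ ≤ 1 := by
    refine integral_abs_le_of_integral_sq_le one_pos hW ?_
    rw [hWdef, integral_sq_sum_of_indep hL2 h0 hind]; simpa using hv1
  -- The test function of the argument: `𝔼[W f(W)]` is bounded above by the size of `f`, and below
  -- by the probability in question. In `f' i` both the sum and the width have lost `ξ i`, whence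
  -- `𝔼[ξ i * f' i] = 0`.
  set f : Ω → ℝ := fun ω => clamp (D ω + δ) (W ω - z) with hf
  set f' : ι → Ω → ℝ := fun i ω => clamp (D' i ω + δ) (W ω - z - ξ i ω) with hf'
  have hclampm : ∀ {a b : Ω → ℝ}, AEStronglyMeasurable a μ → AEStronglyMeasurable b μ →
      AEStronglyMeasurable (fun ω => clamp (a ω) (b ω)) μ := fun ha hb =>
    (measurable_clamp.comp_aemeasurable (ha.aemeasurable.prodMk hb.aemeasurable)).aestronglyMeasurable
  have hfL : MemLp f 2 μ := by
    refine (hD.add (memLp_const δ)).mono (hclampm (hD.1.add aestronglyMeasurable_const) (hW.aestronglyMeasurable.sub aestronglyMeasurable_const)) ?_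
    refine Filter.Eventually.of_forall fun ω => ?_
    have := hDn ω
    rw [Real.norm_eq_abs, Real.norm_eq_abs]
    exact (abs_clamp_le (by linarith) _).trans (le_abs_self _)
  have hfL' : ∀ i ∈ s, MemLp (f' i) 2 μ := fun i hi => by
    refine ((hD' i hi).add (memLp_const δ)).mono (hclampm ((hD' i hi).1.add aestronglyMeasurable_const)
      ((hW.aestronglyMeasurable.sub aestronglyMeasurable_const).sub (hL i hi).1)) ?_
    refine Filter.Eventually.of_forall fun ω => ?_
    have := hDn' i ω
    rw [Real.norm_eq_abs, Real.norm_eq_abs]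
    exact (abs_clamp_le (by linarith) _).trans (le_abs_self _)
  have hzero : ∀ i ∈ s, ∫ ω, ξ i ω * f' i ω ∂μ = 0 := fun i hi => by
    have hi1 : ξ i ⟂ᵢ[μ] f' i := by
      have := (hind' i hi).comp (φ := id) (ψ := fun q : ℝ × ℝ => clamp (q.2 + δ) (q.1 - z))
        measurable_id (measurable_clamp.comp (by fun_prop : Measurable fun q : ℝ × ℝ =>
          (q.2 + δ, q.1 - z)))
      have e : f' i = (fun q : ℝ × ℝ => clamp (q.2 + δ) (q.1 - z)) ∘
          fun ω => (∑ j ∈ s, ξ j ω - ξ i ω, D' i ω) := by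
        ext ω
        simp only [hf', hWdef, Function.comp]
        congr 1; ring
      rw [e]
      exact this
    have := hi1.integral_mul_eq_mul_integral (hL i hi).1 (hfL' i hi).1
    rw [h0 i hi, zero_mul] at this
    exact this
  set A : Set Ω := {ω | |W ω - z| ≤ D ω} with hA
  have hAm : NullMeasurableSet A μ :=
    nullMeasurableSet_le ((hW.aestronglyMeasurable.sub (aestronglyMeasurable_const (b := z))).norm.aemeasurable) hD.1.aemeasurable
  set η : ι → Ω → ℝ := fun i ω => |ξ i ω| * min |ξ i ω| δ with hη
  have hηb : ∀ i ω, |η i ω| ≤ δ * |ξ i ω| := fun i ω => by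
    rw [hη]
    simp only
    rw [abs_of_nonneg (by positivity), mul_comm]
    exact mul_le_mul_of_nonneg_right (min_le_right _ _) (abs_nonneg _)
  have hηL : ∀ i ∈ s, MemLp (η i) 2 μ := fun i hi => by
    refine ((hL2 i hi).abs.const_mul δ).mono
      ((by fun_prop : Measurable fun x : ℝ => |x| * min |x| δ).comp_aemeasurable
        (hL i hi).1.aemeasurable).aestronglyMeasurable ?_
    refine Filter.Eventually.of_forall fun ω => ?_
    rw [Real.norm_eq_abs, Real.norm_eq_abs]
    exact (hηb i ω).trans (le_abs_self _)
  have hηI : ∀ i ∈ s, Integrable (η i) μ := fun i hi => (hηL i hi).integrable (by norm_num)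
  set H : Ω → ℝ := fun ω => ∑ i ∈ s, η i ω with hH
  have hHL : MemLp H 2 μ := memLp_finsetSum s hηL
  have hHI : Integrable H μ := hHL.integrable (by norm_num)
  have hint : ∀ i ∈ s, Integrable (fun ω => |ξ i ω| ^ 3) μ := fun i hi => by
    simpa using (hL i hi).integrable_norm_pow (by norm_num)
  -- The variance is at least `3/4`, and the third moments cost at most `1/4` because their sum is
  -- at most `δ`.
  have hEH : 1 / 2 ≤ ∫ ω, H ω ∂μ := by
    rw [hH, integral_finsetSum _ hηI]
    have : ∀ i ∈ s, ∫ ω, ξ i ω ^ 2 ∂μ - (∫ ω, |ξ i ω| ^ 3 ∂μ) / (4 * δ) ≤ ∫ ω, η i ω ∂μ := by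
      intro i hi
      rw [← integral_div, ← integral_sub (hL2 i hi).integrable_sq ((hint i hi).div_const _)]
      refine integral_mono ((hL2 i hi).integrable_sq.sub ((hint i hi).div_const _)) (hηI i hi)
        fun ω => ?_
      have := mul_min_ge (abs_nonneg (ξ i ω)) hδ
      rwa [sq_abs] at this
    have h2 := Finset.sum_le_sum this
    rw [Finset.sum_sub_distrib, ← Finset.sum_div] at h2
    have h3 : (∑ i ∈ s, ∫ ω, |ξ i ω| ^ 3 ∂μ) / (4 * δ) ≤ 1 / 4 := by
      rw [div_le_iff₀ (by positivity)]; linarith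
    linarith
  have hVH : Var[H; μ] ≤ δ ^ 2 := by
    have h1 : Var[∑ i ∈ s, η i; μ] = ∑ i ∈ s, Var[η i; μ] := by
      refine IndepFun.variance_sum hηL fun i hi j hj hij => ?_
      exact (hind hi hj hij).comp (φ := fun x => |x| * min |x| δ) (ψ := fun x => |x| * min |x| δ)
        (by fun_prop) (by fun_prop)
    have h2 : H = ∑ i ∈ s, η i := by ext ω; simp [hH]
    rw [h2, h1]
    calc ∑ i ∈ s, Var[η i; μ] ≤ ∑ i ∈ s, δ ^ 2 * ∫ ω, ξ i ω ^ 2 ∂μ := by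
          refine Finset.sum_le_sum fun i hi => ?_
          refine (variance_le_expectation_sq (hηL i hi).1).trans ?_
          rw [← integral_const_mul]
          refine integral_mono (hηL i hi).integrable_sq ((hL2 i hi).integrable_sq.const_mul _)
            fun ω => ?_
          have := pow_le_pow_left₀ (abs_nonneg _) (hηb i ω) 2
          rwa [sq_abs, mul_pow δ, sq_abs] at this
      _ ≤ _ := by
          rw [← Finset.mul_sum]
          nlinarith [sq_nonneg δ]
  have hHdev : ∫ ω, |H ω - ∫ ω, H ω ∂μ| ∂μ ≤ δ := by
    refine integral_abs_le_of_integral_sq_le hδ (hHL.sub (memLp_const _)) ?_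
    rwa [← variance_eq_integral hHL.1.aemeasurable]
  have hindic : ∀ (F : Ω → ℝ), Integrable F μ → Integrable (A.indicator F) μ := fun F hF =>
    hF.indicator₀ hAm
  -- `H` is a sum of independent terms with mean at least `1/2` and mean deviation at most `δ`, so
  -- on `A` it may be replaced by `1/2`.
  have hlow : (1 / 2) * μ.real A - δ ≤ ∫ ω, A.indicator H ω ∂μ := by
    have h1 : ∫ ω, A.indicator (fun _ => (1 / 2 : ℝ)) ω ∂μ = (1 / 2) * μ.real A := by
      rw [integral_indicator₀ hAm]; simp [mul_comm]
    have h2 : ∫ ω, (A.indicator (fun _ => (1 / 2 : ℝ)) ω - |H ω - ∫ ω, H ω ∂μ|) ∂μ ≤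
        ∫ ω, A.indicator H ω ∂μ := by
      refine integral_mono ((hindic _ (integrable_const _)).sub
        (hHI.sub (integrable_const _)).abs) (hindic _ hHI) fun ω => ?_
      by_cases hω : ω ∈ A
      · simp only [Set.indicator_of_mem hω]
        have := neg_abs_le (H ω - ∫ ω, H ω ∂μ)
        linarith
      · simp only [Set.indicator_of_notMem hω]
        have := abs_nonneg (H ω - ∫ ω, H ω ∂μ)
        linarith
    have h3 := integral_sub (hindic _ (integrable_const (1 / 2 : ℝ)))
      (hHI.sub (integrable_const (∫ ω, H ω ∂μ))).abs
    simp only [Pi.sub_apply] at h3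
    rw [h3, h1] at h2
    linarith
  have hI1 : ∀ i ∈ s, Integrable (fun ω => ξ i ω * f ω) μ := fun i hi =>
    (hL2 i hi).integrable_mul hfL
  have hI2 : ∀ i ∈ s, Integrable (fun ω => ξ i ω * f' i ω) μ := fun i hi =>
    (hL2 i hi).integrable_mul (hfL' i hi)
  have hI3 : ∀ i ∈ s, Integrable (fun ω => |ξ i ω| * |D ω - D' i ω|) μ := fun i hi =>
    (hL2 i hi).abs.integrable_mul (hD.sub (hD' i hi)).abs
  have hupp : ∫ ω, A.indicator H ω ∂μ - ∑ i ∈ s, ∫ ω, |ξ i ω| * |D ω - D' i ω| ∂μ ≤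
      ∫ ω, W ω * f ω ∂μ := by
    have e1 : ∫ ω, W ω * f ω ∂μ = ∑ i ∈ s, ∫ ω, ξ i ω * (f ω - f' i ω) ∂μ := by
      simp only [hWdef, Finset.sum_mul]
      rw [integral_finsetSum _ hI1]
      refine Finset.sum_congr rfl fun i hi => ?_
      simp only [mul_sub]
      rw [integral_sub (hI1 i hi) (hI2 i hi), hzero i hi, sub_zero]
    have e2 : ∫ ω, A.indicator H ω ∂μ = ∑ i ∈ s, ∫ ω, A.indicator (η i) ω ∂μ := by
      rw [← integral_finsetSum _ fun i hi => hindic _ (hηI i hi)]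
      congr 1; ext ω
      by_cases hω : ω ∈ A <;> simp [hω, hH]
    rw [e1, e2, ← Finset.sum_sub_distrib]
    refine Finset.sum_le_sum fun i hi => ?_
    rw [← integral_sub (hindic _ (hηI i hi)) (hI3 i hi)]
    refine integral_mono ((hindic _ (hηI i hi)).sub (hI3 i hi)) ?_ fun ω => ?_
    · simp only [mul_sub]; exact (hI1 i hi).sub (hI2 i hi)
    · have := indicator_mul_le_mul_clamp_sub (x := ξ i ω) (u := W ω - z) (D := D ω) (D' := D' i ω) hδ
      refine le_trans (le_of_eq ?_) this
      by_cases hω : ω ∈ A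
      · have hω' : W ω - z ∈ {v : ℝ | |v| ≤ D ω} := hω
        simp only [Set.indicator_of_mem hω, Set.indicator_of_mem hω', hη]
      · have hω' : W ω - z ∉ {v : ℝ | |v| ≤ D ω} := hω
        simp only [Set.indicator_of_notMem hω, Set.indicator_of_notMem hω']
  have hWD : Integrable (fun ω => |W ω| * D ω) μ := hW.abs.integrable_mul hD
  have hWI : Integrable (fun ω => |W ω|) μ := (hW.integrable (by norm_num)).abs
  have hWf : ∫ ω, W ω * f ω ∂μ ≤ ∫ ω, |W ω| * D ω ∂μ + δ := by
    calc ∫ ω, W ω * f ω ∂μ ≤ ∫ ω, (|W ω| * D ω + |W ω| * δ) ∂μ := by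
          refine integral_mono (hW.integrable_mul hfL) (hWD.add (hWI.mul_const _)) fun ω => ?_
          have h1 := abs_clamp_le (by linarith [hDn ω] : 0 ≤ D ω + δ) (W ω - z)
          calc W ω * f ω ≤ |W ω * f ω| := le_abs_self _
            _ = |W ω| * |f ω| := abs_mul _ _
            _ ≤ |W ω| * (D ω + δ) := mul_le_mul_of_nonneg_left h1 (abs_nonneg _)
            _ = _ := by ring
      _ = ∫ ω, |W ω| * D ω ∂μ + (∫ ω, |W ω| ∂μ) * δ := by
          rw [integral_add hWD (hWI.mul_const _), integral_mul_const]
      _ ≤ _ := by nlinarith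
  linarith

end Concentration

/-! ### The standard normal distribution: derivatives and tails -/

/-- The standard normal distribution function. -/
noncomputable abbrev Phi (x : ℝ) : ℝ := cdf (gaussianReal 0 1) x

/-- The standard normal density. -/
noncomputable abbrev phi (x : ℝ) : ℝ := gaussianPDFReal 0 1 x

lemma phi_eq (x : ℝ) : phi x = (√(2 * Real.pi))⁻¹ * Real.exp (-x ^ 2 / 2) := by
  simp [phi, gaussianPDFReal]

lemma phi_pos (x : ℝ) : 0 < phi x := gaussianPDFReal_pos _ _ _ one_ne_zero

lemma phi_neg (x : ℝ) : phi (-x) = phi x := by simp [phi_eq]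

lemma one_le_sqrt_two_pi : 1 ≤ √(2 * Real.pi) := by
  rw [Real.one_le_sqrt]
  linarith [Real.pi_gt_three]

lemma phi_le_one (x : ℝ) : phi x ≤ 1 := by
  rw [phi_eq]
  have h1 : (√(2 * Real.pi))⁻¹ ≤ 1 := inv_le_one_of_one_le₀ one_le_sqrt_two_pi
  have h2 : Real.exp (-x ^ 2 / 2) ≤ 1 := Real.exp_le_one_iff.2 (by nlinarith [sq_nonneg x])
  exact mul_le_one₀ h1 (Real.exp_pos _).le h2

lemma hasDerivAt_phi (x : ℝ) : HasDerivAt phi (-x * phi x) x := by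
  have h : HasDerivAt (fun x : ℝ => (√(2 * Real.pi))⁻¹ * Real.exp (-x ^ 2 / 2))
      ((√(2 * Real.pi))⁻¹ * (Real.exp (-x ^ 2 / 2) * (-(2 * x) / 2))) x := by
    refine HasDerivAt.const_mul _ (HasDerivAt.exp ?_)
    simpa using ((hasDerivAt_pow 2 x).neg.div_const 2)
  have e : phi = fun x : ℝ => (√(2 * Real.pi))⁻¹ * Real.exp (-x ^ 2 / 2) := funext phi_eq
  rw [e]
  convert h using 1
  ring

lemma continuous_phi : Continuous phi :=
  continuous_iff_continuousAt.2 fun x => (hasDerivAt_phi x).continuousAt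

lemma Phi_eq_integral (x : ℝ) : Phi x = ∫ t in Set.Iic x, phi t := by
  rw [Phi, cdf_eq_real, Measure.real, gaussianReal_apply_eq_integral _ one_ne_zero,
    ENNReal.toReal_ofReal (integral_nonneg fun t => (phi_pos t).le)]

lemma hasDerivAt_Phi (x : ℝ) : HasDerivAt Phi (phi x) x := by
  have hi : Integrable phi := integrable_gaussianPDFReal 0 1
  have e : Phi = fun x => Phi 0 + ∫ t in (0 : ℝ)..x, phi t := by
    ext y
    rw [← intervalIntegral.integral_Iic_sub_Iic hi.integrableOn hi.integrableOn,
      Phi_eq_integral, Phi_eq_integral]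
    ring
  rw [e]
  exact (intervalIntegral.integral_hasDerivAt_right (hi.intervalIntegrable)
    (continuous_phi.stronglyMeasurableAtFilter _ _) continuous_phi.continuousAt).const_add _

lemma Phi_nonneg (x : ℝ) : 0 ≤ Phi x := cdf_nonneg _ _

lemma Phi_le_one (x : ℝ) : Phi x ≤ 1 := cdf_le_one _ _

lemma Phi_mono : Monotone Phi := monotone_cdf _

lemma Phi_neg (x : ℝ) : Phi (-x) = 1 - Phi x := by
  have h1 : Phi (-x) = (gaussianReal 0 1).real (Set.Ici x) := by
    have h : (gaussianReal 0 1).map (fun y => -y) = gaussianReal 0 1 := by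
      simpa using gaussianReal_map_neg (μ := 0) (v := 1)
    rw [Phi, cdf_eq_real, ← h, map_measureReal_apply measurable_neg measurableSet_Iic, h]
    congr 1; ext y; simp
  have h2 : (gaussianReal 0 1).real (Set.Ici x) = (gaussianReal 0 1).real (Set.Ioi x) := by
    have := nullSingletonClass_gaussianReal (μ := 0) one_ne_zero
    exact measureReal_congr Ioi_ae_eq_Ici.symm
  rw [h1, h2, ← Set.compl_Iic, probReal_compl_eq_one_sub measurableSet_Iic, Phi, cdf_eq_real]

lemma one_sub_Phi_le_one_div_sq {x : ℝ} (hx : 0 < x) : 1 - Phi x ≤ 1 / x ^ 2 := by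
  have h := meas_ge_le_variance_div_sq (μ := gaussianReal 0 1) (X := id)
    (memLp_id_gaussianReal 2) hx
  simp only [integral_id_gaussianReal, id_eq, sub_zero, variance_id_gaussianReal] at h
  have h2 := ENNReal.toReal_mono (by simp) h
  rw [ENNReal.toReal_ofReal (by positivity)] at h2
  rw [Phi, cdf_eq_real, ← probReal_compl_eq_one_sub measurableSet_Iic]
  refine le_trans (measureReal_mono ?_) (h2.trans (by simp))
  intro y hy
  simp only [Set.mem_compl_iff, Set.mem_Iic, not_le] at hy
  exact hy.le.trans (le_abs_self y)

/-- The difference `φ(y) - y(1 - Φ(y))` has derivative `-(1 - Φ(y)) ≤ 0`, and Chebyshev bounds it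
below by `-1/y`; hence it is nonnegative everywhere. -/
lemma mul_one_sub_Phi_le (x : ℝ) : x * (1 - Phi x) ≤ phi x := by
  have hd : ∀ y, HasDerivAt (fun y => phi y - y * (1 - Phi y)) (-(1 - Phi y)) y := fun y => by
    have := (hasDerivAt_phi y).sub ((hasDerivAt_id y).mul ((hasDerivAt_Phi y).const_sub 1))
    refine this.congr_deriv ?_
    simp only [id_eq]; ring
  have hanti : Antitone fun y => phi y - y * (1 - Phi y) :=
    antitone_of_deriv_nonpos (fun y => (hd y).differentiableAt) fun y => by
      rw [(hd y).deriv]; linarith [Phi_le_one y]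
  have hlow : ∀ y, x ≤ y → 0 < y → -(1 / y) ≤ phi x - x * (1 - Phi x) := fun y hxy hy => by
    refine le_trans ?_ (hanti hxy)
    have h1 := one_sub_Phi_le_one_div_sq hy
    have h2 : y * (1 - Phi y) ≤ 1 / y := by
      calc y * (1 - Phi y) ≤ y * (1 / y ^ 2) := mul_le_mul_of_nonneg_left h1 hy.le
        _ = _ := by field_simp
    have := (phi_pos y).le
    linarith
  have hlim : Filter.Tendsto (fun y : ℝ => -(1 / y)) Filter.atTop (nhds 0) := by
    simpa using (tendsto_inv_atTop_zero (𝕜 := ℝ)).neg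
  have := le_of_tendsto hlim (Filter.eventually_atTop.2 ⟨max x 1, fun y hy =>
    hlow y ((le_max_left _ _).trans hy) (lt_of_lt_of_le one_pos ((le_max_right _ _).trans hy))⟩)
  linarith

lemma one_sub_Phi_le {x : ℝ} (hx : 0 ≤ x) : 1 - Phi x ≤ 5 * phi x := by
  rcases le_total 1 x with h | h
  · have h1 := mul_one_sub_Phi_le x
    have h2 := phi_pos x
    nlinarith [Phi_le_one x]
  · have h1 : 1 / 5 ≤ phi x := by
      have h2 : Real.exp (-(1 / 2)) ≤ Real.exp (-x ^ 2 / 2) := Real.exp_le_exp.2 (by nlinarith)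
      have h3 : (1 / 2 : ℝ) ≤ Real.exp (-(1 / 2)) := by
        have := Real.add_one_le_exp (-(1 / 2) : ℝ); linarith
      -- Equivalent to `e ≤ 25/9`. With `√(2π) ≤ 3` this gives `φ ≥ 1/5` on `[0, 1]`.
      have h3' : (3 / 5 : ℝ) ≤ Real.exp (-(1 / 2)) := by
        have h4 := Real.exp_one_lt_d9
        have h5 : Real.exp (-(1 / 2)) * Real.exp (-(1 / 2)) * Real.exp 1 = 1 := by
          rw [← Real.exp_add, ← Real.exp_add]; norm_num
        by_contra hc
        push Not at hc
        have h6 : Real.exp (-(1 / 2)) * Real.exp (-(1 / 2)) ≤ 9 / 25 := by nlinarith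
        nlinarith [Real.exp_pos 1]
      have h4 : √(2 * Real.pi) ≤ 3 := by
        rw [Real.sqrt_le_left (by norm_num)]
        nlinarith [Real.pi_lt_four]
      have h5 : (1 / 3 : ℝ) ≤ (√(2 * Real.pi))⁻¹ := by
        rw [one_div]
        exact inv_anti₀ (by linarith [one_le_sqrt_two_pi]) h4
      rw [phi_eq]
      nlinarith
    linarith [Phi_nonneg x]

/-! ### The Stein equation for half-lines -/

/-- The left branch `Φ / φ` of the Stein solution, up to a factor. -/
noncomputable def steinLeft (w : ℝ) : ℝ := Phi w / phi w

/-- The right branch `(1 - Φ) / φ` of the Stein solution, up to a factor. -/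
noncomputable def steinRight (w : ℝ) : ℝ := (1 - Phi w) / phi w

lemma hasDerivAt_steinLeft (w : ℝ) : HasDerivAt steinLeft (w * steinLeft w + 1) w := by
  have := (hasDerivAt_Phi w).div (hasDerivAt_phi w) (phi_pos w).ne'
  refine this.congr_deriv ?_
  have := (phi_pos w).ne'
  unfold steinLeft; field_simp; ring

lemma hasDerivAt_steinRight (w : ℝ) : HasDerivAt steinRight (w * steinRight w - 1) w := by
  have := ((hasDerivAt_Phi w).const_sub 1).div (hasDerivAt_phi w) (phi_pos w).ne'
  refine this.congr_deriv ?_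
  have := (phi_pos w).ne'
  unfold steinRight; field_simp; ring

lemma steinLeft_neg (w : ℝ) : steinLeft (-w) = steinRight w := by
  rw [steinLeft, steinRight, Phi_neg, phi_neg]

lemma steinLeft_nonneg (w : ℝ) : 0 ≤ steinLeft w := div_nonneg (Phi_nonneg w) (phi_pos w).le

lemma steinRight_nonneg (w : ℝ) : 0 ≤ steinRight w := by
  rw [← steinLeft_neg]; exact steinLeft_nonneg _

lemma steinRight_le {w : ℝ} (hw : 0 ≤ w) : steinRight w ≤ 5 ∧ w * steinRight w ≤ 1 := by
  constructor
  · rw [steinRight, div_le_iff₀ (phi_pos w)]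
    exact one_sub_Phi_le hw
  · rw [steinRight, ← mul_div_assoc, div_le_one (phi_pos w)]
    exact mul_one_sub_Phi_le _

/-- The bounded solution of the Stein equation `f' w - w * f w = 1_{w ≤ z} - Φ z`. -/
noncomputable def stein (z w : ℝ) : ℝ :=
  if w ≤ z then steinLeft w * (1 - Phi z) else Phi z * steinRight w

/-- The derivative of the Stein solution, with a convention at `z`. -/
noncomputable def steinDeriv (z w : ℝ) : ℝ := w * stein z w + (if w ≤ z then 1 else 0) - Phi z

lemma stein_of_le {z w : ℝ} (h : w ≤ z) : stein z w = steinLeft w * (1 - Phi z) := if_pos h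

lemma stein_of_ge {z w : ℝ} (h : z ≤ w) : stein z w = Phi z * steinRight w := by
  rcases h.lt_or_eq with h | rfl
  · exact if_neg (not_le.2 h)
  · rw [stein_of_le le_rfl, steinLeft, steinRight]; ring

lemma stein_nonneg (z w : ℝ) : 0 ≤ stein z w := by
  rcases le_total w z with h | h
  · rw [stein_of_le h]
    exact mul_nonneg (steinLeft_nonneg w) (by linarith [Phi_le_one z])
  · rw [stein_of_ge h]
    exact mul_nonneg (Phi_nonneg z) (steinRight_nonneg w)

/-- Monotonicity of `Φ` lets either branch dominate the solution on both sides of `z`. Thus the tail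
bounds apply according to the sign of `w` alone: this lemma for `w ≥ 0`, `stein_le_left` for `w ≤
0`. -/
lemma stein_le_right {z w : ℝ} : stein z w ≤ steinRight w := by
  rcases le_total w z with h | h
  · rw [stein_of_le h, steinLeft, steinRight, div_mul_eq_mul_div]
    refine div_le_div_of_nonneg_right ?_ (phi_pos w).le
    have := Phi_mono h
    nlinarith [Phi_le_one w, Phi_nonneg w, Phi_le_one z]
  · rw [stein_of_ge h]
    exact mul_le_of_le_one_left (steinRight_nonneg w) (Phi_le_one z)

lemma stein_le_left {z w : ℝ} : stein z w ≤ steinLeft w := by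
  rcases le_total w z with h | h
  · rw [stein_of_le h]
    exact mul_le_of_le_one_right (steinLeft_nonneg w) (by linarith [Phi_nonneg z])
  · rw [stein_of_ge h, steinLeft, steinRight, ← mul_div_assoc]
    refine div_le_div_of_nonneg_right ?_ (phi_pos w).le
    have := Phi_mono h
    nlinarith [Phi_nonneg w, Phi_nonneg z]

lemma stein_le (z w : ℝ) : stein z w ≤ 5 ∧ |w * stein z w| ≤ 1 := by
  have h0 := stein_nonneg z w
  rcases le_total 0 w with h | h
  · obtain ⟨h1, h2⟩ := steinRight_le h
    have h3 := stein_le_right (z := z) (w := w)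
    rw [abs_of_nonneg (mul_nonneg h h0)]
    exact ⟨h3.trans h1, (mul_le_mul_of_nonneg_left h3 h).trans h2⟩
  · obtain ⟨h1, h2⟩ := steinRight_le (neg_nonneg.2 h)
    rw [← steinLeft_neg, neg_neg] at h1 h2
    have h3 := stein_le_left (z := z) (w := w)
    rw [abs_mul, abs_of_nonpos h, abs_of_nonneg h0]
    exact ⟨h3.trans h1, (mul_le_mul_of_nonneg_left h3 (by linarith)).trans h2⟩

lemma abs_stein_le (z w : ℝ) : |stein z w| ≤ 5 := by
  rw [abs_of_nonneg (stein_nonneg z w)]; exact (stein_le z w).1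

lemma abs_steinDeriv_le (z w : ℝ) : |steinDeriv z w| ≤ 2 := by
  have h1 := abs_le.1 (stein_le z w).2
  have h2 := Phi_nonneg z
  have h3 := Phi_le_one z
  rw [steinDeriv, abs_le]
  split_ifs <;> constructor <;> linarith

lemma abs_stein_sub_le_of_le {z a b : ℝ} (ha : a ≤ z) (hb : b ≤ z) :
    |stein z a - stein z b| ≤ 2 * |a - b| := by
  rw [stein_of_le ha, stein_of_le hb]
  have := (convex_Iic z).norm_image_sub_le_of_norm_hasDerivWithin_le
    (f := fun w => steinLeft w * (1 - Phi z)) (C := 2)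
    (fun w _ => ((hasDerivAt_steinLeft w).mul_const _).hasDerivWithinAt) (fun w hw => ?_)
    (x := b) (y := a) hb ha
  · simpa using this
  · have h := abs_steinDeriv_le z w
    rw [steinDeriv, stein_of_le hw, if_pos (Set.mem_Iic.1 hw)] at h
    rw [Real.norm_eq_abs]
    convert h using 2
    ring

lemma abs_stein_sub_le_of_ge {z a b : ℝ} (ha : z ≤ a) (hb : z ≤ b) :
    |stein z a - stein z b| ≤ 2 * |a - b| := by
  rw [stein_of_ge ha, stein_of_ge hb]
  have := (convex_Ici z).norm_image_sub_le_of_norm_hasDerivWithin_le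
    (f := fun w => Phi z * steinRight w) (C := 2)
    (fun w _ => ((hasDerivAt_steinRight w).const_mul _).hasDerivWithinAt) (fun w hw => ?_)
    (x := b) (y := a) hb ha
  · simpa using this
  · have h := abs_le.1 (stein_le z w).2
    rw [stein_of_ge hw] at h
    have h2 := Phi_nonneg z
    have h3 := Phi_le_one z
    rw [Real.norm_eq_abs, abs_le]
    constructor <;> nlinarith

lemma abs_stein_sub_le (z a b : ℝ) : |stein z a - stein z b| ≤ 2 * |a - b| := by
  wlog hab : a ≤ b generalizing a b
  · rw [abs_sub_comm, abs_sub_comm a b]; exact this b a (le_of_not_ge hab)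
  rcases le_total b z with h | h
  · exact abs_stein_sub_le_of_le (hab.trans h) h
  rcases le_total z a with h' | h'
  · exact abs_stein_sub_le_of_ge h' (h'.trans hab)
  · have h1 := abs_stein_sub_le_of_le h' le_rfl
    have h2 := abs_stein_sub_le_of_ge le_rfl h
    rw [abs_of_nonpos (by linarith : a - z ≤ 0)] at h1
    rw [abs_of_nonpos (by linarith : z - b ≤ 0)] at h2
    rw [abs_of_nonpos (by linarith : a - b ≤ 0)]
    have h3 := abs_sub_le (stein z a) (stein z z) (stein z b)
    linarith

lemma continuous_stein (z : ℝ) : Continuous (stein z) := by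
  refine LipschitzWith.continuous (K := 2) (LipschitzWith.of_dist_le_mul fun a b => ?_)
  exact abs_stein_sub_le z a b

lemma hasDerivAt_stein {z w : ℝ} (h : w ≠ z) : HasDerivAt (stein z) (steinDeriv z w) w := by
  rcases lt_or_gt_of_ne h with h | h
  · have h1 : HasDerivAt (fun w => steinLeft w * (1 - Phi z)) (steinDeriv z w) w := by
      refine ((hasDerivAt_steinLeft w).mul_const (1 - Phi z)).congr_deriv ?_
      rw [steinDeriv, stein_of_le h.le, if_pos h.le]; ring
    refine h1.congr_of_eventuallyEq ?_
    filter_upwards [Iio_mem_nhds h] with u hu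
    exact stein_of_le (le_of_lt hu)
  · have h1 : HasDerivAt (fun w => Phi z * steinRight w) (steinDeriv z w) w := by
      refine ((hasDerivAt_steinRight w).const_mul (Phi z)).congr_deriv ?_
      rw [steinDeriv, stein_of_ge h.le, if_neg (not_le.2 h)]; ring
    refine h1.congr_of_eventuallyEq ?_
    filter_upwards [Ioi_mem_nhds h] with u hu
    exact stein_of_ge (le_of_lt hu)

/-- A displacement shorter than the distance to `z` neither crosses nor meets `z`, the only point
where the derivative of the Stein solution jumps. -/
lemma le_iff_le_of_abs_lt {z w t s : ℝ} (h : |t| < |w - z|) (hs : |s| ≤ |t|) :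
    (w + s ≤ z ↔ w ≤ z) ∧ w + s ≠ z := by
  rcases abs_cases t with ⟨h1, _⟩ | ⟨h1, _⟩ <;> rcases abs_cases s with ⟨h2, _⟩ | ⟨h2, _⟩ <;>
    rcases abs_cases (w - z) with ⟨h3, _⟩ | ⟨h3, _⟩ <;> rw [h1] at h hs <;> rw [h2] at hs <;>
    rw [h3] at h <;>
    exact ⟨⟨fun _ => by linarith, fun _ => by linarith⟩, fun _ => by linarith⟩

/-- The indicator of `|u| ≤ r`. -/
noncomputable def near (u r : ℝ) : ℝ := {v : ℝ | |v| ≤ r}.indicator 1 u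

lemma near_nonneg (u r : ℝ) : 0 ≤ near u r := Set.indicator_nonneg (fun _ _ => zero_le_one) _

lemma near_of_le {u r : ℝ} (h : |u| ≤ r) : near u r = 1 :=
  Set.indicator_of_mem (s := {v : ℝ | |v| ≤ r}) h _

lemma near_of_lt {u r : ℝ} (h : r < |u|) : near u r = 0 :=
  Set.indicator_of_notMem (s := {v : ℝ | |v| ≤ r}) (not_le.2 h) _

lemma abs_mul_stein_sub_le (z w s : ℝ) :
    |(w + s) * stein z (w + s) - w * stein z w| ≤ (2 * |w| + 5) * |s| := by
  have h1 := abs_stein_sub_le z (w + s) w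
  have h2 := abs_stein_le z (w + s)
  rw [add_sub_cancel_left] at h1
  calc _ = |w * (stein z (w + s) - stein z w) + s * stein z (w + s)| := by congr 1; ring
    _ ≤ |w| * |stein z (w + s) - stein z w| + |s| * |stein z (w + s)| := by
        rw [← abs_mul, ← abs_mul]; exact abs_add_le _ _
    _ ≤ |w| * (2 * |s|) + |s| * 5 := by gcongr
    _ = _ := by ring

/-- By the Stein equation the derivative is the locally Lipschitz function `w * stein z w` plus an
indicator with a unit jump at `z`; `near` accounts for that jump. -/
lemma abs_steinDeriv_sub_le (z w t : ℝ) :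
    |steinDeriv z (w + t) - steinDeriv z w| ≤ (2 * |w| + 5) * |t| + near (w - z) |t| := by
  rcases le_or_gt |w - z| |t| with h | h
  · rw [near_of_le h]
    have h1 := abs_mul_stein_sub_le z w t
    rw [abs_le] at h1 ⊢
    unfold steinDeriv
    split_ifs <;> constructor <;> linarith [h1.1, h1.2]
  · rw [near_of_lt h, add_zero]
    have h1 := abs_mul_stein_sub_le z w t
    have h2 := (le_iff_le_of_abs_lt h le_rfl).1
    simp only [steinDeriv, h2]
    convert h1 using 2
    ring

/-- If the segment may reach `z`, the Lipschitz bound for the solution and the bound for its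
derivative give `4|t|`. Otherwise the mean value inequality applies along the segment, where the
derivative does not jump. -/
lemma abs_stein_taylor_le (z w t : ℝ) :
    |stein z (w + t) - stein z w - t * steinDeriv z w| ≤
      |t| * ((2 * |w| + 5) * |t| + 4 * near (w - z) |t|) := by
  rcases le_or_gt |w - z| |t| with h | h
  · rw [near_of_le h]
    have h1 := abs_stein_sub_le z (w + t) w
    rw [add_sub_cancel_left] at h1
    have h2 : |t * steinDeriv z w| ≤ 2 * |t| := by
      rw [abs_mul, mul_comm]; gcongr; exact abs_steinDeriv_le z w
    calc _ ≤ |stein z (w + t) - stein z w| + |t * steinDeriv z w| := abs_sub _ _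
      _ ≤ 4 * |t| := by linarith
      _ ≤ _ := by
        have : 0 ≤ |t| * ((2 * |w| + 5) * |t|) := by positivity
        nlinarith
  · rw [near_of_lt h, mul_zero, add_zero]
    have := (convex_Icc (0 : ℝ) 1).norm_image_sub_le_of_norm_hasDerivWithin_le
      (f := fun θ => stein z (w + θ * t) - θ * t * steinDeriv z w)
      (f' := fun θ => (steinDeriv z (w + θ * t) - steinDeriv z w) * t)
      (C := (2 * |w| + 5) * |t| * |t|) (fun θ hθ => ?_) (fun θ hθ => ?_)
      (x := 0) (y := 1) (by simp) (by simp)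
    · simp only [one_mul, zero_mul, add_zero, sub_zero, norm_one, mul_one,
        Real.norm_eq_abs] at this
      calc _ = |stein z (w + t) - t * steinDeriv z w - stein z w| := by congr 1; ring
        _ ≤ _ := this
        _ = _ := by ring
    · have hs : |θ * t| ≤ |t| := by
        rw [abs_mul, abs_of_nonneg hθ.1]; exact mul_le_of_le_one_left (abs_nonneg _) hθ.2
      have h1 := hasDerivAt_stein (le_iff_le_of_abs_lt h hs).2
      have h2 : HasDerivAt (fun θ : ℝ => w + θ * t) t θ := by
        simpa using ((hasDerivAt_id θ).mul_const t).const_add w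
      have h3 : HasDerivAt (fun θ : ℝ => θ * t * steinDeriv z w) (t * steinDeriv z w) θ := by
        simpa using ((hasDerivAt_id θ).mul_const t).mul_const (steinDeriv z w)
      have h4 := (h1.comp θ h2).sub h3
      refine HasDerivAt.hasDerivWithinAt ?_
      exact h4.congr_deriv (by ring)
    · have hs : |θ * t| ≤ |t| := by
        rw [abs_mul, abs_of_nonneg hθ.1]; exact mul_le_of_le_one_left (abs_nonneg _) hθ.2
      have h1 := abs_steinDeriv_sub_le z w (θ * t)
      rw [near_of_lt (lt_of_le_of_lt hs h), add_zero] at h1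
      rw [norm_mul, Real.norm_eq_abs, Real.norm_eq_abs]
      gcongr
      exact h1.trans (by gcongr)

lemma near_eq_indicator (u r : ℝ) : near u r = {q : ℝ × ℝ | |q.1| ≤ q.2}.indicator 1 (u, r) := by
  by_cases h : |u| ≤ r
  · rw [near_of_le h, Set.indicator_of_mem (by exact h)]; rfl
  · rw [near_of_lt (not_le.1 h), Set.indicator_of_notMem (by exact h)]

lemma measurable_near : Measurable fun q : ℝ × ℝ => near q.1 q.2 := by
  simp only [near_eq_indicator]
  exact measurable_one.indicator (measurableSet_le (by fun_prop) (by fun_prop))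

lemma near_le_one (u r : ℝ) : near u r ≤ 1 := by
  rcases le_or_gt |u| r with h | h
  · rw [near_of_le h]
  · rw [near_of_lt h]; exact zero_le_one

lemma measurable_stein (z : ℝ) : Measurable (stein z) := (continuous_stein z).measurable

lemma measurable_steinDeriv (z : ℝ) : Measurable (steinDeriv z) := by
  unfold steinDeriv
  exact ((measurable_id.mul (measurable_stein z)).add
    (Measurable.ite measurableSet_Iic measurable_const measurable_const)).sub measurable_const

section General

variable {Ω : Type*} [MeasurableSpace Ω] {μ : Measure Ω} [IsProbabilityMeasure μ]

lemma integral_near {V : Ω → ℝ} (hV : Measurable V) (z r : ℝ) :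
    ∫ ω, near (V ω - z) r ∂μ = μ.real {ω | |V ω - z| ≤ r} := by
  rw [← integral_indicator_one (measurableSet_le (by fun_prop) measurable_const)]
  rfl

/-- Conditioning on `x` by Fubini: the bound is needed only for each frozen value of `x`. It lets a
concentration bound with a fixed radius be used with the random radius `|ξ i|`. -/
lemma integral_le_of_indepFun {x V : Ω → ℝ} (hx : Measurable x) (hV : Measurable V)
    (h : x ⟂ᵢ[μ] V) {F : ℝ → ℝ → ℝ} (hF : Measurable (Function.uncurry F))
    (hFi : Integrable (fun ω => F (x ω) (V ω)) μ) {b : ℝ → ℝ}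
    (hbi : Integrable (fun ω => b (x ω)) μ) (hle : ∀ ω, ∫ ω', F (x ω) (V ω') ∂μ ≤ b (x ω)) :
    ∫ ω, F (x ω) (V ω) ∂μ ≤ ∫ ω, b (x ω) ∂μ := by
  have hm := (indepFun_iff_map_prod_eq_prod_map_map hx.aemeasurable hV.aemeasurable).1 h
  have h1 : ∫ ω, F (x ω) (V ω) ∂μ =
      ∫ q, Function.uncurry F q ∂((μ.map x).prod (μ.map V)) := by
    rw [← hm, integral_map (hx.prodMk hV).aemeasurable hF.aestronglyMeasurable]
    rfl
  have := Measure.isProbabilityMeasure_map (μ := μ) hx.aemeasurable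
  have := Measure.isProbabilityMeasure_map (μ := μ) hV.aemeasurable
  have hi : Integrable (Function.uncurry F) ((μ.map x).prod (μ.map V)) := by
    rw [← hm, integrable_map_measure hF.aestronglyMeasurable (hx.prodMk hV).aemeasurable]
    exact hFi
  have e : ∀ t, ∫ v, Function.uncurry F (t, v) ∂(μ.map V) = ∫ ω', F t (V ω') ∂μ := fun t =>
    integral_map (f := fun v => F t v) hV.aemeasurable
      (hF.comp measurable_prodMk_left).aestronglyMeasurable
  rw [h1, integral_prod _ hi]
  have hi2 := hi.integral_prod_left
  rw [integral_map hx.aemeasurable hi2.aestronglyMeasurable]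
  refine integral_mono ((integrable_map_measure hi2.aestronglyMeasurable hx.aemeasurable).1 hi2)
    hbi fun ω => ?_
  simp only
  rw [e]
  exact hle ω

/-- Jensen for the cube, from its tangent at the mean: `(t + 2a)(t - a)² ≥ 0`. -/
lemma integral_abs_pow_three_le {x : Ω → ℝ} (hx : MemLp x 3 μ) :
    (∫ ω, |x ω| ∂μ) ^ 3 ≤ ∫ ω, |x ω| ^ 3 ∂μ := by
  set a := ∫ ω, |x ω| ∂μ with ha
  have h0 : 0 ≤ a := integral_nonneg fun _ => abs_nonneg _
  have h1 : Integrable (fun ω => |x ω|) μ := (hx.integrable (by norm_num)).abs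
  have h3 : Integrable (fun ω => |x ω| ^ 3) μ := by simpa using hx.integrable_norm_pow (by norm_num)
  have := integral_mono ((h1.const_mul (3 * a ^ 2)).sub (integrable_const (2 * a ^ 3))) h3
    fun ω => by
      have := abs_nonneg (x ω)
      simp only [Pi.sub_apply]
      nlinarith [mul_nonneg (by linarith : 0 ≤ |x ω| + 2 * a) (sq_nonneg (|x ω| - a))]
  have h4 := integral_sub (h1.const_mul (3 * a ^ 2)) (integrable_const (μ := μ) (2 * a ^ 3))
  rw [integral_const_mul, ← ha] at h4
  simp only [Pi.sub_apply] at this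
  rw [h4] at this
  simp at this
  nlinarith

/-- Integrates `(2t + |s|)(t - |s|)² ≥ 0` at `t = |x|`. The free parameter replaces Hölder's
inequality in comparing second and third moments. -/
lemma integral_sq_mul_le {x : Ω → ℝ} (hx : MemLp x 3 μ) {s : ℝ} :
    3 * s * ∫ ω, x ω ^ 2 ∂μ ≤ 2 * ∫ ω, |x ω| ^ 3 ∂μ + |s| ^ 3 := by
  have h2 : Integrable (fun ω => x ω ^ 2) μ := (hx.mono_exponent (by norm_num)).integrable_sq
  have h3 : Integrable (fun ω => |x ω| ^ 3) μ := by simpa using hx.integrable_norm_pow (by norm_num)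
  have h4 := integral_mono (h2.const_mul (3 * s))
    ((h3.const_mul 2).add (integrable_const (|s| ^ 3))) fun ω => by
      have := abs_nonneg (x ω)
      simp only [Pi.add_apply]
      rw [← sq_abs (x ω)]
      have h6 : 3 * s * |x ω| ^ 2 ≤ 3 * |s| * |x ω| ^ 2 := by
        gcongr; exact le_abs_self s
      have := abs_nonneg s
      nlinarith [mul_nonneg (by linarith : 0 ≤ 2 * |x ω| + |s|) (sq_nonneg (|x ω| - |s|))]
  have h5 := integral_add (h3.const_mul 2) (integrable_const (μ := μ) (|s| ^ 3))
  simp only [Pi.add_apply] at h4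
  rw [h5, integral_const_mul, integral_const_mul] at h4
  simpa using h4

lemma integral_sq_mul_integral_abs_le {x : Ω → ℝ} (hx : MemLp x 3 μ) :
    (∫ ω, x ω ^ 2 ∂μ) * ∫ ω, |x ω| ∂μ ≤ ∫ ω, |x ω| ^ 3 ∂μ := by
  have h1 := integral_abs_pow_three_le hx
  have h2 := integral_sq_mul_le hx (s := ∫ ω, |x ω| ∂μ)
  rw [abs_of_nonneg (integral_nonneg fun _ => abs_nonneg _)] at h2
  linarith

end General

/-! ### Berry-Esseen bounds for independent sums, exact and perturbed -/

section BerryEsseen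

variable {Ω ι : Type*} [MeasurableSpace Ω] {μ : Measure Ω} [IsProbabilityMeasure μ]
  [Fintype ι] [DecidableEq ι] {ξ : ι → Ω → ℝ}

lemma indepFun_sum_erase (hm : ∀ i, Measurable (ξ i)) (hind : iIndepFun ξ μ) (s : Finset ι)
    (i : ι) : ξ i ⟂ᵢ[μ] fun ω => ∑ j ∈ s.erase i, ξ j ω := by
  have := (hind.indepFun_finsetSum_of_notMem hm (Finset.notMem_erase i s)).symm
  convert this using 1
  ext ω; simp

/-- Concentration with a constant width for the sum without `ξ i`. As `𝔼|ξ i|³ ≤ 1/8`, the removed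
variance is at most `1/4`, so the variance left is at least the `3/4` required by
`concentration_of_le`. -/
lemma measureReal_abs_sum_erase_sub_le (hm : ∀ i, Measurable (ξ i)) (hL : ∀ i, MemLp (ξ i) 3 μ)
    (h0 : ∀ i, ∫ ω, ξ i ω ∂μ = 0) (hind : iIndepFun ξ μ) (hv : ∑ i, ∫ ω, ξ i ω ^ 2 ∂μ = 1)
    {γ : ℝ} (hγ : 0 < γ) (hγ' : ∑ i, ∫ ω, |ξ i ω| ^ 3 ∂μ ≤ γ) (hγ8 : γ ≤ 1 / 8) (i : ι) (z : ℝ)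
    {r : ℝ} (hr : 0 ≤ r) :
    ∫ ω, |∑ j ∈ Finset.univ.erase i, ξ j ω| ∂μ ≤ 1 ∧
    μ.real {ω | |∑ j ∈ Finset.univ.erase i, ξ j ω - z| ≤ r} ≤ 2 * (r + 2 * γ) := by
  set s := Finset.univ.erase i
  have hb0 : ∀ i, 0 ≤ ∫ ω, |ξ i ω| ^ 3 ∂μ := fun i => integral_nonneg fun _ => by positivity
  have hs0 : ∀ i, 0 ≤ ∫ ω, ξ i ω ^ 2 ∂μ := fun i => integral_nonneg fun _ => by positivity
  have e2 := Finset.add_sum_erase Finset.univ (fun i => ∫ ω, ξ i ω ^ 2 ∂μ) (Finset.mem_univ i)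
  have e3 := Finset.add_sum_erase Finset.univ (fun i => ∫ ω, |ξ i ω| ^ 3 ∂μ) (Finset.mem_univ i)
  have hi3 : ∫ ω, |ξ i ω| ^ 3 ∂μ ≤ 1 / 8 :=
    (Finset.single_le_sum (fun i _ => hb0 i) (Finset.mem_univ i)).trans (hγ'.trans hγ8)
  have hi2 : ∫ ω, ξ i ω ^ 2 ∂μ ≤ 1 / 4 := by
    have := integral_sq_mul_le (hL i) (s := 1 / 2)
    norm_num at this
    linarith
  have hpw : Set.Pairwise (s : Set ι) fun i j => ξ i ⟂ᵢ[μ] ξ j :=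
    fun i _ j _ hij => hind.indepFun hij
  have hL2 : ∀ i, MemLp (ξ i) 2 μ := fun i => (hL i).mono_exponent (by norm_num)
  have habs : ∫ ω, |∑ j ∈ s, ξ j ω| ∂μ ≤ 1 := by
    refine integral_abs_le_of_integral_sq_le one_pos (memLp_finsetSum s fun i _ => hL2 i) ?_
    rw [integral_sq_sum_of_indep (fun i _ => hL2 i) (fun i _ => h0 i) hpw]
    linarith [hs0 i]
  refine ⟨habs, ?_⟩
  have h := concentration_of_le (s := s) (μ := μ) (ξ := ξ) (fun i _ => hL i) (fun i _ => h0 i) hpw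
    (by linarith) (by linarith [hs0 i])
    (D := fun _ => r) (D' := fun _ _ => r) (memLp_const r) (fun _ _ => memLp_const r)
    (fun _ => hr) (fun _ _ => hr) (fun j hj => ?_) hγ (by linarith [hb0 i]) z
  · refine h.trans ?_
    rw [integral_mul_const]
    simp only [sub_self, abs_zero, mul_zero, integral_zero, Finset.sum_const_zero]
    nlinarith
  · have h1 := (indepFun_sum_erase hm hind s j).comp (φ := id) (ψ := fun t : ℝ => (t, r))
      measurable_id (by fun_prop)
    have e : (fun ω => (∑ j ∈ s, ξ j ω - ξ j ω, r)) = (fun t : ℝ => (t, r)) ∘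
        fun ω => ∑ k ∈ s.erase j, ξ k ω := by
      ext ω
      · simp only [Function.comp]
        rw [← Finset.add_sum_erase s _ hj]; ring
      · rfl
    rw [e]
    exact h1

/-- The Berry-Esseen theorem for independent summands. -/
theorem berryEsseen (hm : ∀ i, Measurable (ξ i)) (hL : ∀ i, MemLp (ξ i) 3 μ)
    (h0 : ∀ i, ∫ ω, ξ i ω ∂μ = 0) (hind : iIndepFun ξ μ) (hv : ∑ i, ∫ ω, ξ i ω ^ 2 ∂μ = 1)
    {γ : ℝ} (hγ : 0 < γ) (hγ' : ∑ i, ∫ ω, |ξ i ω| ^ 3 ∂μ ≤ γ) (z : ℝ) :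
    |μ.real {ω | ∑ i, ξ i ω ≤ z} - Phi z| ≤ 44 * γ := by
  -- For `γ > 1/8` the right side exceeds 1.
  rcases lt_or_ge (1 / 8) γ with hγ8 | hγ8
  · have h1 : 0 ≤ μ.real {ω | ∑ i, ξ i ω ≤ z} := measureReal_nonneg
    have h2 : μ.real {ω | ∑ i, ξ i ω ≤ z} ≤ 1 := measureReal_le_one
    have h3 := Phi_nonneg z
    have h4 := Phi_le_one z
    rw [abs_le]; constructor <;> linarith
  set W : Ω → ℝ := fun ω => ∑ i, ξ i ω with hW
  have hWm : Measurable W := Finset.measurable_fun_sum _ fun i _ => hm i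
  have hL2 : ∀ i, MemLp (ξ i) 2 μ := fun i => (hL i).mono_exponent (by norm_num)
  have hbdd : ∀ {g : ℝ → ℝ} {V : Ω → ℝ} {c : ℝ}, Measurable g → Measurable V → (∀ t, |g t| ≤ c) →
      MemLp (fun ω => g (V ω)) ⊤ μ := fun hg hV hc =>
    memLp_top_of_bound (hg.comp hV).aestronglyMeasurable _ (Filter.Eventually.of_forall fun ω => hc _)
  have hmul : ∀ {a b : Ω → ℝ}, Integrable a μ → MemLp b ⊤ μ → Integrable (fun ω => a ω * b ω) μ :=
    fun ha hb => ha.mul_of_top_left hb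
  have hξI : ∀ i, Integrable (ξ i) μ := fun i => (hL i).integrable (by norm_num)
  -- The discrepancy of one summand. Both integrals are compared with `σ * 𝔼[steinDeriv z V]`, where
  -- `V` is the sum without `ξ i`; the jump terms are paid for by the concentration of `V`. The
  -- constants are `24 = 9 + 15` and `20 = 4 + 16`, from `hfirst` and `hsecond`.
  have hmain : ∀ i, |(∫ ω, ξ i ω ^ 2 ∂μ) * ∫ ω, steinDeriv z (W ω) ∂μ -
      ∫ ω, ξ i ω * stein z (W ω) ∂μ| ≤
      24 * (∫ ω, |ξ i ω| ^ 3 ∂μ) + 20 * γ * ∫ ω, ξ i ω ^ 2 ∂μ := by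
    intro i
    set V : Ω → ℝ := fun ω => ∑ j ∈ Finset.univ.erase i, ξ j ω with hV
    have hVm : Measurable V := Finset.measurable_fun_sum _ fun i _ => hm i
    have hVL : MemLp V 2 μ := memLp_finsetSum _ fun i _ => hL2 i
    have hVI : Integrable (fun ω => |V ω|) μ := (hVL.integrable (by norm_num)).abs
    have hWV : ∀ ω, W ω = V ω + ξ i ω := fun ω => by
      simp only [hW, hV]
      rw [← Finset.add_sum_erase Finset.univ _ (Finset.mem_univ i)]; ring
    have hiV : ξ i ⟂ᵢ[μ] V := indepFun_sum_erase hm hind _ i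
    have hconc := fun r hr => measureReal_abs_sum_erase_sub_le hm hL h0 hind hv hγ hγ' hγ8 i z
      (r := r) hr
    have hVabs : ∫ ω, |V ω| ∂μ ≤ 1 := (hconc 0 le_rfl).1
    set β := ∫ ω, |ξ i ω| ^ 3 ∂μ
    set σ := ∫ ω, ξ i ω ^ 2 ∂μ
    set a := ∫ ω, |ξ i ω| ∂μ
    have hσ0 : 0 ≤ σ := integral_nonneg fun _ => by positivity
    have hβ0 : 0 ≤ β := integral_nonneg fun _ => by positivity
    have ha0 : 0 ≤ a := integral_nonneg fun _ => by positivity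
    have hσa : σ * a ≤ β := integral_sq_mul_integral_abs_le (hL i)
    have hI1 : Integrable (fun ω => |ξ i ω|) μ := (hξI i).abs
    have hI2 : Integrable (fun ω => ξ i ω ^ 2) μ := (hL2 i).integrable_sq
    have hI3 : Integrable (fun ω => |ξ i ω| ^ 3) μ := by
      simpa using (hL i).integrable_norm_pow (by norm_num)
    have hnearm : MemLp (fun ω => near (V ω - z) |ξ i ω|) ⊤ μ :=
      memLp_top_of_bound (measurable_near.comp (by fun_prop :
        Measurable fun ω => (V ω - z, |ξ i ω|))).aestronglyMeasurable 1
        (Filter.Eventually.of_forall fun ω => by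
          rw [Real.norm_eq_abs, abs_of_nonneg (near_nonneg _ _)]; exact near_le_one _ _)
    have hnearI : Integrable (fun ω => near (V ω - z) |ξ i ω|) μ := hnearm.integrable (by simp)
    have hmeasF : Measurable (Function.uncurry fun t v : ℝ => near (v - z) |t|) :=
      measurable_near.comp (by fun_prop : Measurable fun q : ℝ × ℝ => (q.2 - z, |q.1|))
    have hnear0 : ∫ ω, near (V ω - z) |ξ i ω| ∂μ ≤ 2 * a + 4 * γ := by
      have := integral_le_of_indepFun (hm i) hVm hiV (F := fun t v => near (v - z) |t|)
        (b := fun t => 2 * |t| + 4 * γ) hmeasF hnearI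
        ((hI1.const_mul 2).add (integrable_const _)) (fun ω => by
          rw [integral_near hVm]
          have := (hconc _ (abs_nonneg (ξ i ω))).2
          linarith)
      rw [integral_add (hI1.const_mul 2) (integrable_const _), integral_const_mul] at this
      simpa using this
    have hnear2 : ∫ ω, ξ i ω ^ 2 * near (V ω - z) |ξ i ω| ∂μ ≤ 2 * β + 4 * γ * σ := by
      have := integral_le_of_indepFun (hm i) hVm hiV (F := fun t v => t ^ 2 * near (v - z) |t|)
        (b := fun t => 2 * |t| ^ 3 + 4 * γ * t ^ 2)
        (by simpa [Function.uncurry_def] using!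
          (by fun_prop : Measurable fun q : ℝ × ℝ => q.1 ^ 2).mul hmeasF) (hmul hI2 hnearm)
        ((hI3.const_mul 2).add (hI2.const_mul _)) (fun ω => by
          rw [integral_const_mul, integral_near hVm]
          have := (hconc _ (abs_nonneg (ξ i ω))).2
          calc _ ≤ ξ i ω ^ 2 * (2 * (|ξ i ω| + 2 * γ)) := by gcongr
            _ = _ := by rw [← sq_abs (ξ i ω)]; ring)
      rwa [integral_add (hI3.const_mul 2) (hI2.const_mul _), integral_const_mul,
        integral_const_mul] at this
    have hVx : ∀ {g : ℝ → ℝ}, Measurable g → Integrable (fun ω => g (ξ i ω)) μ →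
        Integrable (fun ω => (2 * |V ω| + 5) * g (ξ i ω)) μ ∧
        ∫ ω, (2 * |V ω| + 5) * g (ξ i ω) ∂μ = (2 * (∫ ω, |V ω| ∂μ) + 5) * ∫ ω, g (ξ i ω) ∂μ := by
      intro g hg hgi
      have hind' : (fun ω => 2 * |V ω| + 5) ⟂ᵢ[μ] (fun ω => g (ξ i ω)) :=
        hiV.symm.comp (φ := fun t => 2 * |t| + 5) (ψ := g) (by fun_prop) hg
      have hi : Integrable (fun ω => 2 * |V ω| + 5) μ := (hVI.const_mul 2).add (integrable_const _)
      refine ⟨hind'.integrable_mul hi hgi, ?_⟩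
      have := hind'.integral_mul_eq_mul_integral hi.1 hgi.1
      rw [integral_add (hVI.const_mul 2) (integrable_const _), integral_const_mul] at this
      simpa using this
    have hSD := abs_steinDeriv_le z
    have hS := abs_stein_le z
    have hfirst : |∫ ω, steinDeriv z (W ω) ∂μ - ∫ ω, steinDeriv z (V ω) ∂μ| ≤ 9 * a + 4 * γ := by
      obtain ⟨h1, h2⟩ := hVx (g := fun t => |t|) (by fun_prop) hI1
      have hIW := (hbdd (measurable_steinDeriv z) hWm hSD).integrable (q := ⊤) (by simp)
      have hIV := (hbdd (measurable_steinDeriv z) hVm hSD).integrable (q := ⊤) (by simp)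
      rw [← integral_sub hIW hIV]
      refine abs_integral_le_integral_abs.trans ?_
      calc _ ≤ ∫ ω, ((2 * |V ω| + 5) * |ξ i ω| + near (V ω - z) |ξ i ω|) ∂μ := by
            refine integral_mono (hIW.sub hIV).abs (h1.add hnearI) fun ω => ?_
            simp only
            rw [hWV]
            exact abs_steinDeriv_sub_le z (V ω) (ξ i ω)
        _ ≤ _ := by
            rw [integral_add h1 hnearI, h2]
            nlinarith
    have hsecond : |∫ ω, ξ i ω * stein z (W ω) ∂μ - σ * ∫ ω, steinDeriv z (V ω) ∂μ| ≤
        15 * β + 16 * γ * σ := by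
      obtain ⟨h1, h2⟩ := hVx (g := fun t => |t| ^ 3) (by fun_prop) hI3
      have i1 := hmul (hξI i) (hbdd (measurable_stein z) hWm hS)
      have i2 := hmul (hξI i) (hbdd (measurable_stein z) hVm hS)
      have i3 := hmul hI2 (hbdd (measurable_steinDeriv z) hVm hSD)
      have z2 : ∫ ω, ξ i ω * stein z (V ω) ∂μ = 0 := by
        have := (hiV.comp (φ := id) (ψ := stein z) measurable_id
          (measurable_stein z)).integral_mul_eq_mul_integral (hm i).aestronglyMeasurable
          ((measurable_stein z).comp hVm).aestronglyMeasurable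
        simp only [Function.id_comp, h0 i, zero_mul] at this
        exact this
      have z3 : ∫ ω, ξ i ω ^ 2 * steinDeriv z (V ω) ∂μ = σ * ∫ ω, steinDeriv z (V ω) ∂μ :=
        (hiV.comp (φ := fun t => t ^ 2) (ψ := steinDeriv z) (by fun_prop)
          (measurable_steinDeriv z)).integral_mul_eq_mul_integral
          ((hm i).pow_const 2).aestronglyMeasurable
          ((measurable_steinDeriv z).comp hVm).aestronglyMeasurable
      rw [← z3, ← sub_zero (∫ ω, ξ i ω * stein z (W ω) ∂μ), ← z2, ← integral_sub i1 i2,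
        ← integral_sub (f := fun ω => ξ i ω * stein z (W ω) - ξ i ω * stein z (V ω)) (i1.sub i2) i3]
      refine abs_integral_le_integral_abs.trans ?_
      have i4 := (hmul hI2 hnearm).const_mul 4
      calc _ ≤ ∫ ω, ((2 * |V ω| + 5) * |ξ i ω| ^ 3 +
              4 * (ξ i ω ^ 2 * near (V ω - z) |ξ i ω|)) ∂μ := by
            refine integral_mono ((i1.sub i2).sub i3).abs (h1.add i4) fun ω => ?_
            simp only
            have h := abs_stein_taylor_le z (V ω) (ξ i ω)
            rw [hWV]
            calc _ = |ξ i ω| * |stein z (V ω + ξ i ω) - stein z (V ω) -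
                  ξ i ω * steinDeriv z (V ω)| := by
                  rw [← abs_mul]; congr 1; ring
              _ ≤ |ξ i ω| * (|ξ i ω| * ((2 * |V ω| + 5) * |ξ i ω| +
                  4 * near (V ω - z) |ξ i ω|)) := by gcongr
              _ = _ := by rw [← sq_abs (ξ i ω)]; ring
        _ ≤ _ := by
            rw [integral_add h1 i4, h2, integral_const_mul]
            nlinarith
    have e : σ * ∫ ω, steinDeriv z (W ω) ∂μ - ∫ ω, ξ i ω * stein z (W ω) ∂μ =
        σ * (∫ ω, steinDeriv z (W ω) ∂μ - ∫ ω, steinDeriv z (V ω) ∂μ) -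
        (∫ ω, ξ i ω * stein z (W ω) ∂μ - σ * ∫ ω, steinDeriv z (V ω) ∂μ) := by ring
    rw [e]
    calc _ ≤ |σ * (∫ ω, steinDeriv z (W ω) ∂μ - ∫ ω, steinDeriv z (V ω) ∂μ)| +
          |∫ ω, ξ i ω * stein z (W ω) ∂μ - σ * ∫ ω, steinDeriv z (V ω) ∂μ| := abs_sub _ _
      _ ≤ σ * (9 * a + 4 * γ) + (15 * β + 16 * γ * σ) := by
          rw [abs_mul, abs_of_nonneg hσ0]; gcongr
      _ ≤ _ := by nlinarith
  -- The Stein equation at `W`, integrated. Since the variances sum to 1, the right side splits into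
  -- the discrepancies of `hmain`.
  have hst : μ.real {ω | W ω ≤ z} - Phi z =
      ∫ ω, steinDeriv z (W ω) ∂μ - ∫ ω, W ω * stein z (W ω) ∂μ := by
    have hIW := (hbdd (measurable_steinDeriv z) hWm (abs_steinDeriv_le z)).integrable
      (q := ⊤) (by simp)
    have hIWs := hmul ((memLp_finsetSum Finset.univ fun i _ => hL2 i).integrable (by norm_num))
      (hbdd (measurable_stein z) hWm (abs_stein_le z))
    rw [← integral_sub hIW hIWs, ← integral_indicator_one (measurableSet_le hWm measurable_const)]
    have hIi : Integrable ({ω | W ω ≤ z}.indicator (1 : Ω → ℝ)) μ :=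
      (integrable_const (1 : ℝ)).indicator (measurableSet_le hWm measurable_const)
    have h1 : Phi z = ∫ _, Phi z ∂μ := by simp
    rw [h1, ← integral_sub hIi (integrable_const _)]
    congr 1; ext ω
    simp only [steinDeriv, Set.indicator, Set.mem_ofPred_eq, Pi.one_apply]
    ring
  have hsum : ∫ ω, steinDeriv z (W ω) ∂μ - ∫ ω, W ω * stein z (W ω) ∂μ =
      ∑ i, ((∫ ω, ξ i ω ^ 2 ∂μ) * ∫ ω, steinDeriv z (W ω) ∂μ -
      ∫ ω, ξ i ω * stein z (W ω) ∂μ) := by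
    rw [Finset.sum_sub_distrib, ← Finset.sum_mul, hv, one_mul, ← integral_finsetSum]
    · simp only [hW, Finset.sum_mul]
    · exact fun i _ => hmul (hξI i) (hbdd (measurable_stein z) hWm (abs_stein_le z))
  rw [hst, hsum]
  calc _ ≤ ∑ i, (24 * (∫ ω, |ξ i ω| ^ 3 ∂μ) + 20 * γ * ∫ ω, ξ i ω ^ 2 ∂μ) :=
        (Finset.abs_sum_le_sum_abs _ _).trans (Finset.sum_le_sum fun i _ => hmain i)
    _ = 24 * ∑ i, (∫ ω, |ξ i ω| ^ 3 ∂μ) + 20 * γ := by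
        rw [Finset.sum_add_distrib, ← Finset.mul_sum, ← Finset.mul_sum, hv, mul_one]
    _ ≤ _ := by linarith

/-- The Berry-Esseen theorem for a perturbed sum of independent variables. -/
theorem berryEsseen_add (hm : ∀ i, Measurable (ξ i)) (hL : ∀ i, MemLp (ξ i) 3 μ)
    (h0 : ∀ i, ∫ ω, ξ i ω ∂μ = 0) (hind : iIndepFun ξ μ) (hv : ∑ i, ∫ ω, ξ i ω ^ 2 ∂μ = 1)
    {γ : ℝ} (hγ : 0 < γ) (hγ' : ∑ i, ∫ ω, |ξ i ω| ^ 3 ∂μ ≤ γ)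
    {Δ : Ω → ℝ} {Δ' : ι → Ω → ℝ} (hΔ : MemLp Δ 2 μ) (hΔ' : ∀ i, MemLp (Δ' i) 2 μ)
    (hind' : ∀ i, ξ i ⟂ᵢ[μ] fun ω => (∑ j, ξ j ω - ξ i ω, Δ' i ω)) (z : ℝ) :
    |μ.real {ω | ∑ i, ξ i ω + Δ ω ≤ z} - Phi z| ≤
      48 * γ + 2 * (∫ ω, |∑ i, ξ i ω| * |Δ ω| ∂μ + ∑ i, ∫ ω, |ξ i ω| * |Δ ω - Δ' i ω| ∂μ) := by
  have hL2 : ∀ i, MemLp (ξ i) 2 μ := fun i => (hL i).mono_exponent (by norm_num)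
  have h1 := berryEsseen hm hL h0 hind hv hγ hγ' z
  have h2 := concentration_of_le (s := Finset.univ) (μ := μ) (ξ := ξ) (fun i _ => hL i)
    (fun i _ => h0 i) (fun i _ j _ hij => hind.indepFun hij) (by rw [hv]; norm_num) hv.le
    (D := fun ω => |Δ ω|) (D' := fun i ω => |Δ' i ω|) hΔ.abs (fun i _ => (hΔ' i).abs)
    (fun _ => abs_nonneg _) (fun _ _ => abs_nonneg _)
    (fun i _ => (hind' i).comp (φ := id) (ψ := fun q : ℝ × ℝ => (q.1, |q.2|)) measurable_id
      (by fun_prop)) hγ hγ' z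
  have h3 : ∑ i, ∫ ω, |ξ i ω| * |(|Δ ω| - |Δ' i ω|)| ∂μ ≤
      ∑ i, ∫ ω, |ξ i ω| * |Δ ω - Δ' i ω| ∂μ := by
    refine Finset.sum_le_sum fun i _ => integral_mono
      ((hL2 i).abs.integrable_mul (hΔ.abs.sub (hΔ' i).abs).abs)
      ((hL2 i).abs.integrable_mul (hΔ.sub (hΔ' i)).abs) fun ω => ?_
    simp only
    exact mul_le_mul_of_nonneg_left (abs_abs_sub_abs_le _ _) (abs_nonneg _)
  -- The perturbation changes the event only where the sum lies within `|Δ|` of `z`. The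
  -- concentration inequality bounds this probability and adds `4γ` to the `44γ` of `berryEsseen`.
  have h4 : |μ.real {ω | ∑ i, ξ i ω + Δ ω ≤ z} - μ.real {ω | ∑ i, ξ i ω ≤ z}| ≤
      μ.real {ω | |∑ i, ξ i ω - z| ≤ |Δ ω|} := by
    have ha : μ.real {ω | ∑ i, ξ i ω + Δ ω ≤ z} ≤
        μ.real ({ω | ∑ i, ξ i ω ≤ z} ∪ {ω | |∑ i, ξ i ω - z| ≤ |Δ ω|}) :=
      measureReal_mono fun ω hω => by
        simp only [Set.mem_union, Set.mem_ofPred_eq] at hω ⊢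
        by_cases h : ∑ i, ξ i ω ≤ z
        · exact Or.inl h
        · right
          rw [abs_of_pos (by linarith)]
          linarith [neg_abs_le (Δ ω)]
    have hb : μ.real {ω | ∑ i, ξ i ω ≤ z} ≤
        μ.real ({ω | ∑ i, ξ i ω + Δ ω ≤ z} ∪ {ω | |∑ i, ξ i ω - z| ≤ |Δ ω|}) :=
      measureReal_mono fun ω hω => by
        simp only [Set.mem_union, Set.mem_ofPred_eq] at hω ⊢
        by_cases h : ∑ i, ξ i ω + Δ ω ≤ z
        · exact Or.inl h
        · right
          rw [abs_of_nonpos (by linarith)]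
          linarith [le_abs_self (Δ ω)]
    have ha' := ha.trans (measureReal_union_le _ _)
    have hb' := hb.trans (measureReal_union_le _ _)
    rw [abs_le]; constructor <;> linarith
  have h5 := abs_sub_le (μ.real {ω | ∑ i, ξ i ω + Δ ω ≤ z}) (μ.real {ω | ∑ i, ξ i ω ≤ z}) (Phi z)
  linarith

end BerryEsseen

/-! ### Product measures, resampling a coordinate, and degenerate functions -/

section Pi

variable {M ι κ : Type*} [MeasurableSpace M] {P : Measure M} [IsProbabilityMeasure P]
  [Fintype ι] [DecidableEq ι] [Fintype κ]

lemma measurable_update_prod (i : ι) :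
    Measurable fun q : (ι → M) × M => Function.update q.1 i q.2 := by
  refine measurable_pi_iff.2 fun j => ?_
  rcases eq_or_ne j i with rfl | h
  · simpa using! measurable_snd
  · simpa [Function.update_of_ne h] using! (measurable_pi_apply j).comp measurable_fst

/-- Replacing one coordinate by a fresh copy preserves the product law. This makes averaging over
coordinate `i` an ordinary integral and stands in for conditional expectations throughout. -/
lemma measurePreserving_update (i : ι) :
    MeasurePreserving (fun q : (ι → M) × M => Function.update q.1 i q.2)
      ((Measure.pi fun _ : ι => P).prod P) (Measure.pi fun _ : ι => P) := by
  refine ⟨measurable_update_prod i, (Measure.pi_eq fun s hs => ?_).symm⟩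
  rw [Measure.map_apply (measurable_update_prod i) (MeasurableSet.univ_pi hs)]
  have e : (fun q : (ι → M) × M => Function.update q.1 i q.2) ⁻¹' Set.univ.pi s =
      (Set.univ.pi (Function.update s i Set.univ)) ×ˢ s i := by
    ext ⟨x, t⟩
    simp only [Set.mem_preimage, Set.mem_univ_pi, Set.mem_prod]
    constructor
    · intro h
      refine ⟨fun j => ?_, by simpa using h i⟩
      rcases eq_or_ne j i with rfl | hj
      · simp
      · simpa [hj] using h j
    · rintro ⟨h1, h2⟩ j
      rcases eq_or_ne j i with rfl | hj
      · simpa using h2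
      · simpa [hj] using h1 j
  rw [e, Measure.prod_prod, Measure.pi_pi,
    ← Finset.mul_prod_erase Finset.univ (fun j => P (Function.update s i Set.univ j))
      (Finset.mem_univ i),
    ← Finset.prod_erase_mul Finset.univ (fun j => P (s j)) (Finset.mem_univ i)]
  simp only [Function.update_self, measure_univ, one_mul]
  congr 1
  refine Finset.prod_congr rfl fun j hj => ?_
  rw [Function.update_of_ne (Finset.ne_of_mem_erase hj)]

lemma measurePreserving_comp_injective {e : κ → ι} (he : Function.Injective e) :
    MeasurePreserving (fun x : ι → M => fun k => x (e k))
      (Measure.pi fun _ : ι => P) (Measure.pi fun _ : κ => P) := by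
  have h0 : iIndepFun (fun (i : ι) (x : ι → M) => x i) (Measure.pi fun _ : ι => P) :=
    iIndepFun_pi (X := fun _ => id) fun _ => aemeasurable_id
  have h1 := h0.precomp he
  rw [iIndepFun_iff_map_fun_eq_pi_map fun k => (measurable_pi_apply (e k)).aemeasurable] at h1
  refine ⟨by fun_prop, h1.trans ?_⟩
  congr 1; ext1 k
  exact (measurePreserving_eval (fun _ : ι => P) (e k)).map_eq

/-- `F` does not depend on the coordinate `i`. -/
def IndepOfCoord (F : (ι → M) → ℝ) (i : ι) : Prop := ∀ x t, F (Function.update x i t) = F x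

variable (P) in
/-- Averaging `F` over the coordinate `i` gives zero. -/
def Degenerate (F : (ι → M) → ℝ) (i : ι) : Prop :=
  ∀ᵐ x ∂(Measure.pi fun _ : ι => P), ∫ t, F (Function.update x i t) ∂P = 0

lemma IndepOfCoord.sum {α : Type*} {F : α → (ι → M) → ℝ} {i : ι} {s : Finset α}
    (h : ∀ a ∈ s, IndepOfCoord (F a) i) : IndepOfCoord (fun x => ∑ a ∈ s, F a x) i :=
  fun x t => Finset.sum_congr rfl fun a ha => h a ha x t

lemma IndepOfCoord.comp {F : (ι → M) → ℝ} {i : ι} (h : IndepOfCoord F i) (g : ℝ → ℝ) :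
    IndepOfCoord (fun x => g (F x)) i := fun x t => congrArg g (h x t)

lemma integral_eq_integral_integral_update {F : (ι → M) → ℝ}
    (hF : Integrable F (Measure.pi fun _ : ι => P)) (i : ι) :
    ∫ x, F x ∂(Measure.pi fun _ : ι => P) =
      ∫ x, ∫ t, F (Function.update x i t) ∂P ∂(Measure.pi fun _ : ι => P) := by
  have h := measurePreserving_update (P := P) i
  have h1 : ∫ x, F x ∂(Measure.pi fun _ : ι => P) =
      ∫ q, F (Function.update q.1 i q.2) ∂((Measure.pi fun _ : ι => P).prod P) := by
    rw [← h.map_eq] at hF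
    rw [← h.map_eq, integral_map h.measurable.aemeasurable hF.1, h.map_eq]
  rw [h1, integral_prod (fun q : (ι → M) × M => F (Function.update q.1 i q.2))
    (h.integrable_comp_of_integrable hF)]

lemma integrable_update_ae {F : (ι → M) → ℝ}
    (hF : Integrable F (Measure.pi fun _ : ι => P)) (i : ι) :
    ∀ᵐ x ∂(Measure.pi fun _ : ι => P), Integrable (fun t => F (Function.update x i t)) P :=
  ((measurePreserving_update (P := P) i).integrable_comp_of_integrable hF).prod_right_ae

lemma Degenerate.sum {α : Type*} {F : α → (ι → M) → ℝ} {i : ι} {s : Finset α}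
    (hI : ∀ a ∈ s, Integrable (F a) (Measure.pi fun _ : ι => P))
    (h : ∀ a ∈ s, Degenerate P (F a) i) : Degenerate P (fun x => ∑ a ∈ s, F a x) i := by
  have h1 : ∀ᵐ x ∂(Measure.pi fun _ : ι => P), ∀ a ∈ s,
      Integrable (fun t => F a (Function.update x i t)) P ∧
      ∫ t, F a (Function.update x i t) ∂P = 0 := by
    rw [Finset.eventually_all]
    exact fun a ha => (integrable_update_ae (hI a ha) i).and (h a ha)
  filter_upwards [h1] with x hx
  rw [integral_finsetSum _ fun a ha => (hx a ha).1]
  exact Finset.sum_eq_zero fun a ha => (hx a ha).2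

lemma integral_mul_eq_zero_of_degenerate {A B : (ι → M) → ℝ} {i : ι} (hA : IndepOfCoord A i)
    (hB : Degenerate P B i) (hAB : Integrable (fun x => A x * B x) (Measure.pi fun _ : ι => P)) :
    ∫ x, A x * B x ∂(Measure.pi fun _ : ι => P) = 0 := by
  rw [integral_eq_integral_integral_update hAB i]
  refine integral_eq_zero_of_ae ?_
  filter_upwards [hB] with x hx
  simp only [hA x, integral_const_mul, hx, mul_zero, Pi.zero_apply]

/-- Under resampling of coordinate `i`, the event `{x i ∈ s, F ∈ t}` pulls back to the rectangle `F
⁻¹' t ×ˢ s`, whose measure factors. -/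
lemma IndepOfCoord.indepFun {N : Type*} [MeasurableSpace N] {F : (ι → M) → N} (hF : Measurable F)
    {i : ι} (h : ∀ x t, F (Function.update x i t) = F x) :
    (fun x : ι → M => x i) ⟂ᵢ[Measure.pi fun _ : ι => P] F := by
  rw [indepFun_iff_measure_inter_preimage_eq_mul]
  intro s t hs ht
  have hu := measurePreserving_update (P := P) i
  have hm1 : MeasurableSet ((fun x : ι → M => x i) ⁻¹' s) := measurable_pi_apply i hs
  have hm2 : MeasurableSet (F ⁻¹' t) := hF ht
  have e : (fun q : (ι → M) × M => Function.update q.1 i q.2) ⁻¹'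
      ((fun x : ι → M => x i) ⁻¹' s ∩ F ⁻¹' t) = (F ⁻¹' t) ×ˢ s := by
    ext ⟨x, u⟩
    simp [h, and_comm]
  rw [← hu.measure_preimage (hm1.inter hm2).nullMeasurableSet, e, Measure.prod_prod,
    ← (measurePreserving_eval (fun _ : ι => P) i).measure_preimage hs.nullMeasurableSet, mul_comm]

/-- Orthogonality: of two distinct index sets one contains a coordinate missing from the other, and
averaging over that coordinate kills the product. -/
lemma integral_sq_sum_of_degenerate {F : Finset ι → (ι → M) → ℝ} {𝒥 : Finset (Finset ι)}
    (hL : ∀ J ∈ 𝒥, MemLp (F J) 2 (Measure.pi fun _ : ι => P))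
    (hI : ∀ J ∈ 𝒥, ∀ i ∉ J, IndepOfCoord (F J) i) (hD : ∀ J ∈ 𝒥, ∀ i ∈ J, Degenerate P (F J) i) :
    ∫ x, (∑ J ∈ 𝒥, F J x) ^ 2 ∂(Measure.pi fun _ : ι => P) =
      ∑ J ∈ 𝒥, ∫ x, F J x ^ 2 ∂(Measure.pi fun _ : ι => P) := by
  have hint : ∀ J ∈ 𝒥, ∀ J' ∈ 𝒥, Integrable (fun x => F J x * F J' x)
    (Measure.pi fun _ : ι => P) := fun J hJ J' hJ' => (hL J hJ).integrable_mul (hL J' hJ')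
  have hzero : ∀ J ∈ 𝒥, ∀ J' ∈ 𝒥, J ≠ J' → (∃ i ∈ J', i ∉ J) →
      ∫ x, F J x * F J' x ∂(Measure.pi fun _ : ι => P) = 0 := by
    rintro J hJ J' hJ' - ⟨i, hi, hi'⟩
    exact integral_mul_eq_zero_of_degenerate (hI J hJ i hi') (hD J' hJ' i hi) (hint J hJ J' hJ')
  have hzero' : ∀ J ∈ 𝒥, ∀ J' ∈ 𝒥, J ≠ J' →
      ∫ x, F J x * F J' x ∂(Measure.pi fun _ : ι => P) = 0 := by
    intro J hJ J' hJ' hne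
    by_cases h : J' ⊆ J
    · have h2 : ¬ J ⊆ J' := fun h2 => hne (h2.antisymm h)
      obtain ⟨i, hi, hi'⟩ := Finset.not_subset.1 h2
      simp only [mul_comm (F J _)]
      exact hzero J' hJ' J hJ hne.symm ⟨i, hi, hi'⟩
    · obtain ⟨i, hi, hi'⟩ := Finset.not_subset.1 h
      exact hzero J hJ J' hJ' hne ⟨i, hi, hi'⟩
  simp only [sq, Finset.sum_mul_sum]
  rw [integral_finsetSum _ fun J hJ => integrable_finsetSum _ fun J' hJ' => hint J hJ J' hJ']
  refine Finset.sum_congr rfl fun J hJ => ?_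
  rw [integral_finsetSum _ fun J' hJ' => hint J hJ J' hJ',
    Finset.sum_eq_single_of_mem J hJ fun J' hJ' hne => hzero' J hJ J' hJ' hne.symm]

end Pi

/-! ### A von Bahr-Esseen inequality with exponent 3/2 -/

/-- The signed square root. -/
noncomputable def signedSqrt (x : ℝ) : ℝ := Real.sign x * √|x|

lemma abs_signedSqrt_sub_le (x y : ℝ) : |signedSqrt x - signedSqrt y| ≤ 2 * √(|x - y|) := by
  wlog hxy : y ≤ x generalizing x y
  · rw [abs_sub_comm, abs_sub_comm x]; exact this y x (le_of_not_ge hxy)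
  have key : ∀ a b : ℝ, 0 ≤ a → 0 ≤ b → b ≤ a → √a - √b ≤ √(a - b) := fun a b ha hb hab => by
    rw [sub_le_iff_le_add]
    refine Real.sqrt_le_iff.2 ⟨by positivity, ?_⟩
    nlinarith [Real.sq_sqrt (sub_nonneg.2 hab), Real.sq_sqrt hb,
      mul_nonneg (Real.sqrt_nonneg (a - b)) (Real.sqrt_nonneg b)]
  have hs : ∀ x : ℝ, 0 ≤ x → signedSqrt x = √x := fun x hx => by
    rw [signedSqrt]
    rcases hx.lt_or_eq with h | rfl
    · rw [Real.sign_of_pos h, abs_of_pos h, one_mul]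
    · simp
  have hs' : ∀ x : ℝ, x ≤ 0 → signedSqrt x = -√(-x) := fun x hx => by
    rw [signedSqrt]
    rcases hx.lt_or_eq with h | rfl
    · rw [Real.sign_of_neg h, abs_of_neg h]; ring
    · simp
  have h0 := Real.sqrt_nonneg (x - y)
  rw [abs_of_nonneg (sub_nonneg.2 hxy)]
  rcases le_total 0 x with hx | hx <;> rcases le_total 0 y with hy | hy
  · rw [hs x hx, hs y hy, abs_of_nonneg (sub_nonneg.2 (Real.sqrt_le_sqrt hxy))]
    linarith [key x y hx hy hxy]
  · rw [hs x hx, hs' y hy, abs_of_nonneg (by have := Real.sqrt_nonneg x; have := Real.sqrt_nonneg (-y); linarith)]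
    have h1 : √x ≤ √(x - y) := Real.sqrt_le_sqrt (by linarith)
    have h2 : √(-y) ≤ √(x - y) := Real.sqrt_le_sqrt (by linarith)
    linarith
  · have : x = 0 := by linarith
    have : y = 0 := by linarith
    simp [*]
  · rw [hs' x hx, hs' y hy]
    have h1 : √(-x) ≤ √(-y) := Real.sqrt_le_sqrt (by linarith)
    have h2 := key (-y) (-x) (by linarith) (by linarith) (by linarith)
    rw [abs_of_nonneg (by linarith)]
    have e : -y - -x = x - y := by ring
    rw [e] at h2
    linarith

lemma rpow_three_halves {x : ℝ} (hx : 0 ≤ x) : x ^ (3 / 2 : ℝ) = x * √x := by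
  rw [Real.sqrt_eq_rpow, ← Real.rpow_one_add' hx (by norm_num)]
  norm_num

lemma hasDerivAt_abs_rpow_three_halves (x : ℝ) :
    HasDerivAt (fun x : ℝ => |x| ^ (3 / 2 : ℝ)) (3 / 2 * signedSqrt x) x := by
  unfold signedSqrt
  refine (hasDerivAt_abs_rpow x (by norm_num : (1 : ℝ) < 3 / 2)).congr_deriv ?_
  rcases lt_trichotomy x 0 with h | rfl | h
  · rw [Real.sign_of_neg h, abs_of_neg h, Real.sqrt_eq_rpow]
    have h1 : (-x) ^ (3 / 2 - 2 : ℝ) = (-x) ^ (1 / 2 : ℝ) / (-x) := by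
      rw [show (3 / 2 - 2 : ℝ) = 1 / 2 - 1 by norm_num, Real.rpow_sub_one (by linarith)]
    rw [h1]
    field_simp [h.ne]
  · simp
  · rw [Real.sign_of_pos h, abs_of_pos h, Real.sqrt_eq_rpow]
    have h1 : x ^ (3 / 2 - 2 : ℝ) = x ^ (1 / 2 : ℝ) / x := by
      rw [show (3 / 2 - 2 : ℝ) = 1 / 2 - 1 by norm_num, Real.rpow_sub_one h.ne']
    rw [h1]
    field_simp

/-- The derivative `3/2 * signedSqrt` is Hölder of order `1/2`, so the first-order expansion at `a`
has remainder at most `3|b|^{3/2}`. Its linear term is the one that vanishes on integration against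
a degenerate `b`. -/
lemma abs_add_rpow_three_halves_le (a b : ℝ) :
    |a + b| ^ (3 / 2 : ℝ) ≤
      |a| ^ (3 / 2 : ℝ) + 3 / 2 * signedSqrt a * b + 3 * |b| ^ (3 / 2 : ℝ) := by
  have := (convex_Icc (0 : ℝ) 1).norm_image_sub_le_of_norm_hasDerivWithin_le
    (f := fun θ => |a + θ * b| ^ (3 / 2 : ℝ) - θ * (3 / 2 * signedSqrt a * b))
    (f' := fun θ => 3 / 2 * signedSqrt (a + θ * b) * b -
      3 / 2 * signedSqrt a * b)
    (C := 3 * |b| ^ (3 / 2 : ℝ)) (fun θ hθ => ?_) (fun θ hθ => ?_)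
    (x := 0) (y := 1) (by simp) (by simp)
  · simp only [one_mul, zero_mul, add_zero, sub_zero, norm_one, mul_one, Real.norm_eq_abs] at this
    linarith [le_abs_self (|a + b| ^ (3 / 2 : ℝ) - 3 / 2 * signedSqrt a * b -
      |a| ^ (3 / 2 : ℝ))]
  · have h2 : HasDerivAt (fun θ : ℝ => a + θ * b) b θ := by
      simpa using ((hasDerivAt_id θ).mul_const b).const_add a
    have h3 : HasDerivAt (fun θ : ℝ => θ * (3 / 2 * signedSqrt a * b))
        (3 / 2 * signedSqrt a * b) θ := by
      simpa using ((hasDerivAt_id θ).mul_const (3 / 2 * signedSqrt a * b))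
    exact (((hasDerivAt_abs_rpow_three_halves (a + θ * b)).comp θ h2).sub h3).hasDerivWithinAt
  · have h1 := abs_signedSqrt_sub_le (a + θ * b) a
    have h2 : √(|a + θ * b - a|) ≤ √(|b|) := by
      refine Real.sqrt_le_sqrt ?_
      rw [add_sub_cancel_left, abs_mul, abs_of_nonneg hθ.1]
      exact mul_le_of_le_one_left (abs_nonneg _) hθ.2
    rw [Real.norm_eq_abs, rpow_three_halves (abs_nonneg b)]
    calc _ = 3 / 2 * |signedSqrt (a + θ * b) - signedSqrt a| * |b| := by
          rw [← abs_of_pos (by norm_num : (0 : ℝ) < 3 / 2), ← abs_mul, ← abs_mul]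
          rw [abs_of_pos (by norm_num : (0 : ℝ) < 3 / 2)]
          congr 1; ring
      _ ≤ 3 / 2 * (2 * √(|b|)) * |b| := by gcongr; linarith
      _ = _ := by ring

lemma abs_signedSqrt (x : ℝ) : |signedSqrt x| = √(|x|) := by
  rcases lt_trichotomy x 0 with h | rfl | h
  · rw [signedSqrt, Real.sign_of_neg h, neg_one_mul, abs_neg, abs_of_nonneg (Real.sqrt_nonneg _)]
  · simp [signedSqrt]
  · rw [signedSqrt, Real.sign_of_pos h, one_mul, abs_of_nonneg (Real.sqrt_nonneg _)]

lemma continuous_signedSqrt : Continuous signedSqrt := by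
  refine continuous_iff_continuousAt.2 fun x => ?_
  have h : Filter.Tendsto (fun y => 2 * √(|y - x|)) (nhds x) (nhds 0) := by
    have : Continuous fun y : ℝ => 2 * √(|y - x|) := by fun_prop
    simpa using this.tendsto x
  refine tendsto_iff_dist_tendsto_zero.2 (squeeze_zero (fun _ => dist_nonneg) (fun y => ?_) h)
  exact abs_signedSqrt_sub_le y x

section LpThreeHalves

variable {Ω : Type*} [MeasurableSpace Ω] {μ : Measure Ω}

lemma integrable_abs_rpow_three_halves {f : Ω → ℝ} (hf : MemLp f (3 / 2 : ENNReal) μ) :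
    Integrable (fun ω => |f ω| ^ (3 / 2 : ℝ)) μ := by
  have := hf.integrable_norm_rpow (by simp) (ENNReal.div_ne_top (by simp) (by simp))
  simpa using this

lemma memLp_three_halves_iff {f : Ω → ℝ} (hf : AEStronglyMeasurable f μ) :
    MemLp f (3 / 2 : ENNReal) μ ↔ Integrable (fun ω => |f ω| ^ (3 / 2 : ℝ)) μ := by
  have := integrable_norm_rpow_iff (p := (3 / 2 : ENNReal)) hf (by simp)
    (ENNReal.div_ne_top (by simp) (by simp))
  simpa using this.symm

/-- The product of a function in `L³` and a function in `L^{3/2}` is integrable. -/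
lemma MemLp.integrable_mul_three_halves {f g : Ω → ℝ} (hf : MemLp f 3 μ)
    (hg : MemLp g (3 / 2 : ENNReal) μ) : Integrable (fun ω => f ω * g ω) μ := by
  have : ENNReal.HolderConjugate 3 (3 / 2) := by
    rw [ENNReal.holderConjugate_iff, ENNReal.inv_div (by simp) (by simp)]
    rw [← ENNReal.toReal_eq_one_iff, ENNReal.toReal_add (by simp) (ENNReal.div_ne_top (by simp) (by simp))]
    norm_num
  exact hf.integrable_mul hg

lemma MemLp.signedSqrt_three {f : Ω → ℝ} (hf : MemLp f (3 / 2 : ENNReal) μ) :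
    MemLp (fun ω => signedSqrt (f ω)) 3 μ := by
  rw [← integrable_norm_rpow_iff (continuous_signedSqrt.comp_aestronglyMeasurable hf.1)
    (by simp) (by simp)]
  refine (integrable_abs_rpow_three_halves hf).congr (Filter.Eventually.of_forall fun ω => ?_)
  simp only [Real.norm_eq_abs, abs_signedSqrt]
  rw [Real.sqrt_eq_rpow, ← Real.rpow_mul (abs_nonneg _)]
  norm_num

end LpThreeHalves

section Family

variable {M ι : Type*} [MeasurableSpace M] {P : Measure M} [IsProbabilityMeasure P]
  [Fintype ι] [DecidableEq ι]

/-- A von Bahr-Esseen type inequality for a single martingale difference. -/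
lemma integral_abs_add_rpow_three_halves_le {A B : (ι → M) → ℝ} {i : ι}
    (hA : IndepOfCoord A i) (hB : Degenerate P B i)
    (hAL : MemLp A (3 / 2 : ENNReal) (Measure.pi fun _ : ι => P))
    (hBL : MemLp B (3 / 2 : ENNReal) (Measure.pi fun _ : ι => P)) :
    ∫ x, |A x + B x| ^ (3 / 2 : ℝ) ∂(Measure.pi fun _ : ι => P) ≤
      ∫ x, |A x| ^ (3 / 2 : ℝ) ∂(Measure.pi fun _ : ι => P) +
        3 * ∫ x, |B x| ^ (3 / 2 : ℝ) ∂(Measure.pi fun _ : ι => P) := by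
  have i1 := integrable_abs_rpow_three_halves hAL
  have i2 := integrable_abs_rpow_three_halves hBL
  have i3 := integrable_abs_rpow_three_halves (hAL.add hBL)
  have i4 : Integrable (fun x => (3 / 2 * signedSqrt (A x)) * B x) (Measure.pi fun _ : ι => P) :=
    MemLp.integrable_mul_three_halves ((MemLp.signedSqrt_three hAL).const_mul _) hBL
  have h4 := integral_mul_eq_zero_of_degenerate (hA.comp fun t => 3 / 2 * signedSqrt t) hB i4
  calc _ ≤ ∫ x, (|A x| ^ (3 / 2 : ℝ) + (3 / 2 * signedSqrt (A x)) * B x +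
        3 * |B x| ^ (3 / 2 : ℝ)) ∂(Measure.pi fun _ : ι => P) :=
        integral_mono i3 ((i1.add i4).add (i2.const_mul 3)) fun x =>
          abs_add_rpow_three_halves_le (A x) (B x)
    _ = _ := by
      have e1 := integral_add (i1.add i4) (i2.const_mul 3)
      have e2 := integral_add i1 i4
      simp only [Pi.add_apply] at e1
      rw [e1, e2, integral_const_mul, h4, add_zero]

/-- Coordinates are treated one at a time: the family is split by whether `i ∈ J`, the part with `i`
is degenerate in `i` and the rest does not see `i`, so only the former pays a factor 3. The
hypothesis that `J ∩ s` determines `J` survives the split and leaves at most one term when `s` is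
exhausted. -/
lemma integral_abs_sum_rpow_three_halves_le_aux {F : Finset ι → (ι → M) → ℝ} (s : Finset ι) :
    ∀ 𝒥 : Finset (Finset ι),
    (∀ J ∈ 𝒥, MemLp (F J) (3 / 2 : ENNReal) (Measure.pi fun _ : ι => P)) →
    (∀ J ∈ 𝒥, ∀ i ∉ J, IndepOfCoord (F J) i) → (∀ J ∈ 𝒥, ∀ i ∈ J, Degenerate P (F J) i) →
    (∀ J ∈ 𝒥, ∀ J' ∈ 𝒥, J ∩ s = J' ∩ s → J = J') →
    ∫ x, |∑ J ∈ 𝒥, F J x| ^ (3 / 2 : ℝ) ∂(Measure.pi fun _ : ι => P) ≤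
      ∑ J ∈ 𝒥, 3 ^ (J ∩ s).card * ∫ x, |F J x| ^ (3 / 2 : ℝ) ∂(Measure.pi fun _ : ι => P) := by
  induction s using Finset.induction_on with
  | empty =>
    intro 𝒥 _ _ _ hinj
    rcases 𝒥.eq_empty_or_nonempty with rfl | ⟨J, hJ⟩
    · simp
    · have e : 𝒥 = {J} := Finset.eq_singleton_iff_unique_mem.2
        ⟨hJ, fun J' hJ' => hinj _ hJ' _ hJ (by simp)⟩
      simp [e]
  | insert i s his ih =>
    intro 𝒥 hL hI hD hinj
    set 𝒜 := 𝒥.filter fun J => i ∉ J with h𝒜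
    set ℬ := 𝒥.filter fun J => ¬ i ∉ J with hℬ
    have hA𝒥 : ∀ J ∈ 𝒜, J ∈ 𝒥 ∧ i ∉ J := fun J hJ => Finset.mem_filter.1 hJ
    have hB𝒥 : ∀ J ∈ ℬ, J ∈ 𝒥 ∧ i ∈ J := fun J hJ => by
      simpa [hℬ] using hJ
    have hAint : ∀ J ∈ 𝒜, J ∩ insert i s = J ∩ s := fun J hJ =>
      Finset.inter_insert_of_notMem (hA𝒥 J hJ).2
    have hBint : ∀ J ∈ ℬ, J ∩ insert i s = insert i (J ∩ s) := fun J hJ =>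
      Finset.inter_insert_of_mem (hB𝒥 J hJ).2
    have hA := ih 𝒜 (fun J hJ => hL J (hA𝒥 J hJ).1) (fun J hJ => hI J (hA𝒥 J hJ).1)
      (fun J hJ => hD J (hA𝒥 J hJ).1) fun J hJ J' hJ' h =>
        hinj J (hA𝒥 J hJ).1 J' (hA𝒥 J' hJ').1 (by rw [hAint J hJ, hAint J' hJ', h])
    have hB := ih ℬ (fun J hJ => hL J (hB𝒥 J hJ).1) (fun J hJ => hI J (hB𝒥 J hJ).1)
      (fun J hJ => hD J (hB𝒥 J hJ).1) fun J hJ J' hJ' h =>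
        hinj J (hB𝒥 J hJ).1 J' (hB𝒥 J' hJ').1 (by rw [hBint J hJ, hBint J' hJ', h])
    have hsplit : ∀ f : Finset ι → ℝ, ∑ J ∈ 𝒥, f J = ∑ J ∈ 𝒜, f J + ∑ J ∈ ℬ, f J := fun f =>
      (Finset.sum_filter_add_sum_filter_not 𝒥 (fun J => i ∉ J) f).symm
    have hone : (1 : ENNReal) ≤ 3 / 2 := by
      rw [ENNReal.le_div_iff_mul_le (by simp) (by simp)]; norm_num
    have hmain := integral_abs_add_rpow_three_halves_le (P := P)
      (A := fun x => ∑ J ∈ 𝒜, F J x) (B := fun x => ∑ J ∈ ℬ, F J x) (i := i)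
      (IndepOfCoord.sum fun J hJ => hI J (hA𝒥 J hJ).1 i (hA𝒥 J hJ).2)
      (Degenerate.sum (fun J hJ => (hL J (hB𝒥 J hJ).1).integrable hone)
        fun J hJ => hD J (hB𝒥 J hJ).1 i (hB𝒥 J hJ).2)
      (memLp_finsetSum _ fun J hJ => hL J (hA𝒥 J hJ).1)
      (memLp_finsetSum _ fun J hJ => hL J (hB𝒥 J hJ).1)
    simp only [hsplit]
    refine hmain.trans (add_le_add (hA.trans (le_of_eq ?_))
      ((mul_le_mul_of_nonneg_left hB (by norm_num)).trans (le_of_eq ?_)))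
    · exact Finset.sum_congr rfl fun J hJ => by rw [hAint J hJ]
    · rw [Finset.mul_sum]
      refine Finset.sum_congr rfl fun J hJ => ?_
      rw [hBint J hJ, Finset.card_insert_of_notMem fun h => his (Finset.mem_of_mem_inter_right h),
        pow_succ]
      ring

lemma integral_abs_sum_rpow_three_halves_le {F : Finset ι → (ι → M) → ℝ}
    {𝒥 : Finset (Finset ι)}
    (hL : ∀ J ∈ 𝒥, MemLp (F J) (3 / 2 : ENNReal) (Measure.pi fun _ : ι => P))
    (hI : ∀ J ∈ 𝒥, ∀ i ∉ J, IndepOfCoord (F J) i) (hD : ∀ J ∈ 𝒥, ∀ i ∈ J, Degenerate P (F J) i) :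
    ∫ x, |∑ J ∈ 𝒥, F J x| ^ (3 / 2 : ℝ) ∂(Measure.pi fun _ : ι => P) ≤
      ∑ J ∈ 𝒥, 3 ^ J.card * ∫ x, |F J x| ^ (3 / 2 : ℝ) ∂(Measure.pi fun _ : ι => P) := by
  simpa using integral_abs_sum_rpow_three_halves_le_aux Finset.univ 𝒥 hL hI hD fun J _ J' _ h => by
    simpa using h

end Family

/-! ### The Hoeffding decomposition of a symmetric kernel -/

lemma memLp_integral_prod {α β : Type*} [MeasurableSpace α] [MeasurableSpace β] {μ : Measure α}
    {ν : Measure β} [IsProbabilityMeasure μ] [IsProbabilityMeasure ν] {p : ENNReal} (hp1 : 1 ≤ p)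
    (hp : p ≠ ⊤) {K : α × β → ℝ} (hK : MemLp K p (μ.prod ν)) :
    MemLp (fun x => ∫ y, K (x, y) ∂ν) p μ := by
  have hp0 : p ≠ 0 := (lt_of_lt_of_le one_pos hp1).ne'
  refine ⟨hK.1.integral_prod_right', ?_⟩
  rw [eLpNorm_lt_top_iff_lintegral_rpow_enorm_lt_top hp0 hp]
  have h := (eLpNorm_lt_top_iff_lintegral_rpow_enorm_lt_top hp0 hp).1 hK.2
  rw [lintegral_prod _ (hK.1.enorm.pow_const _)] at h
  refine lt_of_le_of_lt (lintegral_mono_ae ?_) h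
  filter_upwards [hK.1.prodMk_left] with x hx
  have h1 : ‖∫ y, K (x, y) ∂ν‖ₑ ≤ eLpNorm (fun y => K (x, y)) p ν := by
    refine (enorm_integral_le_lintegral_enorm _).trans ?_
    rw [← eLpNorm_one_eq_lintegral_enorm]
    exact eLpNorm_le_eLpNorm_of_exponent_le hp1 hx
  refine (ENNReal.rpow_le_rpow h1 ENNReal.toReal_nonneg).trans (le_of_eq ?_)
  rw [eLpNorm_eq_lintegral_rpow_enorm_toReal hp0 hp, ← ENNReal.rpow_mul,
    one_div_mul_cancel (ENNReal.toReal_pos hp0 hp).ne', ENNReal.rpow_one]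

/-- A symmetric kernel sees only the set of places it reads: an injective tuple contained in the
range of another tuple of the same length is a permutation of it. -/
lemma IsSymmKernel.comp_eq {M κ : Type*} {m : ℕ} {k : (Fin m → M) → ℝ} (hk : IsSymmKernel k)
    {e e' : Fin m → κ} (he : Function.Injective e) (h : ∀ l, ∃ l', e' l' = e l) (z : κ → M) :
    k (fun l => z (e l)) = k fun l => z (e' l) := by
  choose τ hτ using h
  have hinj : Function.Injective τ := fun a b hab => he (by rw [← hτ a, ← hτ b, hab])
  have hbij : Function.Bijective τ := Finite.injective_iff_bijective.1 hinj
  have := hk (Equiv.ofBijective τ hbij) fun l => z (e' l)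
  rw [← this]
  congr 1; ext l
  simp [hτ]

section Hoeffding

variable {M : Type*} [MeasurableSpace M] (P : Measure M) {m : ℕ} (k : (Fin m → M) → ℝ)

/-- The Hoeffding projections of a kernel. -/
noncomputable def hproj (r : ℕ) (x : Fin r → M) : ℝ :=
  (partialMean P k r x - mean P k) -
    ∑ t : Fin (r - 1), ∑ j : Idx r ((t : ℕ) + 1), hproj ((t : ℕ) + 1) fun l => x (j l)
termination_by r
decreasing_by omega

/-- For a centred `h`, subtracting `σ_h²` is the same as centring `h²`, so the projections in the
statement are those of the general kernel `h²`. -/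
lemma hoeffdingProj_eq_hproj {h : (Fin m → M) → ℝ} (hv : varH P h = mean P fun y => h y ^ 2) :
    ∀ r x, hoeffdingProj P h r x = hproj P (fun y => h y ^ 2) r x := by
  intro r
  induction r using Nat.strong_induction_on with
  | _ r ih =>
    intro x
    rw [hoeffdingProj, hproj, PsiTilde, hv]
    congr 1
    refine Finset.sum_congr rfl fun t _ => Finset.sum_congr rfl fun j _ => ?_
    exact ih _ (by omega) _

variable {n : ℕ}

/-- The increasing enumeration of `J`. -/
abbrev enum (J : Finset (Fin n)) : Fin J.card ↪o Fin n := J.orderEmbOfFin rfl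

/-- The conditional mean of the centred kernel given the coordinates in `J`. -/
noncomputable def condKernel (J : Finset (Fin n)) (x : Fin n → M) : ℝ :=
  partialMean P k J.card (fun l => x (enum J l)) - mean P k

/-- The Hoeffding component of the kernel on the coordinates in `J`. -/
noncomputable def component (J : Finset (Fin n)) (x : Fin n → M) : ℝ :=
  hproj P k J.card fun l => x (enum J l)

/-- The argument of the kernel in which the first places are filled by the coordinates in `J`. -/
def kernelArg (m : ℕ) (J : Finset (Fin n)) (q : (Fin n → M) × (Fin m → M)) : Fin m → M :=
  fun l => if hl : (l : ℕ) < J.card then q.1 (enum J ⟨l, hl⟩) else q.2 l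

/-- The places of `kernelArg`. -/
def kernelIdx (m : ℕ) (J : Finset (Fin n)) (l : Fin m) : Fin n ⊕ Fin m :=
  if hl : (l : ℕ) < J.card then Sum.inl (enum J ⟨l, hl⟩) else Sum.inr l

lemma kernelArg_eq (J : Finset (Fin n)) (q : (Fin n → M) × (Fin m → M)) :
    kernelArg m J q = fun l => Sum.elim q.1 q.2 (kernelIdx m J l) := by
  ext l
  unfold kernelArg kernelIdx
  split_ifs <;> rfl

lemma kernelIdx_injective (J : Finset (Fin n)) : Function.Injective (kernelIdx m J) := by
  intro a b hab
  unfold kernelIdx at hab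
  split_ifs at hab with h1 h2 h2
  · have := (enum J).injective (Sum.inl_injective hab)
    ext
    simpa using this
  · exact Sum.inr_injective hab

lemma condKernel_eq (J : Finset (Fin n)) (x : Fin n → M) :
    condKernel P k J x = ∫ y, k (kernelArg m J (x, y)) ∂(Measure.pi fun _ : Fin m => P) -
      mean P k := rfl

lemma exists_enum_eq {J : Finset (Fin n)} {i : Fin n} (hi : i ∈ J) : ∃ l, enum J l = i := by
  have := Finset.range_orderEmbOfFin J rfl
  rw [Set.ext_iff] at this
  exact (this i).2 hi

lemma enum_mem (J : Finset (Fin n)) (l : Fin J.card) : enum J l ∈ J :=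
  Finset.orderEmbOfFin_mem _ _ _

variable {P k}

/-- By symmetry it does not matter whether the value `t` enters through the coordinate `i ∈ J` or
through the place `l₀` that becomes free when `i` is erased. The swap `θ` matches the two readings.
-/
lemma kernelArg_update (hk : IsSymmKernel k) {J : Finset (Fin n)} {i : Fin n} (hi : i ∈ J)
    (hJ : J.card ≤ m) {l₀ : Fin m} (hl₀ : (l₀ : ℕ) + 1 = J.card) (x : Fin n → M) (y : Fin m → M)
    (t : M) : k (kernelArg m J (Function.update x i t, y)) =
      k (kernelArg m (J.erase i) (x, Function.update y l₀ t)) := by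
  have hc : (J.erase i).card = l₀ := by rw [Finset.card_erase_of_mem hi]; omega
  set θ := Equiv.swap (Sum.inl i : Fin n ⊕ Fin m) (Sum.inr l₀)
  set z : Fin n ⊕ Fin m → M := Sum.elim (Function.update x i t) y with hz
  have e1 : kernelArg m (J.erase i) (x, Function.update y l₀ t) =
      fun l => z (θ (kernelIdx m (J.erase i) l)) := by
    ext l
    unfold kernelArg kernelIdx
    split_ifs with h
    · have hne : enum (J.erase i) ⟨l, h⟩ ≠ i := Finset.ne_of_mem_erase (enum_mem _ _)
      rw [Equiv.swap_apply_of_ne_of_ne (fun h => hne (Sum.inl_injective h)) (by simp)]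
      exact (Function.update_of_ne hne _ _).symm
    · rcases eq_or_ne l l₀ with rfl | hne
      · rw [Equiv.swap_apply_right]; simp only [hz, Sum.elim_inl, Function.update_self]
      · rw [Equiv.swap_apply_of_ne_of_ne (by simp) (fun h => hne (Sum.inr_injective h))]
        exact Function.update_of_ne hne _ _
  rw [e1, kernelArg_eq]
  refine (hk.comp_eq (e := fun l => θ (kernelIdx m (J.erase i) l)) (e' := kernelIdx m J)
    (θ.injective.comp (kernelIdx_injective _)) (fun l => ?_) z).symm
  have hJmem : ∀ j ∈ J, ∃ l', kernelIdx m J l' = Sum.inl j := fun j hj => by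
    obtain ⟨l', hl'⟩ := exists_enum_eq hj
    refine ⟨⟨l', lt_of_lt_of_le l'.2 hJ⟩, ?_⟩
    rw [kernelIdx, dif_pos (by exact l'.2), ← hl']
  rw [kernelIdx]
  split_ifs with h
  · have hne : enum (J.erase i) ⟨l, h⟩ ≠ i := Finset.ne_of_mem_erase (enum_mem _ _)
    rw [Equiv.swap_apply_of_ne_of_ne (fun h => hne (Sum.inl_injective h)) (by simp)]
    exact hJmem _ (Finset.mem_of_mem_erase (enum_mem _ _))
  · rcases eq_or_ne l l₀ with rfl | hne
    · rw [Equiv.swap_apply_right]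
      exact hJmem i hi
    · rw [Equiv.swap_apply_of_ne_of_ne (by simp) (fun h => hne (Sum.inr_injective h))]
      refine ⟨l, ?_⟩
      have : (l : ℕ) ≠ l₀ := fun h => hne (Fin.ext h)
      rw [kernelIdx, dif_neg (by omega)]

lemma measurable_kernelArg (J : Finset (Fin n)) :
    Measurable (kernelArg (M := M) m J) := by
  refine measurable_pi_iff.2 fun l => ?_
  unfold kernelArg
  split_ifs <;> fun_prop

variable [IsProbabilityMeasure P]

lemma measurePreserving_kernelArg (J : Finset (Fin n)) :
    MeasurePreserving (kernelArg (M := M) m J)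
      ((Measure.pi fun _ : Fin n => P).prod (Measure.pi fun _ : Fin m => P))
      (Measure.pi fun _ : Fin m => P) := by
  have h1 := measurePreserving_sumPiEquivProdPi_symm (fun _ : Fin n ⊕ Fin m => P)
  have h2 := (measurePreserving_comp_injective (P := P) (kernelIdx_injective (m := m) J)).comp h1
  convert h2 using 1
  ext q l
  rw [kernelArg_eq]
  simp only [Function.comp]
  cases kernelIdx m J l <;> rfl

lemma condKernel_degenerate (hk : IsSymmKernel k)
    (hi : Integrable k (Measure.pi fun _ : Fin m => P)) {J : Finset (Fin n)} {i : Fin n}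
    (hiJ : i ∈ J) (hJ : J.card ≤ m) :
    ∀ᵐ x ∂(Measure.pi fun _ : Fin n => P),
      ∫ t, condKernel P k J (Function.update x i t) ∂P = condKernel P k (J.erase i) x := by
  have hpos : 0 < J.card := Finset.card_pos.2 ⟨i, hiJ⟩
  -- Places are counted from 0: this is the last place filled for `J`, and the first free one for
  -- `J.erase i`.
  set l₀ : Fin m := ⟨J.card - 1, by omega⟩
  have hl₀ : (l₀ : ℕ) + 1 = J.card := by simp only [l₀]; omega
  have h1 := ((measurePreserving_kernelArg (P := P) (m := m) (J.erase i)).integrable_comp_of_integrable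
    hi).prod_right_ae
  filter_upwards [h1] with x hx
  simp only [condKernel_eq, kernelArg_update hk hiJ hJ hl₀]
  have hx' : Integrable (fun y => k (kernelArg m (J.erase i) (x, y)))
    (Measure.pi fun _ : Fin m => P) := hx
  have h2 := (measurePreserving_update (P := P) l₀).integrable_comp_of_integrable hx'
  have h3 : Integrable (fun t => ∫ y, k (kernelArg m (J.erase i) (x, Function.update y l₀ t))
      ∂(Measure.pi fun _ : Fin m => P)) P := h2.integral_prod_right
  rw [integral_sub h3 (integrable_const _)]
  congr 1
  · rw [integral_eq_integral_integral_update hx' l₀]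
    exact (integral_integral_swap (f := fun y t => k (kernelArg m (J.erase i)
      (x, Function.update y l₀ t))) h2).symm
  · simp

lemma condKernel_empty (x : Fin n → M) : condKernel P k ∅ x = 0 := by
  rw [condKernel_eq]
  have : ∀ y : Fin m → M, kernelArg m (∅ : Finset (Fin n)) (x, y) = y := fun y => by
    ext l; simp [kernelArg]
  simp [this, mean]

lemma measurable_condKernel (hk : Measurable k) (J : Finset (Fin n)) :
    Measurable (condKernel P k J) := by
  have h : StronglyMeasurable fun q : (Fin n → M) × (Fin m → M) => k (kernelArg m J q) :=
    (hk.comp (measurable_kernelArg J)).stronglyMeasurable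
  exact (h.integral_prod_right (ν := Measure.pi fun _ : Fin m => P)).measurable.sub_const _

lemma memLp_condKernel {p : ENNReal} (hp1 : 1 ≤ p) (hp : p ≠ ⊤)
    (hk : MemLp k p (Measure.pi fun _ : Fin m => P)) (J : Finset (Fin n)) :
    MemLp (condKernel P k J) p (Measure.pi fun _ : Fin n => P) :=
  (memLp_integral_prod hp1 hp
    (hk.comp_measurePreserving (measurePreserving_kernelArg (P := P) J))).sub (memLp_const _)

lemma eval_enum_eq {s : ℕ} {A : Finset (Fin n)} (hA : A.card = s) {f : Fin s ↪o Fin n}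
    (hf : ∀ l, f l ∈ A) (G : (s : ℕ) → (Fin s → M) → ℝ) (x : Fin n → M) :
    G s (fun l => x (f l)) = G A.card fun l => x (enum A l) := by
  subst hA
  rw [Finset.orderEmbOfFin_unique' rfl hf]

/-- Passes from increasing tuples to subsets, for which inclusion arguments are easier. `G` is a
family over all arities because the arity becomes `A.card`, which equals `s` only propositionally.
-/
lemma sum_idx_eq {r : ℕ} (e : Fin r ↪o Fin n) (s : ℕ) (G : (s : ℕ) → (Fin s → M) → ℝ)
    (x : Fin n → M) :
    ∑ j : Idx r s, G s (fun l => x (e (j l))) =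
      ∑ A ∈ Finset.powersetCard s (Finset.univ.map e.toEmbedding),
        G A.card fun l => x (enum A l) := by
  refine Finset.sum_bij (fun j _ => Finset.univ.map (j.trans e).toEmbedding) ?_ ?_ ?_ ?_
  · intro j _
    rw [Finset.mem_powersetCard]
    refine ⟨fun a ha => ?_, by simp⟩
    simp only [Finset.mem_map, Finset.mem_univ, true_and] at ha ⊢
    obtain ⟨l, rfl⟩ := ha
    exact ⟨j l, rfl⟩
  · intro j _ j' _ h
    have hc : (Finset.univ.map (j.trans e).toEmbedding).card = s := by simp
    have h1 := Finset.orderEmbOfFin_unique' hc (f := j.trans e) fun l =>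
      Finset.mem_map_of_mem _ (Finset.mem_univ l)
    have h2 := Finset.orderEmbOfFin_unique' hc (f := j'.trans e) fun l => by
      rw [h]; exact Finset.mem_map_of_mem _ (Finset.mem_univ l)
    have h3 := h1.trans h2.symm
    ext l
    have := DFunLike.congr_fun h3 l
    exact congrArg Fin.val (e.injective this)
  · intro A hA
    rw [Finset.mem_powersetCard] at hA
    obtain ⟨B, -, rfl⟩ := Finset.subset_map_iff.1 hA.1
    have hB : B.card = s := by simpa using hA.2
    refine ⟨B.orderEmbOfFin hB, Finset.mem_univ _, ?_⟩
    ext a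
    simp only [Finset.mem_map, Finset.mem_univ, true_and]
    constructor
    · rintro ⟨l, rfl⟩
      exact ⟨_, Finset.orderEmbOfFin_mem B hB l, rfl⟩
    · rintro ⟨b, hb, rfl⟩
      have := Finset.range_orderEmbOfFin B hB
      rw [Set.ext_iff] at this
      obtain ⟨l, hl⟩ := (this b).2 hb
      exact ⟨l, by rw [← hl]; rfl⟩
  · intro j _
    exact eval_enum_eq (by simp) (f := j.trans e)
      (fun l => Finset.mem_map_of_mem _ (Finset.mem_univ l)) G x

lemma map_enum (J : Finset (Fin n)) : Finset.univ.map (enum J).toEmbedding = J := by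
  ext a
  simp only [Finset.mem_map, Finset.mem_univ, true_and]
  exact ⟨fun ⟨l, hl⟩ => hl ▸ enum_mem J l, fun ha => exists_enum_eq ha⟩

lemma component_eq (J : Finset (Fin n)) (x : Fin n → M) :
    component P k J x = condKernel P k J x -
      ∑ A ∈ J.ssubsets.erase ∅, component P k A x := by
  rw [component, hproj, condKernel]
  congr 1
  have h1 : ∀ t : ℕ, ∑ j : Idx J.card (t + 1), hproj P k (t + 1) (fun l => x (enum J (j l))) =
      ∑ A ∈ Finset.powersetCard (t + 1) J, component P k A x := fun t => by
    have := sum_idx_eq (enum J) (t + 1) (fun s y => hproj P k s y) x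
    rw [map_enum] at this
    exact this
  simp only [h1]
  rw [Finset.sum_sigma']
  refine Finset.sum_bij (fun q _ => q.2) ?_ ?_ ?_ ?_
  · rintro ⟨t, A⟩ h
    simp only [Finset.mem_sigma, Finset.mem_univ, true_and, Finset.mem_powersetCard] at h
    have := t.2
    rw [Finset.mem_erase, Finset.mem_ssubsets]
    refine ⟨?_, Finset.ssubset_iff_subset_ne.2 ⟨h.1, ?_⟩⟩
    · rintro rfl; simp at h
    · intro hAJ; have := congrArg Finset.card hAJ; simp only at this; omega
  · rintro ⟨t, A⟩ h ⟨t', A'⟩ h' rfl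
    simp only [Finset.mem_sigma, Finset.mem_univ, true_and, Finset.mem_powersetCard] at h h'
    have : t = t' := Fin.ext (by omega)
    subst this; rfl
  · intro A hA
    rw [Finset.mem_erase, Finset.mem_ssubsets] at hA
    have h1 := Finset.card_lt_card hA.2
    have h2 := Finset.card_pos.2 (Finset.nonempty_iff_ne_empty.2 hA.1)
    refine ⟨⟨⟨A.card - 1, by omega⟩, A⟩, ?_, rfl⟩
    simp only [Finset.mem_sigma, Finset.mem_univ, true_and, Finset.mem_powersetCard]
    exact ⟨hA.2.1, by omega⟩
  · intro _ _; rfl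

lemma condKernel_eq_sum {J : Finset (Fin n)} (hJ : J ≠ ∅) (x : Fin n → M) :
    condKernel P k J x = ∑ A ∈ J.powerset.erase ∅, component P k A x := by
  have h := component_eq (P := P) (k := k) J x
  have e : J.powerset.erase ∅ = insert J (J.ssubsets.erase ∅) := by
    ext A
    simp only [Finset.mem_erase, Finset.mem_powerset, Finset.mem_insert, Finset.mem_ssubsets]
    constructor
    · rintro ⟨h1, h2⟩
      rcases eq_or_ne A J with rfl | h3
      · exact Or.inl rfl
      · exact Or.inr ⟨h1, Finset.ssubset_iff_subset_ne.2 ⟨h2, h3⟩⟩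
    · rintro (rfl | ⟨h1, h2⟩)
      · exact ⟨hJ, le_rfl⟩
      · exact ⟨h1, h2.1⟩
  rw [e, Finset.sum_insert (by simp)]
  linarith

lemma component_indepOfCoord {J : Finset (Fin n)} {i : Fin n} (hi : i ∉ J) :
    IndepOfCoord (component P k J) i := fun x t => by
  unfold component
  congr 1; ext l
  rw [Function.update_of_ne]
  rintro rfl
  exact hi (enum_mem J l)

lemma measurable_component (hk : Measurable k) (J : Finset (Fin n)) :
    Measurable (component P k J) := by
  induction J using Finset.strongInduction with
  | H J ih =>
    have : component P k J = fun x => condKernel P k J x -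
      ∑ A ∈ J.ssubsets.erase ∅, component P k A x := funext fun x => component_eq J x
    rw [this]
    refine (measurable_condKernel hk J).sub (Finset.measurable_fun_sum _ fun A hA => ih A ?_)
    exact Finset.mem_ssubsets.1 (Finset.mem_of_mem_erase hA)

lemma memLp_component {p : ENNReal} (hp1 : 1 ≤ p) (hp : p ≠ ⊤)
    (hk : MemLp k p (Measure.pi fun _ : Fin m => P)) (J : Finset (Fin n)) :
    MemLp (component P k J) p (Measure.pi fun _ : Fin n => P) := by
  induction J using Finset.strongInduction with
  | H J ih =>
    have : component P k J = fun x => condKernel P k J x -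
      ∑ A ∈ J.ssubsets.erase ∅, component P k A x := funext fun x => component_eq J x
    rw [this]
    refine (memLp_condKernel hp1 hp hk J).sub (memLp_finsetSum _ fun A hA => ih A ?_)
    exact Finset.mem_ssubsets.1 (Finset.mem_of_mem_erase hA)

/-- Averaging the recursion for `component` over `x i`: the conditional kernel of `J` becomes that
of `J.erase i`, the lower components containing `i` vanish by induction, and the others are
unchanged and sum to the conditional kernel of `J.erase i`. The two contributions cancel. -/
lemma component_degenerate (hk : IsSymmKernel k)
    (hi : Integrable k (Measure.pi fun _ : Fin m => P)) (J : Finset (Fin n)) :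
    J.card ≤ m → ∀ i ∈ J, Degenerate P (component P k J) i := by
  have hL := memLp_one_iff_integrable.2 hi
  induction J using Finset.strongInduction with
  | H J ih =>
    intro hJ i hiJ
    have hA : ∀ A ∈ J.ssubsets.erase ∅, A ⊂ J := fun A hA =>
      Finset.mem_ssubsets.1 (Finset.mem_of_mem_erase hA)
    have h1 : ∀ᵐ x ∂(Measure.pi fun _ : Fin n => P), ∀ A ∈ J.ssubsets.erase ∅,
        Integrable (fun t => component P k A (Function.update x i t)) P ∧
        ∫ t, component P k A (Function.update x i t) ∂P =
          if i ∈ A then 0 else component P k A x := by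
      rw [Finset.eventually_all]
      intro A hA'
      have hint := integrable_update_ae (memLp_one_iff_integrable.1
        (memLp_component le_rfl (by simp) hL A)) i
      by_cases hiA : i ∈ A
      · filter_upwards [hint, ih A (hA A hA') ((Finset.card_le_card (hA A hA').1).trans hJ) i hiA]
          with x h1 h2
        exact ⟨h1, by rw [h2, if_pos hiA]⟩
      · filter_upwards [hint] with x h1
        refine ⟨h1, ?_⟩
        rw [if_neg hiA]
        simp [component_indepOfCoord hiA x]
    filter_upwards [h1, condKernel_degenerate hk hi hiJ hJ, integrable_update_ae
      (memLp_one_iff_integrable.1 (memLp_condKernel le_rfl (by simp) hL J)) i] with x hx hc hci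
    simp only [component_eq J]
    rw [integral_sub hci (integrable_finsetSum _ fun A hA => (hx A hA).1), hc,
      integral_finsetSum _ fun A hA => (hx A hA).1, Finset.sum_congr rfl fun A hA => (hx A hA).2]
    have e : ∑ A ∈ J.ssubsets.erase ∅, (if i ∈ A then 0 else component P k A x) =
        ∑ A ∈ (J.erase i).powerset.erase ∅, component P k A x := by
      simp only [← ite_not (i ∈ _)]
      rw [← Finset.sum_filter]
      congr 1
      ext A
      simp only [Finset.mem_filter, Finset.mem_erase, Finset.mem_ssubsets, Finset.mem_powerset]
      constructor
      · rintro ⟨⟨h1, h2⟩, h3⟩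
        exact ⟨h1, Finset.subset_erase.2 ⟨h2.1, h3⟩⟩
      · rintro ⟨h1, h2⟩
        obtain ⟨h3, h4⟩ := Finset.subset_erase.1 h2
        exact ⟨⟨h1, Finset.ssubset_iff_subset_ne.2 ⟨h3, fun h => h4 (h ▸ hiJ)⟩⟩, h4⟩
    rw [e]
    rcases (J.erase i).eq_empty_or_nonempty with h | h
    · rw [h, condKernel_empty]; simp
    · rw [condKernel_eq_sum h.ne_empty, sub_self]

end Hoeffding

/-! ### U-statistics through their Hoeffding components; variance bounds -/

/-- The weight of a Hoeffding component of order `r` in a U-statistic of order `m`. -/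
noncomputable def weight (n m r : ℕ) : ℝ := (m.choose r : ℝ) / (n.choose r : ℝ)

/-- The sets of coordinates of cardinality between `q` and `m`. -/
def cardBetween (n q m : ℕ) : Finset (Finset (Fin n)) :=
  Finset.univ.filter fun A => q ≤ A.card ∧ A.card ≤ m

lemma mem_cardBetween {n q m : ℕ} {A : Finset (Fin n)} :
    A ∈ cardBetween n q m ↔ q ≤ A.card ∧ A.card ≤ m := by simp [cardBetween]

lemma weight_nonneg (n m r : ℕ) : 0 ≤ weight n m r := by unfold weight; positivity

lemma weight_self {m r : ℕ} (hr : r ≤ m) : weight m m r = 1 :=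
  div_self (by exact_mod_cast (Nat.choose_pos hr).ne')

lemma choose_mul_weight {n m r : ℕ} (hr : r ≤ n) :
    (n.choose r : ℝ) * weight n m r = m.choose r := by
  have : (n.choose r : ℝ) ≠ 0 := by exact_mod_cast (Nat.choose_pos hr).ne'
  unfold weight; field_simp

/-- Successive weights have ratio `(m - r)/(n - r) ≤ m/n`. -/
lemma weight_le_pow {n m r : ℕ} (hr : r ≤ m) (hmn : m ≤ n) : weight n m r ≤ ((m : ℝ) / n) ^ r := by
  induction r with
  | zero => simp [weight]
  | succ r ih =>
    have ih := ih (by omega)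
    have hrn : (0 : ℝ) < (n : ℝ) - r := by
      have : (r : ℝ) + 1 ≤ n := by exact_mod_cast hr.trans hmn
      linarith
    have hrm : (0 : ℝ) ≤ (m : ℝ) - r := by
      have : (r : ℝ) + 1 ≤ m := by exact_mod_cast hr
      linarith
    have hc : ∀ N : ℕ, r ≤ N → (N.choose (r + 1) : ℝ) = N.choose r * ((N : ℝ) - r) / (r + 1) := by
      intro N hN
      have := Nat.choose_succ_right_eq N r
      rw [eq_div_iff (by positivity), ← Nat.cast_sub hN]
      exact_mod_cast this
    have hn0 : (0 : ℝ) < n := by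
      have : (r : ℝ) + 1 ≤ n := by exact_mod_cast hr.trans hmn
      have : (0 : ℝ) ≤ r := Nat.cast_nonneg r
      linarith
    have e : weight n m (r + 1) = weight n m r * (((m : ℝ) - r) / ((n : ℝ) - r)) := by
      have h1 : (n.choose r : ℝ) ≠ 0 := by exact_mod_cast (Nat.choose_pos (by omega)).ne'
      unfold weight
      rw [hc n (by omega), hc m (by omega)]
      field_simp
    rw [e, pow_succ]
    have h2 : ((m : ℝ) - r) / ((n : ℝ) - r) ≤ (m : ℝ) / n := by
      rw [div_le_div_iff₀ hrn hn0]
      have : (m : ℝ) ≤ n := by exact_mod_cast hmn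
      have : (0 : ℝ) ≤ r := Nat.cast_nonneg r
      nlinarith
    exact mul_le_mul ih h2 (by positivity) (by positivity)

lemma weight_one {n m : ℕ} : weight n m 1 = (m : ℝ) / n := by simp [weight]

lemma sum_cardBetween {n q m : ℕ} (f : Finset (Fin n) → ℝ) :
    ∑ A ∈ cardBetween n q m, f A =
      ∑ r ∈ Finset.Icc q m, ∑ A ∈ Finset.powersetCard r Finset.univ, f A := by
  rw [← Finset.sum_fiberwise_of_maps_to (t := Finset.Icc q m) (g := Finset.card)
    (fun A hA => by rw [Finset.mem_Icc]; exact mem_cardBetween.1 hA)]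
  refine Finset.sum_congr rfl fun r hr => Finset.sum_congr ?_ fun _ _ => rfl
  ext A
  rw [Finset.mem_Icc] at hr
  simp only [Finset.mem_filter, mem_cardBetween, Finset.mem_powersetCard, Finset.subset_univ,
    true_and]
  constructor
  · exact fun h => h.2
  · rintro rfl; exact ⟨hr, rfl⟩

lemma sum_cardBetween_card {n q m : ℕ} (F : ℕ → ℝ) :
    ∑ A ∈ cardBetween n q m, F A.card = ∑ r ∈ Finset.Icc q m, (n.choose r : ℝ) * F r := by
  rw [sum_cardBetween]
  refine Finset.sum_congr rfl fun r _ => ?_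
  rw [Finset.sum_congr rfl fun A hA => by rw [(Finset.mem_powersetCard.1 hA).2],
    Finset.sum_const, Finset.card_powersetCard]
  simp

lemma card_filter_subset_powersetCard {n m : ℕ} {A : Finset (Fin n)} (hA : A.card ≤ m) :
    ((Finset.powersetCard m Finset.univ).filter fun I => A ⊆ I).card =
      (n - A.card).choose (m - A.card) := by
  have h1 : (n - A.card).choose (m - A.card) =
      (Finset.powersetCard (m - A.card) Aᶜ).card := by
    rw [Finset.card_powersetCard, Finset.card_compl, Fintype.card_fin]
  rw [h1]
  refine Finset.card_nbij' (fun I => I \ A) (fun B => B ∪ A) ?_ ?_ ?_ ?_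
  · intro I hI
    simp only [Finset.coe_filter, Finset.mem_powersetCard, Finset.subset_univ, true_and,
      Set.mem_ofPred_eq] at hI
    simp only [Finset.mem_coe, Finset.mem_powersetCard]
    refine ⟨fun a ha => by simpa using (Finset.mem_sdiff.1 ha).2, ?_⟩
    rw [Finset.card_sdiff_of_subset hI.2, hI.1]
  · intro B hB
    simp only [Finset.mem_coe, Finset.mem_powersetCard] at hB
    simp only [Finset.coe_filter, Finset.mem_powersetCard, Finset.subset_univ, true_and,
      Set.mem_ofPred_eq]
    refine ⟨?_, Finset.subset_union_right⟩
    rw [Finset.card_union_of_disjoint, hB.2]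
    · omega
    · exact Finset.disjoint_left.2 fun a ha => by simpa using hB.1 ha
  · intro I hI
    simp only [Finset.coe_filter, Set.mem_ofPred_eq] at hI
    exact Finset.sdiff_union_of_subset hI.2
  · intro B hB
    simp only [Finset.mem_coe, Finset.mem_powersetCard] at hB
    refine Finset.union_sdiff_cancel_right (Finset.disjoint_left.2 fun a ha => by simpa using hB.1 ha)

section UStatistic

variable {M : Type*} [MeasurableSpace M] {P : Measure M} [IsProbabilityMeasure P] {m n : ℕ}
  {k : (Fin m → M) → ℝ}

/-- The complete U-statistic with kernel `k`. -/
noncomputable def ustat (k : (Fin m → M) → ℝ) (n : ℕ) (x : Fin n → M) : ℝ :=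
  (n.choose m : ℝ)⁻¹ * ∑ j : Idx n m, k fun l => x (j l)

lemma card_idx (n m : ℕ) : Fintype.card (Idx n m) = n.choose m := by
  rw [← Nat.card_eq_fintype_card, Nat.card_congr Set.powersetCard.ofFinEmbEquiv,
    Set.powersetCard.card, Nat.card_eq_fintype_card, Fintype.card_fin]

lemma partialMean_self (x : Fin m → M) : partialMean P k m x = k x := by
  simp [partialMean, mean]

/-- Each `A` lies in `(n - |A|) choose (m - |A|)` sets of size `m`; divided by `n choose m` this
count is the weight. -/
lemma ustat_sub_mean (hm : 1 ≤ m) (hmn : m ≤ n) (x : Fin n → M) :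
    ustat k n x - mean P k =
      ∑ A ∈ cardBetween n 1 m, weight n m A.card * component P k A x := by
  have hC : (n.choose m : ℝ) ≠ 0 := by exact_mod_cast (Nat.choose_pos hmn).ne'
  have h1 : ustat k n x - mean P k =
      (n.choose m : ℝ)⁻¹ * ∑ j : Idx n m, (partialMean P k m (fun l => x (j l)) - mean P k) := by
    simp only [partialMean_self, Finset.sum_sub_distrib, Finset.sum_const, Finset.card_univ,
      card_idx, ustat, nsmul_eq_mul]
    field_simp
  have h2 := sum_idx_eq (RelEmbedding.refl _ : Fin n ↪o Fin n) m
    (fun s y => partialMean P k s y - mean P k) x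
  have e : (Finset.univ : Finset (Fin n)).map
      (RelEmbedding.refl _ : Fin n ↪o Fin n).toEmbedding = Finset.univ := by
    ext; simp
  rw [e] at h2
  have h3 : ∑ A ∈ Finset.powersetCard m (Finset.univ : Finset (Fin n)),
      (partialMean P k A.card (fun l => x (enum A l)) - mean P k) =
      ∑ I ∈ Finset.powersetCard m (Finset.univ : Finset (Fin n)), ∑ A ∈ cardBetween n 1 m,
        if A ⊆ I then component P k A x else 0 := by
    refine Finset.sum_congr rfl fun I hI => ?_
    have hI' := (Finset.mem_powersetCard.1 hI).2
    have hne : I ≠ ∅ := by rintro rfl; simp at hI'; omega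
    refine (condKernel_eq_sum hne x).trans ?_
    rw [← Finset.sum_filter]
    refine Finset.sum_congr ?_ fun _ _ => rfl
    ext A
    simp only [Finset.mem_erase, Finset.mem_powerset, Finset.mem_filter, mem_cardBetween]
    constructor
    · rintro ⟨h1, h2⟩
      exact ⟨⟨Finset.card_pos.2 (Finset.nonempty_iff_ne_empty.2 h1),
        hI' ▸ Finset.card_le_card h2⟩, h2⟩
    · rintro ⟨⟨h1, h2⟩, h3⟩
      exact ⟨Finset.nonempty_iff_ne_empty.1 (Finset.card_pos.1 h1), h3⟩
  rw [h1]
  refine (congrArg _ (h2.trans h3)).trans ?_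
  rw [Finset.sum_comm, Finset.mul_sum]
  refine Finset.sum_congr rfl fun A hA => ?_
  have hA' := mem_cardBetween.1 hA
  rw [← Finset.sum_filter, Finset.sum_const, card_filter_subset_powersetCard hA'.2, nsmul_eq_mul,
    ← mul_assoc]
  congr 1
  have h4 : (n.choose A.card : ℝ) ≠ 0 := by
    exact_mod_cast (Nat.choose_pos (hA'.2.trans hmn)).ne'
  have h5 := Nat.choose_mul (n := n) (k := m) hA'.2
  have h5' : (n.choose m : ℝ) * m.choose A.card =
    n.choose A.card * (n - A.card).choose (m - A.card) := by exact_mod_cast h5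
  unfold weight
  field_simp
  linarith

lemma sub_mean_eq_sum (hm : 1 ≤ m) (x : Fin m → M) :
    k x - mean P k = ∑ A ∈ cardBetween m 1 m, component P k A x := by
  have h := ustat_sub_mean (P := P) (k := k) hm le_rfl x
  have h1 : ustat k m x = k x := by
    have h2 := sum_idx_eq (RelEmbedding.refl _ : Fin m ↪o Fin m) m
      (fun s y => partialMean P k s y) x
    have e : (Finset.univ : Finset (Fin m)).map
        (RelEmbedding.refl _ : Fin m ↪o Fin m).toEmbedding = Finset.univ := by
      ext; simp
    have e2 : Finset.powersetCard m (Finset.univ : Finset (Fin m)) = {Finset.univ} := by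
      have := Finset.powersetCard_self (Finset.univ : Finset (Fin m))
      simpa using this
    rw [e, e2, Finset.sum_singleton, ← eval_enum_eq (by simp)
      (f := (RelEmbedding.refl _ : Fin m ↪o Fin m)) (by simp)
      (fun s y => partialMean P k s y) x] at h2
    have h3 : ∑ j : Idx m m, k (fun l => x (j l)) = k x := by
      simpa [partialMean_self] using h2
    simp [ustat, h3]
  rw [← h1, h]
  refine Finset.sum_congr rfl fun A hA => ?_
  rw [weight_self (mem_cardBetween.1 hA).2, one_mul]

variable (P k) in
/-- The second moment of the Hoeffding components of order `r`. -/
noncomputable def hvar (r : ℕ) : ℝ := mean P fun x => hproj P k r x ^ 2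

variable (P k) in
/-- The variance of the kernel carried by the components of order at least `q`. -/
noncomputable def hvarSum (q : ℕ) : ℝ := ∑ r ∈ Finset.Icc q m, (m.choose r : ℝ) * hvar P k r

lemma hvar_nonneg (r : ℕ) : 0 ≤ hvar P k r := integral_nonneg fun _ => sq_nonneg _

lemma hvarSum_nonneg (q : ℕ) : 0 ≤ hvarSum P k q :=
  Finset.sum_nonneg fun r _ => mul_nonneg (Nat.cast_nonneg _) (hvar_nonneg r)

lemma measurable_hproj (hk : Measurable k) (r : ℕ) : Measurable (hproj P k r) := by
  have h := measurable_component (P := P) hk (Finset.univ : Finset (Fin r))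
  have e : component P k (Finset.univ : Finset (Fin r)) = hproj P k r := by
    ext x
    exact (eval_enum_eq (by simp) (f := (RelEmbedding.refl _ : Fin r ↪o Fin r)) (by simp)
      (fun s y => hproj P k s y) x).symm
  rwa [e] at h

lemma integral_comp_component {g : ℝ → ℝ} (hg : Measurable g) (hk : Measurable k)
    (A : Finset (Fin n)) :
    ∫ x, g (component P k A x) ∂(Measure.pi fun _ : Fin n => P) =
      mean P fun x => g (hproj P k A.card x) := by
  have h := measurePreserving_comp_injective (P := P) (enum A).injective
  rw [mean, ← h.map_eq, integral_map h.measurable.aemeasurable]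
  · rfl
  · exact (hg.comp (measurable_hproj hk _)).aestronglyMeasurable

lemma integral_sq_component (hk : Measurable k) (A : Finset (Fin n)) :
    ∫ x, component P k A x ^ 2 ∂(Measure.pi fun _ : Fin n => P) = hvar P k A.card :=
  integral_comp_component (g := fun t => t ^ 2) (by fun_prop) hk A

lemma integral_sq_sum_component (hk : Measurable k) (hs : IsSymmKernel k)
    (hL : MemLp k 2 (Measure.pi fun _ : Fin m => P)) {𝒥 : Finset (Finset (Fin n))}
    (h𝒥 : ∀ J ∈ 𝒥, J.card ≤ m) (b : ℕ → ℝ) :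
    ∫ x, (∑ A ∈ 𝒥, b A.card * component P k A x) ^ 2 ∂(Measure.pi fun _ : Fin n => P) =
      ∑ A ∈ 𝒥, b A.card ^ 2 * hvar P k A.card := by
  have hI := hL.integrable (by norm_num)
  rw [integral_sq_sum_of_degenerate (F := fun A x => b A.card * component P k A x)]
  · refine Finset.sum_congr rfl fun A _ => ?_
    simp only [mul_pow]
    rw [integral_const_mul, integral_sq_component hk]
  · exact fun J _ => (memLp_component (by norm_num) (by simp) hL J).const_mul _
  · exact fun J _ i hi => (component_indepOfCoord hi).comp fun t => b J.card * t
  · intro J hJ i hi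
    filter_upwards [component_degenerate hs hI J (h𝒥 J hJ) i hi] with x hx
    rw [integral_const_mul, hx, mul_zero]

lemma integral_sq_sub_mean (hm : 1 ≤ m) (hk : Measurable k) (hs : IsSymmKernel k)
    (hL : MemLp k 2 (Measure.pi fun _ : Fin m => P)) :
    mean P (fun x => (k x - mean P k) ^ 2) = hvarSum P k 1 := by
  have h := integral_sq_sum_component (n := m) hk hs hL (𝒥 := cardBetween m 1 m)
    (fun J hJ => (mem_cardBetween.1 hJ).2) (fun _ => 1)
  simp only [one_mul, ← sub_mean_eq_sum hm, one_pow] at h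
  rw [mean, h, sum_cardBetween_card (fun r => hvar P k r), hvarSum]

/-- By orthogonality order `r` contributes `(n choose r) * weight² * hvar`. One weight turns `n
choose r` into `m choose r`; the other is at most `(m/n)^q`. -/
lemma integral_sq_sum_weight_le {q : ℕ} (hmn : m ≤ n) (hk : Measurable k) (hs : IsSymmKernel k)
    (hL : MemLp k 2 (Measure.pi fun _ : Fin m => P)) :
    ∫ x, (∑ A ∈ cardBetween n q m, weight n m A.card * component P k A x) ^ 2
      ∂(Measure.pi fun _ : Fin n => P) ≤ ((m : ℝ) / n) ^ q * hvarSum P k q := by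
  rw [integral_sq_sum_component hk hs hL (fun J hJ => (mem_cardBetween.1 hJ).2) (weight n m),
    sum_cardBetween_card (fun r => weight n m r ^ 2 * hvar P k r), hvarSum, Finset.mul_sum]
  refine Finset.sum_le_sum fun r hr => ?_
  rw [Finset.mem_Icc] at hr
  have h1 := choose_mul_weight (n := n) (m := m) (hr.2.trans hmn)
  have h2 : weight n m r ≤ ((m : ℝ) / n) ^ q := by
    refine (weight_le_pow hr.2 hmn).trans (pow_le_pow_of_le_one (by positivity) ?_ hr.1)
    exact div_le_one_of_le₀ (by exact_mod_cast hmn) (by positivity)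
  have h3 := hvar_nonneg (P := P) (k := k) r
  calc _ = ((n.choose r : ℝ) * weight n m r) * hvar P k r * weight n m r := by ring
    _ = (m.choose r : ℝ) * hvar P k r * weight n m r := by rw [h1]
    _ ≤ (m.choose r : ℝ) * hvar P k r * ((m : ℝ) / n) ^ q := by gcongr
    _ = _ := by ring

/-- Summation over `i` counts each `A` with multiplicity `|A|`. With `m/n ≤ 1/2` the factor `r
(m/n)^(r-2)` stays below 2, so the total leave-one-out variance is at most twice the bound for the
whole higher-order part. -/
lemma sum_integral_sq_sum_weight_le (hmn : 2 * m ≤ n) (hk : Measurable k) (hs : IsSymmKernel k)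
    (hL : MemLp k 2 (Measure.pi fun _ : Fin m => P)) :
    ∑ i, ∫ x, (∑ A ∈ (cardBetween n 2 m).filter (fun A => i ∈ A),
        weight n m A.card * component P k A x) ^ 2 ∂(Measure.pi fun _ : Fin n => P) ≤
      2 * (((m : ℝ) / n) ^ 2 * hvarSum P k 2) := by
  have h0 : ∀ i : Fin n, ∫ x, (∑ A ∈ (cardBetween n 2 m).filter (fun A => i ∈ A),
        weight n m A.card * component P k A x) ^ 2 ∂(Measure.pi fun _ : Fin n => P) =
      ∑ A ∈ cardBetween n 2 m, if i ∈ A then weight n m A.card ^ 2 * hvar P k A.card else 0 :=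
    fun i => by
      rw [integral_sq_sum_component hk hs hL (fun J hJ =>
        (mem_cardBetween.1 (Finset.mem_filter.1 hJ).1).2) (weight n m), Finset.sum_filter]
  rw [Finset.sum_congr rfl fun i _ => h0 i, Finset.sum_comm]
  have h1 : ∀ A : Finset (Fin n), (∑ i, if i ∈ A then weight n m A.card ^ 2 * hvar P k A.card
      else 0) = A.card * (weight n m A.card ^ 2 * hvar P k A.card) := fun A => by
    rw [← Finset.sum_filter, Finset.sum_const, nsmul_eq_mul]
    congr 3
    ext; simp
  rw [Finset.sum_congr rfl fun A _ => h1 A,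
    sum_cardBetween_card (fun r => r * (weight n m r ^ 2 * hvar P k r)), hvarSum, Finset.mul_sum,
    Finset.mul_sum]
  refine Finset.sum_le_sum fun r hr => ?_
  rw [Finset.mem_Icc] at hr
  have h1 := choose_mul_weight (n := n) (m := m) (r := r) (by omega)
  have h3 := hvar_nonneg (P := P) (k := k) r
  have h2 : r * weight n m r ≤ 2 * ((m : ℝ) / n) ^ 2 := by
    have hw := weight_le_pow (n := n) hr.2 (by omega)
    obtain ⟨s, rfl⟩ : ∃ s, r = s + 2 := ⟨r - 2, by omega⟩
    have hn0 : (0 : ℝ) < n := by exact_mod_cast (by omega : 0 < n)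
    have hhalf : (m : ℝ) / n ≤ 1 / 2 := by
      rw [div_le_div_iff₀ hn0 (by norm_num)]
      have : 2 * (m : ℝ) ≤ n := by exact_mod_cast hmn
      linarith
    have hpow : ((s + 2 : ℕ) : ℝ) * ((m : ℝ) / n) ^ s ≤ 2 := by
      have h4 : ((m : ℝ) / n) ^ s ≤ (1 / 2) ^ s := pow_le_pow_left₀ (by positivity) hhalf s
      have h5 : ((s + 2 : ℕ) : ℝ) ≤ 2 * 2 ^ s := by
        have : s + 2 ≤ 2 * 2 ^ s := by
          have := Nat.lt_two_pow_self (n := s)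
          rcases s with _ | s
          · norm_num
          · have := Nat.one_le_two_pow (n := s + 1); omega
        exact_mod_cast this
      calc ((s + 2 : ℕ) : ℝ) * ((m : ℝ) / n) ^ s ≤ (2 * (2 : ℝ) ^ s) * (1 / 2) ^ s := by gcongr
        _ = 2 := by rw [mul_assoc, ← mul_pow]; norm_num
    calc _ ≤ ((s + 2 : ℕ) : ℝ) * ((m : ℝ) / n) ^ (s + 2) := by gcongr
      _ = ((s + 2 : ℕ) : ℝ) * ((m : ℝ) / n) ^ s * ((m : ℝ) / n) ^ 2 := by rw [pow_add]; ring
      _ ≤ _ := by gcongr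
  calc _ = ((n.choose r : ℝ) * weight n m r) * hvar P k r * (r * weight n m r) := by ring
    _ = (m.choose r : ℝ) * hvar P k r * (r * weight n m r) := by rw [h1]
    _ ≤ (m.choose r : ℝ) * hvar P k r * (2 * ((m : ℝ) / n) ^ 2) := by gcongr
    _ = _ := by ring

end UStatistic

/-! ### First-order projections -/

section Projection

variable {M : Type*} [MeasurableSpace M] {P : Measure M} [IsProbabilityMeasure P] {m n : ℕ}
  {k : (Fin m → M) → ℝ}

lemma component_singleton (i : Fin n) (x : Fin n → M) :
    component P k {i} x = partialMean P k 1 (fun _ => x i) - mean P k := by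
  have e := eval_enum_eq (M := M) (A := {i}) (s := 1) (Finset.card_singleton i)
    (f := ({i} : Finset (Fin n)).orderEmbOfFin (Finset.card_singleton i))
    (fun l => Finset.orderEmbOfFin_mem _ _ _) (fun s y => hproj P k s y) x
  rw [component, ← e, hproj]
  simp only [Finset.orderEmbOfFin_singleton]
  simp

lemma sum_cardBetween_one (hm : 1 ≤ m) (f : Finset (Fin n) → ℝ) :
    ∑ A ∈ cardBetween n 1 m, f A = ∑ i, f {i} + ∑ A ∈ cardBetween n 2 m, f A := by
  rw [sum_cardBetween, sum_cardBetween, ← Finset.add_sum_Ioc_eq_sum_Icc hm]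
  congr 1
  rw [Finset.powersetCard_one, Finset.sum_map]
  rfl

/-- The Hoeffding decomposition of a U-statistic. -/
lemma ustat_decomposition (hm : 1 ≤ m) (hmn : m ≤ n) (x : Fin n → M) :
    ustat k n x - mean P k = (m : ℝ) / n * ∑ i, (partialMean P k 1 (fun _ => x i) - mean P k) +
      ∑ A ∈ cardBetween n 2 m, weight n m A.card * component P k A x := by
  rw [ustat_sub_mean hm hmn, sum_cardBetween_one hm, Finset.mul_sum]
  congr 1
  refine Finset.sum_congr rfl fun i _ => ?_
  rw [Finset.card_singleton, weight_one, component_singleton]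

lemma hproj_one (x : Fin 1 → M) : hproj P k 1 x = partialMean P k 1 x - mean P k := by
  rw [hproj]; simp

lemma measurable_partialMean_one (hk : Measurable k) :
    Measurable fun t : M => partialMean P k 1 fun _ => t := by
  have h := (measurable_hproj (P := P) hk 1).comp
    (measurable_pi_lambda (fun (t : M) (_ : Fin 1) => t) fun _ => measurable_id)
  have h2 := h.add_const (mean P k)
  convert h2 using 2
  simp [hproj_one]

lemma memLp_comp_eval {p : ENNReal} {f : M → ℝ} (hf : Measurable f) (i : Fin n) :
    MemLp (fun x : Fin n → M => f (x i)) p (Measure.pi fun _ : Fin n => P) ↔ MemLp f p P := by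
  have h := measurePreserving_eval (fun _ : Fin n => P) i
  constructor
  · intro hL
    rw [← h.map_eq, memLp_map_measure_iff hf.aestronglyMeasurable h.measurable.aemeasurable]
    exact hL
  · exact fun hL => hL.comp_measurePreserving h

lemma integral_comp_eval {f : M → ℝ} (hf : Measurable f) (i : Fin n) :
    ∫ x : Fin n → M, f (x i) ∂(Measure.pi fun _ : Fin n => P) = ∫ t, f t ∂P := by
  have h := measurePreserving_eval (fun _ : Fin n => P) i
  rw [← h.map_eq, integral_map h.measurable.aemeasurable hf.aestronglyMeasurable, h.map_eq]

lemma memLp_partialMean_one {p : ENNReal} (hp1 : 1 ≤ p) (hp : p ≠ ⊤) (hk : Measurable k)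
    (hL : MemLp k p (Measure.pi fun _ : Fin m => P)) :
    MemLp (fun t : M => partialMean P k 1 fun _ => t) p P := by
  have h := memLp_component (n := 1) hp1 hp hL {0}
  have e : component P k ({0} : Finset (Fin 1)) =
    fun x => partialMean P k 1 (fun _ => x 0) - mean P k := funext fun x => component_singleton 0 x
  rw [e] at h
  have h2 := h.add (memLp_const (mean P k))
  rw [← memLp_comp_eval (n := 1) (measurable_partialMean_one hk) 0]
  convert h2 using 1
  ext x; simp

lemma integral_partialMean_one (hm : 1 ≤ m) (hk : Measurable k) (hs : IsSymmKernel k)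
    (hi : Integrable k (Measure.pi fun _ : Fin m => P)) :
    ∫ t, (partialMean P k 1 (fun _ => t) - mean P k) ∂P = 0 := by
  rw [← integral_comp_eval (n := 1) (f := fun t => partialMean P k 1 (fun _ => t) - mean P k)
    ((measurable_partialMean_one hk).sub_const _) 0]
  have h := component_degenerate (n := 1) hs hi {0} (by simpa using hm) 0 (by simp)
  have hL := memLp_component (n := 1) le_rfl (by simp) (memLp_one_iff_integrable.2 hi) {0}
  have h0 := integral_mul_eq_zero_of_degenerate (A := fun _ => 1) (fun _ _ => rfl) h
    (by simpa using memLp_one_iff_integrable.1 hL)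
  simpa [component_singleton] using h0

lemma hvar_one (hk : Measurable k) :
    hvar P k 1 = ∫ t, (partialMean P k 1 (fun _ => t) - mean P k) ^ 2 ∂P := by
  rw [hvar, mean, ← integral_comp_eval (n := 1)
    (f := fun t => (partialMean P k 1 (fun _ => t) - mean P k) ^ 2)
    (((measurable_partialMean_one hk).sub_const _).pow_const 2) 0]
  refine integral_congr_ae (Filter.Eventually.of_forall fun x => ?_)
  simp only [hproj_one]
  congr 3; ext l; rw [Subsingleton.elim l 0]

lemma hvarSum_one (hm : 1 ≤ m) : hvarSum P k 1 = m * hvar P k 1 + hvarSum P k 2 := by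
  rw [hvarSum, ← Finset.add_sum_Ioc_eq_sum_Icc hm]
  simp only [Nat.choose_one_right]
  rfl

end Projection

/-! ### Consequences of the assumptions, and Berry-Esseen for complete U-statistics -/

section Admissible

variable {M : Type*} [MeasurableSpace M] {P : Measure M} [IsProbabilityMeasure P] {m n : ℕ}
  {h : (Fin m → M) → ℝ}

lemma Admissible.memLp_three (ha : Admissible P h) :
    MemLp h 3 (Measure.pi fun _ : Fin m => P) := by
  rw [← integrable_norm_rpow_iff ha.measurable.aestronglyMeasurable (by simp) (by simp)]
  refine ha.third_moment.congr (Filter.Eventually.of_forall fun x => ?_)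
  simp only [Real.norm_eq_abs]
  rw [← Real.rpow_natCast]
  norm_num

lemma Admissible.integrable (ha : Admissible P h) :
    Integrable h (Measure.pi fun _ : Fin m => P) := ha.memLp_two.integrable (by norm_num)

lemma Admissible.varH_eq (ha : Admissible P h) : varH P h = mean P fun x => h x ^ 2 :=
  variance_of_integral_eq_zero ha.measurable.aemeasurable ha.mean_zero

lemma Admissible.measurable_g (ha : Admissible P h) : Measurable (g P h) :=
  measurable_partialMean_one ha.measurable

lemma Admissible.memLp_g (ha : Admissible P h) : MemLp (g P h) 3 P :=
  memLp_partialMean_one (by norm_num) (by simp) ha.measurable ha.memLp_three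

lemma Admissible.integral_g (ha : Admissible P h) (hm : 1 ≤ m) : ∫ t, g P h t ∂P = 0 := by
  have := integral_partialMean_one hm ha.measurable ha.symm ha.integrable
  simpa [ha.mean_zero, g] using this

lemma Admissible.varG_eq (ha : Admissible P h) (hm : 1 ≤ m) :
    varG P h = ∫ t, g P h t ^ 2 ∂P :=
  variance_of_integral_eq_zero ha.measurable_g.aemeasurable (ha.integral_g hm)

/-- The order-one components carry variance `m σ_g²`. The rest is what the second term of `B2`
measures, and its nonnegativity gives `m σ_g² ≤ σ_h²`. -/
lemma Admissible.hvarSum_two (ha : Admissible P h) (hm : 1 ≤ m) :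
    hvarSum P h 2 = varH P h - m * varG P h := by
  have h1 := integral_sq_sub_mean hm ha.measurable ha.symm ha.memLp_two
  have h2 := hvar_one (P := P) ha.measurable
  have h3 := hvarSum_one (P := P) (k := h) hm
  simp only [ha.mean_zero, sub_zero] at h1 h2
  rw [ha.varH_eq, ha.varG_eq hm, h1, h3, h2]
  simp only [g]
  ring

lemma Admissible.varG_le (ha : Admissible P h) (hm : 1 ≤ m) : m * varG P h ≤ varH P h := by
  have := ha.hvarSum_two hm
  have := hvarSum_nonneg (P := P) (k := h) 2
  linarith

lemma pow_three_le_integral_of_sq {Ω : Type*} [MeasurableSpace Ω] {μ : Measure Ω}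
    [IsProbabilityMeasure μ] {f : Ω → ℝ} (hf : MemLp f 3 μ) {v : ℝ} (hv0 : 0 ≤ v)
    (hv : v = ∫ ω, f ω ^ 2 ∂μ) : √v ^ 3 ≤ ∫ ω, |f ω| ^ 3 ∂μ := by
  have := integral_sq_mul_le hf (s := √v)
  rw [← hv, abs_of_nonneg (Real.sqrt_nonneg v)] at this
  have h2 := Real.sq_sqrt hv0
  have h3 : √v ^ 3 = √v * v := by rw [pow_succ, h2]; ring
  linarith

lemma Admissible.sigmaG_pos (ha : Admissible P h) : 0 < sigmaG P h := Real.sqrt_pos.2 ha.varG_pos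

lemma Admissible.sigmaH_pos (ha : Admissible P h) : 0 < sigmaH P h := Real.sqrt_pos.2 ha.varH_pos

lemma Admissible.sigmaG_sq (ha : Admissible P h) : sigmaG P h ^ 2 = varG P h :=
  Real.sq_sqrt ha.varG_pos.le

lemma Admissible.sigmaH_sq (ha : Admissible P h) : sigmaH P h ^ 2 = varH P h :=
  Real.sq_sqrt ha.varH_pos.le

lemma integral_abs_mul_abs_le {Ω : Type*} [MeasurableSpace Ω] {μ : Measure Ω} {a b : Ω → ℝ}
    (ha : MemLp a 2 μ) (hb : MemLp b 2 μ) {c : ℝ} (hc : 0 < c) :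
    ∫ ω, |a ω| * |b ω| ∂μ ≤ (c * ∫ ω, a ω ^ 2 ∂μ + (∫ ω, b ω ^ 2 ∂μ) / c) / 2 := by
  have h1 := ha.integrable_sq
  have h2 := hb.integrable_sq
  rw [← integral_const_mul, ← integral_div, ← integral_add (h1.const_mul c) (h2.div_const c),
    ← integral_div]
  refine integral_mono (ha.abs.integrable_mul hb.abs)
    (((h1.const_mul c).add (h2.div_const c)).div_const 2) fun ω => ?_
  have : 0 ≤ (c * |a ω| - |b ω|) ^ 2 / c := by positivity
  have h3 : (c * |a ω| - |b ω|) ^ 2 / c = c * a ω ^ 2 - 2 * (|a ω| * |b ω|) + b ω ^ 2 / c := by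
    rw [← sq_abs (a ω), ← sq_abs (b ω)]; field_simp; ring
  simp only
  linarith

/-- A Berry-Esseen bound for complete U-statistics. -/
theorem ustat_berryEsseen (ha : Admissible P h) (hm : 2 ≤ m) (hmn : 2 * m < n) (u : ℝ) :
    |(Measure.pi fun _ : Fin n => P).real {x | ustat h n x ≤ u} -
      Phi (u * (√n / (m * sigmaG P h)))| ≤ 48 * B2 P h n := by
  set μ := Measure.pi fun _ : Fin n => P with hμ
  have hσ := ha.sigmaG_pos
  have hσ2 := ha.sigmaG_sq
  have hn0 : (0 : ℝ) < n := by exact_mod_cast (by omega : 0 < n)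
  have hm0 : (0 : ℝ) < m := by exact_mod_cast (by omega : 0 < m)
  have hsn : 0 < √(n : ℝ) := Real.sqrt_pos.2 hn0
  have hsn2 : √(n : ℝ) ^ 2 = n := Real.sq_sqrt hn0.le
  set a : ℝ := √n / (m * sigmaG P h) with haa
  have ha0 : 0 < a := by positivity
  set b : ℝ := (√n * sigmaG P h)⁻¹ with hb
  have hb0 : 0 < b := by positivity
  have hab : a * ((m : ℝ) / n) = b := by
    rw [haa, hb]
    field_simp
    exact hsn2
  set ξ : Fin n → (Fin n → M) → ℝ := fun i x => b * g P h (x i) with hξ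
  set comp : Finset (Fin n) → (Fin n → M) → ℝ := fun A x =>
    weight n m A.card * component P h A x with hcomp
  set Δ : (Fin n → M) → ℝ := fun x => a * ∑ A ∈ cardBetween n 2 m, comp A x with hΔ
  -- The leave-one-out perturbation drops exactly the components containing `i`, so it does not see
  -- the coordinate on which `ξ i` depends.
  set Δ' : Fin n → (Fin n → M) → ℝ := fun i x =>
    a * ∑ A ∈ (cardBetween n 2 m).filter (fun A => i ∉ A), comp A x with hΔ'
  have hgm := ha.measurable_g
  have hcm : ∀ A, Measurable (comp A) := fun A => (measurable_component ha.measurable A).const_mul _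
  have hcL : ∀ A, MemLp (comp A) 2 μ := fun A =>
    (memLp_component (by norm_num) (by simp) ha.memLp_two A).const_mul _
  have hξm : ∀ i, Measurable (ξ i) := fun i => (hgm.comp (measurable_pi_apply i)).const_mul _
  have hξL : ∀ i, MemLp (ξ i) 3 μ := fun i => ((memLp_comp_eval hgm i).2 ha.memLp_g).const_mul _
  have hξ0 : ∀ i, ∫ x, ξ i x ∂μ = 0 := fun i => by
    rw [integral_const_mul, hμ, integral_comp_eval hgm, ha.integral_g (by omega), mul_zero]
  have hind : iIndepFun ξ μ :=
    iIndepFun_pi (X := fun _ t => b * g P h t) fun _ => (hgm.const_mul b).aemeasurable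
  have hξ2 : ∀ i, ∫ x, ξ i x ^ 2 ∂μ = 1 / n := fun i => by
    simp only [hξ, mul_pow]
    rw [integral_const_mul, hμ, integral_comp_eval (f := fun t => g P h t ^ 2) (hgm.pow_const 2),
      ← ha.varG_eq (by omega), ← hσ2, hb]
    field_simp
    rw [hsn2]
  have hv : ∑ i, ∫ x, ξ i x ^ 2 ∂μ = 1 := by
    simp only [hξ2, Finset.sum_const, Finset.card_univ, Fintype.card_fin, nsmul_eq_mul]
    field_simp
  set γ : ℝ := (∫ x, |g P h x| ^ 3 ∂P) / (√n * sigmaG P h ^ 3) with hγ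
  have hg3 : 0 < ∫ x, |g P h x| ^ 3 ∂P := lt_of_lt_of_le (pow_pos hσ 3)
    (pow_three_le_integral_of_sq ha.memLp_g ha.varG_pos.le (ha.varG_eq (by omega)))
  have hγ0 : 0 < γ := by positivity
  have hγ' : ∑ i, ∫ x, |ξ i x| ^ 3 ∂μ ≤ γ := by
    have : ∀ i, ∫ x, |ξ i x| ^ 3 ∂μ = b ^ 3 * ∫ x, |g P h x| ^ 3 ∂P := fun i => by
      simp only [hξ, abs_mul, mul_pow, abs_of_pos hb0]
      rw [integral_const_mul, hμ,
        integral_comp_eval (f := fun t => |g P h t| ^ 3) (hgm.abs.pow_const 3)]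
    simp only [this, Finset.sum_const, Finset.card_univ, Fintype.card_fin, nsmul_eq_mul]
    refine le_of_eq ?_
    rw [hγ, hb]
    field_simp
    rw [hsn2]
  have hΔL : MemLp Δ 2 μ := (memLp_finsetSum _ fun A _ => hcL A).const_mul _
  have hΔL' : ∀ i, MemLp (Δ' i) 2 μ := fun i => (memLp_finsetSum _ fun A _ => hcL A).const_mul _
  have hind' : ∀ i, ξ i ⟂ᵢ[μ] fun x => (∑ j, ξ j x - ξ i x, Δ' i x) := fun i => by
    have h1 := IndepOfCoord.indepFun (P := P) (i := i)
      (F := fun x : Fin n → M => (∑ j, ξ j x - ξ i x, Δ' i x))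
      (((Finset.measurable_fun_sum _ fun j _ => hξm j).sub (hξm i)).prodMk
        ((Finset.measurable_fun_sum _ fun A _ => hcm A).const_mul _)) (fun x t => by
        have e1 : ∀ y : Fin n → M, ∑ j, ξ j y - ξ i y = ∑ j ∈ Finset.univ.erase i, ξ j y :=
          fun y => by rw [← Finset.add_sum_erase _ _ (Finset.mem_univ i)]; ring
        refine Prod.ext ?_ ?_
        · simp only [e1]
          refine Finset.sum_congr rfl fun j hj => ?_
          simp only [hξ, Function.update_of_ne (Finset.ne_of_mem_erase hj)]
        · simp only [hΔ']
          congr 1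
          refine Finset.sum_congr rfl fun A hA => ?_
          simp only [hcomp, component_indepOfCoord (Finset.mem_filter.1 hA).2 x t])
    exact h1.comp (φ := fun t => b * g P h t) (ψ := id) (hgm.const_mul b) measurable_id
  have hmain := berryEsseen_add hξm hξL hξ0 hind hv hγ0 hγ' hΔL hΔL' hind' (u * a)
  have hset : {x : Fin n → M | ∑ i, ξ i x + Δ x ≤ u * a} = {x | ustat h n x ≤ u} := by
    ext x
    have hd := ustat_decomposition (P := P) (k := h) (by omega : 1 ≤ m) (by omega : m ≤ n) x
    simp only [ha.mean_zero, sub_zero] at hd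
    have : ∑ i, ξ i x + Δ x = ustat h n x * a := by
      rw [hd]
      simp only [hξ, hΔ, hcomp, ← Finset.mul_sum, ← hab, g]
      ring
    simp only [Set.mem_ofPred_eq, this]
    exact mul_le_mul_iff_of_pos_right ha0
  rw [hset] at hmain
  set τ : ℝ := (m : ℝ) / n * (varH P h / (m * varG P h) - 1) with hτ
  have haτ : a ^ 2 * (((m : ℝ) / n) ^ 2 * hvarSum P h 2) = τ := by
    rw [ha.hvarSum_two (by omega), ← mul_assoc, ← mul_pow, hab, hb, hτ, inv_pow, mul_pow, hsn2, hσ2]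
    have := ha.varG_pos
    field_simp
  have hΔ2 : ∫ x, Δ x ^ 2 ∂μ ≤ τ := by
    simp only [hΔ, mul_pow]
    rw [integral_const_mul, ← haτ]
    gcongr
    exact integral_sq_sum_weight_le (by omega) ha.measurable ha.symm ha.memLp_two
  have hdiff : ∀ i x, Δ x - Δ' i x =
      a * ∑ A ∈ (cardBetween n 2 m).filter (fun A => i ∈ A), comp A x := fun i x => by
    simp only [hΔ, hΔ']
    rw [← Finset.sum_filter_add_sum_filter_not (cardBetween n 2 m) (fun A => i ∈ A)]
    ring
  have hΔΔ : ∑ i, ∫ x, (Δ x - Δ' i x) ^ 2 ∂μ ≤ 2 * τ := by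
    simp only [hdiff, mul_pow, integral_const_mul]
    rw [← Finset.mul_sum, ← haτ]
    have := sum_integral_sq_sum_weight_le (P := P) (n := n) hmn.le ha.measurable ha.symm
      ha.memLp_two
    calc _ ≤ a ^ 2 * (2 * (((m : ℝ) / n) ^ 2 * hvarSum P h 2)) := by gcongr
      _ = _ := by ring
  have hξL2 : ∀ i, MemLp (ξ i) 2 μ := fun i => (hξL i).mono_exponent (by norm_num)
  -- Weighted AM-GM in place of Cauchy-Schwarz; taking `c` strictly above `√τ` avoids division by
  -- zero when `τ = 0`, and the limit `c → √τ` follows. The two parts are at most `c` and `3c/2`.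
  have hkey : ∀ c, √τ < c → ∫ x, |∑ i, ξ i x| * |Δ x| ∂μ +
      ∑ i, ∫ x, |ξ i x| * |Δ x - Δ' i x| ∂μ ≤ 5 / 2 * c := by
    intro c hc
    have hc0 : 0 < c := lt_of_le_of_lt (Real.sqrt_nonneg _) hc
    have hcτ : τ / c ≤ c := by
      rw [div_le_iff₀ hc0, ← sq]
      exact (Real.sqrt_le_left hc0.le).1 hc.le
    have h1 := integral_abs_mul_abs_le (memLp_finsetSum Finset.univ fun i _ => hξL2 i) hΔL hc0
    rw [integral_sq_sum_of_indep (fun i _ => hξL2 i) (fun i _ => hξ0 i)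
      (fun i _ j _ hij => hind.indepFun hij), hv] at h1
    have h2 := Finset.sum_le_sum fun i (_ : i ∈ Finset.univ) =>
      integral_abs_mul_abs_le (hξL2 i) (hΔL.sub (hΔL' i)) hc0
    simp only [Pi.sub_apply] at h2
    rw [← Finset.sum_div, Finset.sum_add_distrib, ← Finset.mul_sum, hv, ← Finset.sum_div] at h2
    have h3 : (∫ x, Δ x ^ 2 ∂μ) / c ≤ τ / c := by gcongr
    have h4 : (∑ i, ∫ x, (Δ x - Δ' i x) ^ 2 ∂μ) / c ≤ 2 * τ / c := by gcongr
    rw [mul_div_assoc] at h4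
    linarith
  have hlim := le_of_forall_gt_imp_ge_of_dense (a₂ := 5 / 2 * √τ) (a₁ := ∫ x, |∑ i, ξ i x| * |Δ x| ∂μ +
      ∑ i, ∫ x, |ξ i x| * |Δ x - Δ' i x| ∂μ) fun c hc => by
    have := hkey (2 / 5 * c) (by linarith)
    linarith
  have hB2 : B2 P h n = γ + √τ := rfl
  rw [hB2]
  have := Real.sqrt_nonneg τ
  linarith

end Admissible

/-! ### The normal distribution function under a change of scale -/

section NormalScale

lemma abs_mul_phi_le (w : ℝ) : |w * phi w| ≤ 1 := by
  have h1 : |w| * Real.exp (-w ^ 2 / 2) ≤ 1 := by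
    rw [neg_div, Real.exp_neg, ← div_eq_mul_inv, div_le_one (Real.exp_pos _)]
    have := Real.add_one_le_exp (w ^ 2 / 2)
    nlinarith [sq_nonneg (|w| - 1), sq_abs w]
  have h2 : (√(2 * Real.pi))⁻¹ ≤ 1 := inv_le_one_of_one_le₀ one_le_sqrt_two_pi
  rw [abs_mul, abs_of_pos (phi_pos w), phi_eq]
  have h3 : 0 ≤ |w| * Real.exp (-w ^ 2 / 2) := by positivity
  calc _ = (√(2 * Real.pi))⁻¹ * (|w| * Real.exp (-w ^ 2 / 2)) := by ring
    _ ≤ 1 := mul_le_one₀ h2 h3 h1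

lemma abs_pow_three_mul_phi_le (w : ℝ) : |w ^ 3 * phi w| ≤ 8 := by
  have h1 : |w| ^ 3 * Real.exp (-w ^ 2 / 2) ≤ 8 := by
    rw [neg_div, Real.exp_neg, ← div_eq_mul_inv, div_le_iff₀ (Real.exp_pos _)]
    have h := Real.quadratic_le_exp_of_nonneg (x := w ^ 2 / 2) (by positivity)
    have e : w ^ 2 = |w| ^ 2 := (sq_abs w).symm
    rw [e] at h ⊢
    have h0 := abs_nonneg w
    nlinarith [mul_nonneg (sq_nonneg |w|) (sq_nonneg (|w| - 1)), sq_nonneg (|w| - 1)]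
  have h2 : (√(2 * Real.pi))⁻¹ ≤ 1 := inv_le_one_of_one_le₀ one_le_sqrt_two_pi
  rw [abs_mul, abs_of_pos (phi_pos w), phi_eq, abs_pow]
  have h3 : 0 ≤ |w| ^ 3 * Real.exp (-w ^ 2 / 2) := by positivity
  calc _ = (√(2 * Real.pi))⁻¹ * (|w| ^ 3 * Real.exp (-w ^ 2 / 2)) := by ring
    _ ≤ 1 * 8 := mul_le_mul h2 h1 h3 zero_le_one
    _ = 8 := one_mul _

lemma abs_mul_phi_sub_le (a b : ℝ) : |a * phi a - b * phi b| ≤ 9 * |a - b| := by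
  have := (convex_univ (𝕜 := ℝ) (E := ℝ)).norm_image_sub_le_of_norm_hasDerivWithin_le
    (f := fun w => w * phi w) (f' := fun w => 1 * phi w + w * (-w * phi w)) (C := 9)
    (fun w _ => ((hasDerivAt_id w).mul (hasDerivAt_phi w)).hasDerivWithinAt) (fun w _ => ?_)
    (x := b) (y := a) (Set.mem_univ _) (Set.mem_univ _)
  · simpa using this
  · have h1 := abs_mul_phi_le w
    have h2 := abs_pow_three_mul_phi_le w
    have h3 := phi_pos w
    have h4 := phi_le_one w
    have h5 : w ^ 2 * phi w ≤ 8 := by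
      rw [abs_mul, abs_pow, abs_of_pos h3] at h2
      rw [abs_mul, abs_of_pos h3] at h1
      rw [← sq_abs]
      have h0 := abs_nonneg w
      rcases le_total |w| 1 with h | h
      · nlinarith
      · have : |w| ^ 2 ≤ |w| ^ 3 := pow_le_pow_right₀ h (by norm_num)
        nlinarith
    have h6 : 0 ≤ w ^ 2 * phi w := by positivity
    rw [Real.norm_eq_abs, abs_le]
    constructor <;> nlinarith

/-- A second-order expansion in the scale, uniform in `a`. The second derivative `-a³ u φ(au)` is
`-(au)³ φ(au) / u²`, hence at most `4 * 8` for `u ≥ 1/2`. -/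
lemma abs_Phi_mul_sub_le (a : ℝ) {s : ℝ} (hs : 1 / 2 ≤ s) :
    |Phi (a * s) - Phi a - (s - 1) * (a * phi a)| ≤ 32 * (s - 1) ^ 2 := by
  have hd1 : ∀ u : ℝ, HasDerivAt (fun u => a * phi (a * u)) (-(a ^ 3 * u * phi (a * u))) u :=
    fun u => by
      have h : HasDerivAt (fun u : ℝ => a * u) a u := by
        simpa using (hasDerivAt_id u).const_mul a
      refine (((hasDerivAt_phi (a * u)).comp u h).const_mul a).congr_deriv ?_
      ring
  have hb1 : ∀ u : ℝ, 1 / 2 ≤ u → |-(a ^ 3 * u * phi (a * u))| ≤ 32 := fun u hu => by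
    have h := abs_pow_three_mul_phi_le (a * u)
    have e : (a * u) ^ 3 * phi (a * u) = u ^ 2 * (a ^ 3 * u * phi (a * u)) := by ring
    rw [e, abs_mul, abs_of_nonneg (sq_nonneg u)] at h
    rw [abs_neg]
    have h0 := abs_nonneg (a ^ 3 * u * phi (a * u))
    have hu2 : 1 / 4 ≤ u ^ 2 := by nlinarith
    have h4 := mul_le_mul_of_nonneg_right hu2 h0
    linarith
  have h1 : ∀ u : ℝ, 1 / 2 ≤ u → |a * phi (a * u) - a * phi a| ≤ 32 * |u - 1| := fun u hu => by
    have := (convex_Ici (1 / 2 : ℝ)).norm_image_sub_le_of_norm_hasDerivWithin_le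
      (fun w _ => (hd1 w).hasDerivWithinAt) (fun w hw => hb1 w hw)
      (x := 1) (y := u) (Set.mem_Ici.2 (by norm_num)) hu
    simpa using this
  have hseg : ∀ θ ∈ Set.Icc (0 : ℝ) 1, 1 / 2 ≤ 1 + θ * (s - 1) := fun θ hθ => by
    nlinarith [hθ.1, hθ.2]
  have := (convex_Icc (0 : ℝ) 1).norm_image_sub_le_of_norm_hasDerivWithin_le
    (f := fun θ => Phi (a * (1 + θ * (s - 1))) - θ * ((s - 1) * (a * phi a)))
    (f' := fun θ => (a * phi (a * (1 + θ * (s - 1))) - a * phi a) * (s - 1))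
    (C := 32 * (s - 1) ^ 2) (fun θ hθ => ?_) (fun θ hθ => ?_)
    (x := 0) (y := 1) (by simp) (by simp)
  · simp only [one_mul, zero_mul, add_zero, sub_zero, norm_one, mul_one, Real.norm_eq_abs,
      add_sub_cancel] at this
    calc _ = |Phi (a * s) - (s - 1) * (a * phi a) - Phi a| := by congr 1; ring
      _ ≤ _ := this
  · have h : HasDerivAt (fun θ : ℝ => a * (1 + θ * (s - 1))) (a * (s - 1)) θ := by
      simpa using (((hasDerivAt_id θ).mul_const (s - 1)).const_add 1).const_mul a
    have h2 : HasDerivAt (fun θ : ℝ => θ * ((s - 1) * (a * phi a))) ((s - 1) * (a * phi a)) θ := by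
      simpa using (hasDerivAt_id θ).mul_const ((s - 1) * (a * phi a))
    exact ((((hasDerivAt_Phi _).comp θ h).sub h2).congr_deriv (by ring)).hasDerivWithinAt
  · have h2 := h1 _ (hseg θ hθ)
    rw [norm_mul, Real.norm_eq_abs, Real.norm_eq_abs]
    have h3 : |1 + θ * (s - 1) - 1| ≤ |s - 1| := by
      rw [add_sub_cancel_left, abs_mul, abs_of_nonneg hθ.1]
      exact mul_le_of_le_one_left (abs_nonneg _) hθ.2
    calc _ ≤ 32 * |s - 1| * |s - 1| := by
          gcongr
          exact h2.trans (by linarith)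
      _ = _ := by rw [mul_assoc, abs_mul_abs_self]; ring

lemma abs_Phi_div_sqrt_sub_le (a : ℝ) {y : ℝ} (hy : |y| ≤ 1 / 2) :
    |Phi (a / √(1 + y)) - Phi a + 1 / 2 * (a * phi a) * y| ≤ 33 * y ^ 2 := by
  obtain ⟨hy1, hy2⟩ := abs_le.1 hy
  set r := √(1 + y) with hr
  have hr2 : r ^ 2 = 1 + y := Real.sq_sqrt (by linarith)
  have hr0 : 0 ≤ r := Real.sqrt_nonneg _
  have hr1 : 7 / 10 ≤ r := Real.le_sqrt_of_sq_le (by norm_num; linarith)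
  have hr3 : r ≤ 5 / 4 := Real.sqrt_le_iff.2 ⟨by norm_num, by norm_num; linarith⟩
  have hrpos : 0 < r := by linarith
  have hs : 1 / 2 ≤ 1 / r := by rw [div_le_div_iff₀ (by norm_num) hrpos]; linarith
  have h1 := abs_Phi_mul_sub_le a hs
  have h2 : |1 / r - 1| ≤ |y| := by
    have e : 1 / r - 1 = -y / (r * (1 + r)) := by
      field_simp; nlinarith
    rw [e, abs_div, abs_neg, abs_of_pos (by positivity : 0 < r * (1 + r))]
    exact div_le_self (abs_nonneg _) (by nlinarith)
  have h3 : |1 / r - 1 + y / 2| ≤ y ^ 2 := by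
    have e : 1 / r - 1 + y / 2 = y ^ 2 * ((r + 2) / (2 * r * (1 + r) ^ 2)) := by
      have : y = r ^ 2 - 1 := by linarith
      rw [this]
      field_simp; ring
    rw [e, abs_of_nonneg (by positivity)]
    refine mul_le_of_le_one_right (sq_nonneg y) ?_
    rw [div_le_one (by positivity)]
    nlinarith
  have h4 : (1 / r - 1) ^ 2 ≤ y ^ 2 := sq_le_sq.2 h2
  have h5 := abs_mul_phi_le a
  have h6 : |(1 / r - 1 + y / 2) * (a * phi a)| ≤ y ^ 2 := by
    rw [abs_mul]
    calc _ ≤ y ^ 2 * 1 := by gcongr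
      _ = _ := mul_one _
  rw [div_eq_mul_one_div]
  calc _ = |(Phi (a * (1 / r)) - Phi a - (1 / r - 1) * (a * phi a)) +
        (1 / r - 1 + y / 2) * (a * phi a)| := by congr 1; ring
    _ ≤ _ := abs_add_le _ _
    _ ≤ _ := by linarith

/-- When the relative change of variance is not small, the error `|L|^{3/2} + |ρ|` already dominates
every bounded quantity and the linear term. -/
lemma one_le_of_half_lt_abs_add {L ρ : ℝ} (h : 1 / 2 < |L + ρ|) :
    1 ≤ 8 * (|L| ^ (3 / 2 : ℝ) + |ρ|) ∧ |L| ≤ 8 * (|L| ^ (3 / 2 : ℝ) + |ρ|) := by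
  have h0 := abs_add_le L ρ
  have hρ := abs_nonneg ρ
  have hL := abs_nonneg L
  rw [rpow_three_halves hL]
  have hs := Real.sqrt_nonneg |L|
  rcases le_or_gt (1 / 4) |L| with h1 | h1
  · have h2 : 1 / 2 ≤ √(|L|) := Real.le_sqrt_of_sq_le (by norm_num; linarith)
    constructor <;> nlinarith
  · have h3 : 0 ≤ |L| * √(|L|) := by positivity
    constructor <;> nlinarith

lemma sq_add_le_of_abs_le {L ρ : ℝ} (h : |L + ρ| ≤ 1 / 2) :
    (L + ρ) ^ 2 ≤ 2 * (|L| ^ (3 / 2 : ℝ) + |ρ|) := by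
  have hρ := abs_nonneg ρ
  have hL := abs_nonneg L
  rw [rpow_three_halves hL]
  have hs := Real.sqrt_nonneg |L|
  have hs2 := Real.sq_sqrt hL
  rcases le_or_gt (1 / 2) |L| with h1 | h1
  · have h2 : 1 / 2 ≤ √(|L|) := Real.le_sqrt_of_sq_le (by norm_num; linarith)
    have h3 : (L + ρ) ^ 2 ≤ 1 / 4 := by rw [← sq_abs]; nlinarith [abs_nonneg (L + ρ)]
    nlinarith
  · have h2 : |ρ| ≤ 1 := by
      have := abs_sub (L + ρ) L
      rw [add_sub_cancel_left] at this
      linarith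
    have h3 : |L| ≤ √(|L|) := Real.le_sqrt_of_sq_le (by nlinarith)
    have h4 : (L + ρ) ^ 2 ≤ 2 * |L| ^ 2 + 2 * |ρ| ^ 2 := by
      rw [sq_abs, sq_abs]; nlinarith [sq_nonneg (L - ρ)]
    nlinarith

/-- Comparison of the normal distribution functions at two scales, to first order in a part `L`
of the relative change of the variance. -/
lemma abs_Phi_scale_le (a : ℝ) (L ρ : ℝ) :
    |Phi (a / √(1 + (L + ρ))) - Phi a + 1 / 2 * (a * phi a) * L| ≤
      100 * (|L| ^ (3 / 2 : ℝ) + |ρ|) := by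
  have h5 := abs_mul_phi_le a
  have h6 : ∀ t, |1 / 2 * (a * phi a) * t| ≤ 1 / 2 * |t| := fun t => by
    rw [abs_mul, abs_mul, abs_of_pos (by norm_num : (0 : ℝ) < 1 / 2)]
    have := abs_nonneg t
    nlinarith
  have h0 : 0 ≤ |L| ^ (3 / 2 : ℝ) := by positivity
  rcases le_or_gt |L + ρ| (1 / 2) with h | h
  · have h1 := abs_Phi_div_sqrt_sub_le a h
    have h2 := sq_add_le_of_abs_le h
    calc _ = |(Phi (a / √(1 + (L + ρ))) - Phi a + 1 / 2 * (a * phi a) * (L + ρ)) -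
          1 / 2 * (a * phi a) * ρ| := by congr 1; ring
      _ ≤ _ := abs_sub _ _
      _ ≤ 33 * (L + ρ) ^ 2 + 1 / 2 * |ρ| := add_le_add h1 (h6 ρ)
      _ ≤ _ := by linarith [abs_nonneg ρ]
  · obtain ⟨h1, h2⟩ := one_le_of_half_lt_abs_add h
    have h3 : |Phi (a / √(1 + (L + ρ))) - Phi a| ≤ 1 := by
      rw [abs_le]
      constructor <;> linarith [Phi_nonneg (a / √(1 + (L + ρ))), Phi_le_one (a / √(1 + (L + ρ))),
        Phi_nonneg a, Phi_le_one a]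
    calc _ ≤ _ := abs_add_le _ _
      _ ≤ 1 + 1 / 2 * |L| := add_le_add h3 (h6 L)
      _ ≤ _ := by linarith

end NormalScale

/-! ### Smoothing by an independent Gaussian -/

section GaussianConvolution

lemma continuous_Phi : Continuous Phi :=
  continuous_iff_continuousAt.2 fun x => (hasDerivAt_Phi x).continuousAt

/-- Both integrals are the probability that `U` plus `s` times an independent standard normal is at
most `c`, integrated in either order. -/
lemma integral_Phi_eq {Ω : Type*} [MeasurableSpace Ω] {μ : Measure Ω} [IsProbabilityMeasure μ]
    {U : Ω → ℝ} (hU : Measurable U) {s : ℝ} (hs : 0 < s) (c : ℝ) :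
    Integrable (fun t => μ.real {ω | U ω ≤ c - s * t}) (gaussianReal 0 1) ∧
    ∫ ω, Phi ((c - U ω) / s) ∂μ = ∫ t, μ.real {ω | U ω ≤ c - s * t} ∂(gaussianReal 0 1) := by
  set S : Set (Ω × ℝ) := {q | U q.1 ≤ c - s * q.2} with hS
  have hSm : MeasurableSet S := measurableSet_le (hU.comp measurable_fst) (by fun_prop)
  have hi : Integrable (S.indicator (1 : Ω × ℝ → ℝ)) (μ.prod (gaussianReal 0 1)) :=
    (integrable_const (1 : ℝ)).indicator hSm
  have h1 := integral_integral_swap (f := fun ω t => S.indicator (1 : Ω × ℝ → ℝ) (ω, t)) hi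
  have e1 : ∀ ω, ∫ t, S.indicator (1 : Ω × ℝ → ℝ) (ω, t) ∂(gaussianReal 0 1) =
      Phi ((c - U ω) / s) := fun ω => by
    rw [Phi, cdf_eq_real, ← integral_indicator_one measurableSet_Iic]
    congr 1; ext t
    simp only [Set.indicator, hS, Set.mem_ofPred_eq, Set.mem_Iic, Pi.one_apply, le_div_iff₀ hs]
    congr 1
    exact propext ⟨fun h => by linarith, fun h => by linarith⟩
  have e2 : ∀ t, ∫ ω, S.indicator (1 : Ω × ℝ → ℝ) (ω, t) ∂μ = μ.real {ω | U ω ≤ c - s * t} :=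
    fun t => by
      rw [← integral_indicator_one (measurableSet_le hU measurable_const)]
      rfl
  have h2 := hi.integral_prod_right
  simp only [e1, e2] at h1 h2
  exact ⟨h2, h1⟩

lemma integral_Phi_gaussian {s₁ s₂ : ℝ} (h₁ : 0 < s₁) (h₂ : 0 < s₂) (c : ℝ) :
    ∫ t, Phi ((c - s₂ * t) / s₁) ∂(gaussianReal 0 1) = Phi (c / √(s₁ ^ 2 + s₂ ^ 2)) := by
  set γ := gaussianReal 0 1
  have hs : 0 < √(s₁ ^ 2 + s₂ ^ 2) := Real.sqrt_pos.2 (by positivity)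
  have hsq : √(s₁ ^ 2 + s₂ ^ 2) ^ 2 = s₁ ^ 2 + s₂ ^ 2 := Real.sq_sqrt (by positivity)
  have hind : (fun q : ℝ × ℝ => s₁ * q.1) ⟂ᵢ[γ.prod γ] fun q => s₂ * q.2 :=
    indepFun_prod (X := fun t => s₁ * t) (Y := fun t => s₂ * t) (by fun_prop) (by fun_prop)
  have hm1 : (γ.prod γ).map (fun q => s₁ * q.1) = gaussianReal (s₁ * 0) (.mk (s₁ ^ 2) (sq_nonneg _) * 1) := by
    rw [← gaussianReal_map_const_mul s₁]
    have : (fun q : ℝ × ℝ => s₁ * q.1) = (fun t => s₁ * t) ∘ Prod.fst := rfl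
    rw [this, ← Measure.map_map (by fun_prop) measurable_fst, Measure.map_fst_prod]
    simp [γ]
  have hm2 : (γ.prod γ).map (fun q => s₂ * q.2) = gaussianReal (s₂ * 0) (.mk (s₂ ^ 2) (sq_nonneg _) * 1) := by
    rw [← gaussianReal_map_const_mul s₂]
    have : (fun q : ℝ × ℝ => s₂ * q.2) = (fun t => s₂ * t) ∘ Prod.snd := rfl
    rw [this, ← Measure.map_map (by fun_prop) measurable_snd, Measure.map_snd_prod]
    simp [γ]
  have hsum := gaussianReal_add_gaussianReal_of_indepFun hind hm1 hm2
  have hscale : γ.map (fun t => √(s₁ ^ 2 + s₂ ^ 2) * t) = (γ.prod γ).map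
      ((fun q : ℝ × ℝ => s₁ * q.1) + fun q => s₂ * q.2) := by
    rw [hsum, gaussianReal_map_const_mul]
    congr 1
    · simp
    · ext; simp [hsq]
  have h1 : Phi (c / √(s₁ ^ 2 + s₂ ^ 2)) =
      (γ.map (fun t => √(s₁ ^ 2 + s₂ ^ 2) * t)).real (Set.Iic c) := by
    rw [Phi, cdf_eq_real, map_measureReal_apply (by fun_prop) measurableSet_Iic]
    congr 1; ext t
    simp [le_div_iff₀ hs, mul_comm]
  rw [h1, hscale, map_measureReal_apply (by fun_prop) measurableSet_Iic]
  have hS : MeasurableSet (((fun q : ℝ × ℝ => s₁ * q.1) + fun q => s₂ * q.2) ⁻¹' Set.Iic c) :=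
    (by fun_prop : Measurable ((fun q : ℝ × ℝ => s₁ * q.1) + fun q => s₂ * q.2)) measurableSet_Iic
  have hi : Integrable ((((fun q : ℝ × ℝ => s₁ * q.1) + fun q => s₂ * q.2) ⁻¹' Set.Iic c).indicator
      (1 : ℝ × ℝ → ℝ)) (γ.prod γ) := (integrable_const (1 : ℝ)).indicator hS
  rw [← integral_indicator_one hS, integral_prod_symm _ hi]
  refine integral_congr_ae (Filter.Eventually.of_forall fun t => ?_)
  simp only
  rw [Phi, cdf_eq_real, ← integral_indicator_one measurableSet_Iic]
  congr 1; ext x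
  simp only [Set.indicator, Set.mem_preimage, Set.mem_Iic, Pi.add_apply, Pi.one_apply,
    le_div_iff₀ h₁]
  congr 1
  exact propext ⟨fun h => by linarith, fun h => by linarith⟩

/-- Adding an independent Gaussian to both laws averages the difference of their distribution
functions, so a uniform bound persists, and the two Gaussian variances add. -/
lemma abs_integral_Phi_sub_le {Ω : Type*} [MeasurableSpace Ω] {μ : Measure Ω}
    [IsProbabilityMeasure μ] {U : Ω → ℝ} (hU : Measurable U) {s₁ s₂ B : ℝ} (h₁ : 0 < s₁)
    (h₂ : 0 < s₂) (hB : ∀ u, |μ.real {ω | U ω ≤ u} - Phi (u / s₁)| ≤ B) (c : ℝ) :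
    |∫ ω, Phi ((c - U ω) / s₂) ∂μ - Phi (c / √(s₁ ^ 2 + s₂ ^ 2))| ≤ B := by
  obtain ⟨hi, he⟩ := integral_Phi_eq (μ := μ) hU h₂ c
  have hi2 : Integrable (fun t => Phi ((c - s₂ * t) / s₁)) (gaussianReal 0 1) :=
    Integrable.of_bound (continuous_Phi.comp (by fun_prop)).aestronglyMeasurable 1
      (Filter.Eventually.of_forall fun t => by
        rw [Real.norm_eq_abs, abs_of_nonneg (Phi_nonneg _)]; exact Phi_le_one _)
  rw [he, ← integral_Phi_gaussian h₁ h₂, ← integral_sub hi hi2]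
  refine abs_integral_le_integral_abs.trans ?_
  calc _ ≤ ∫ _, B ∂(gaussianReal 0 1) := integral_mono (hi.sub hi2).abs (integrable_const _)
        fun t => hB _
    _ = B := by simp

end GaussianConvolution

/-! ### Weighted Bernoulli sums -/

section Bernoulli

variable {ν : Measure ℝ} [IsProbabilityMeasure ν] {p : ℝ}

lemma ae_bernoulli (h1 : ν.real {1} = p) (h0 : ν.real {0} = 1 - p) :
    ∀ᵐ t ∂ν, t = 0 ∨ t = 1 := by
  have hm : MeasurableSet ({0, 1} : Set ℝ) := (Set.toFinite _).measurableSet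
  have : ν.real ({0, 1} : Set ℝ) = 1 := by
    rw [Set.insert_eq, measureReal_union (by simp) (measurableSet_singleton _), h0, h1]
    ring
  have h : ν ({0, 1} : Set ℝ)ᶜ = 0 := by
    rw [prob_compl_eq_zero_iff hm]
    rwa [measureReal_def, ENNReal.toReal_eq_one_iff] at this
  rw [← compl_mem_ae_iff, compl_compl] at h
  filter_upwards [h] with t ht
  simpa using ht

lemma bernoulli_ae_eq (h1 : ν.real {1} = p) (h0 : ν.real {0} = 1 - p) (f : ℝ → ℝ) :
    f =ᵐ[ν] fun t => f 1 * t + f 0 * (1 - t) := by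
  filter_upwards [ae_bernoulli h1 h0] with t ht
  rcases ht with rfl | rfl <;> simp

lemma integral_bernoulli_id (h1 : ν.real {1} = p) (h0 : ν.real {0} = 1 - p) :
    Integrable (fun t => t) ν ∧ ∫ t, t ∂ν = p := by
  have e : (fun t : ℝ => t) =ᵐ[ν] ({1} : Set ℝ).indicator 1 := by
    filter_upwards [ae_bernoulli h1 h0] with t ht
    rcases ht with rfl | rfl <;> simp
  refine ⟨((integrable_const (1 : ℝ)).indicator (measurableSet_singleton _)).congr e.symm, ?_⟩
  rw [integral_congr_ae e, integral_indicator_one (measurableSet_singleton _), h1]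

lemma integral_bernoulli (h1 : ν.real {1} = p) (h0 : ν.real {0} = 1 - p) (f : ℝ → ℝ) :
    ∫ t, f t ∂ν = p * f 1 + (1 - p) * f 0 := by
  obtain ⟨hi, he⟩ := integral_bernoulli_id h1 h0
  have hi' : Integrable (fun t => 1 - t) ν := (integrable_const (1 : ℝ)).sub hi
  rw [integral_congr_ae (bernoulli_ae_eq h1 h0 f),
    integral_add (hi.const_mul _) (hi'.const_mul _),
    integral_const_mul, integral_const_mul, integral_sub (integrable_const _) hi, he]
  simp
  ring

lemma memLp_bernoulli (h1 : ν.real {1} = p) (h0 : ν.real {0} = 1 - p) (f : ℝ → ℝ) (q : ENNReal) :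
    MemLp f q ν := by
  have hm : AEStronglyMeasurable f ν :=
    ⟨fun t => f 1 * t + f 0 * (1 - t), by fun_prop, bernoulli_ae_eq h1 h0 f⟩
  refine MemLp.of_bound hm (max ‖f 0‖ ‖f 1‖) ?_
  filter_upwards [ae_bernoulli h1 h0] with t ht
  rcases ht with rfl | rfl <;> simp

end Bernoulli

section Family

variable {ι : Type*} [Fintype ι] {ν : ι → Measure ℝ} [∀ i, IsProbabilityMeasure (ν i)] {p : ℝ}

lemma integral_eval_pi (f : ℝ → ℝ) (i : ι) (hf : AEStronglyMeasurable f (ν i)) :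
    ∫ ζ, f (ζ i) ∂Measure.pi ν = ∫ t, f t ∂ν i := by
  rw [← (measurePreserving_eval ν i).map_eq] at hf ⊢
  rw [integral_map (measurable_pi_apply i).aemeasurable hf]

/-- The normal approximation of the sampling given the data, with frozen weights `a i`. The factor
`1 - 2p + 2p²` comes from the third absolute central moment `p(1-p)(1 - 2p + 2p²)`. -/
lemma bernoulli_berryEsseen [DecidableEq ι] (hp0 : 0 < p) (hp1 : p < 1)
    (h1 : ∀ i, (ν i).real {1} = p) (h0 : ∀ i, (ν i).real {0} = 1 - p) (a : ι → ℝ)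
    (ha : 0 < ∑ i, a i ^ 2) :
    |(Measure.pi ν).real {ζ | ∑ i, ζ i * a i ≤ 0} -
        Phi (-(p * ∑ i, a i) / √(p * (1 - p) * ∑ i, a i ^ 2))| ≤
      44 * ((1 - 2 * p + 2 * p ^ 2) * (∑ i, |a i| ^ 3) /
        (√(p * (1 - p) * ∑ i, a i ^ 2) * ∑ i, a i ^ 2)) := by
  have hq : 0 < 1 - p := by linarith
  set A := ∑ i, a i ^ 2 with hA
  set s := √(p * (1 - p) * A) with hs_def
  have hpA : 0 < p * (1 - p) * A := by positivity
  have hs : 0 < s := Real.sqrt_pos.2 hpA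
  have hsq : s ^ 2 = p * (1 - p) * A := Real.sq_sqrt hpA.le
  have hmem : ∀ i, ∀ f : ℝ → ℝ, ∀ q : ENNReal, MemLp f q (ν i) := fun i f q =>
    memLp_bernoulli (h1 i) (h0 i) f q
  have hint : ∀ i (f : ℝ → ℝ), ∫ ζ, f (ζ i) ∂Measure.pi ν = p * f 1 + (1 - p) * f 0 := fun i f => by
    rw [integral_eval_pi f i (hmem i f 1).1, integral_bernoulli (h1 i) (h0 i)]
  have h3 : 0 < ∑ i, |a i| ^ 3 := by
    by_contra hcon
    have hz : ∀ i ∈ Finset.univ, |a i| ^ 3 = 0 := (Finset.sum_eq_zero_iff_of_nonneg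
      fun i _ => by positivity).1 (le_antisymm (not_lt.1 hcon) (Finset.sum_nonneg fun i _ => by positivity))
    have : A = 0 := Finset.sum_eq_zero fun i hi => by
      have := pow_eq_zero_iff (by norm_num) |>.1 (hz i hi)
      rw [abs_eq_zero.1 this]; norm_num
    linarith
  have hpoly : 0 < 1 - 2 * p + 2 * p ^ 2 := by nlinarith
  have key := berryEsseen (μ := Measure.pi ν) (ξ := fun i ζ => (ζ i - p) * (a i / s))
    (γ := (1 - 2 * p + 2 * p ^ 2) * (∑ i, |a i| ^ 3) / (s * A))
    (fun i => by fun_prop)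
    (fun i => (hmem i (fun t => (t - p) * (a i / s)) 3).comp_measurePreserving
      (measurePreserving_eval ν i))
    (fun i => by
      rw [hint i fun t => (t - p) * (a i / s)]; ring)
    (iIndepFun_pi (X := fun i t => (t - p) * (a i / s)) fun i => by fun_prop)
    (by
      have : ∀ i, ∫ ζ, ((ζ i - p) * (a i / s)) ^ 2 ∂Measure.pi ν = p * (1 - p) / s ^ 2 * a i ^ 2 :=
        fun i => by
          rw [hint i fun t => ((t - p) * (a i / s)) ^ 2]; ring
      simp only [this, ← Finset.mul_sum, ← hA, hsq]
      field_simp)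
    (by positivity)
    (by
      have : ∀ i, ∫ ζ, |(ζ i - p) * (a i / s)| ^ 3 ∂Measure.pi ν =
          p * (1 - p) * (1 - 2 * p + 2 * p ^ 2) / s ^ 3 * |a i| ^ 3 := fun i => by
        rw [hint i fun t => |(t - p) * (a i / s)| ^ 3, abs_mul, abs_mul, abs_div, abs_of_pos hs,
          abs_of_pos hq, zero_sub, abs_neg, abs_of_pos hp0]
        ring
      simp only [this, ← Finset.mul_sum]
      apply le_of_eq
      have : s ^ 3 = s * (p * (1 - p) * A) := by rw [← hsq]; ring
      rw [this]
      field_simp)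
    (-(p * ∑ i, a i) / s)
  convert key using 4
  congr 1; ext ζ
  have : ∑ i, (ζ i - p) * (a i / s) = (∑ i, ζ i * a i - p * ∑ i, a i) / s := by
    rw [Finset.mul_sum, ← Finset.sum_sub_distrib, Finset.sum_div]
    exact Finset.sum_congr rfl fun i _ => by ring
  simp only [this]
  rw [div_le_div_iff_of_pos_right hs]
  constructor <;> intro h <;> linarith

lemma measureReal_pi_sum_eq_zero_le (hp1 : p ≤ 1) (h1 : ∀ i, (ν i).real {1} = p)
    (h0 : ∀ i, (ν i).real {0} = 1 - p) :
    (Measure.pi ν).real {ζ | ∑ i, ζ i = 0} ≤ Real.exp (-(Fintype.card ι * p)) := by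
  have hae : ∀ᵐ ζ ∂Measure.pi ν, ∀ i, ζ i = 0 ∨ ζ i = 1 := by
    rw [ae_all_iff]
    exact fun i => (measurePreserving_eval ν i).quasiMeasurePreserving.ae (ae_bernoulli (h1 i) (h0 i))
  have hle : (Measure.pi ν) {ζ | ∑ i, ζ i = 0} ≤ (Measure.pi ν) (Set.univ.pi fun _ => {0}) := by
    refine measure_mono_ae ?_
    filter_upwards [hae] with ζ hζ hsum
    have hsum : ∑ i, ζ i = 0 := hsum
    rw [Finset.sum_eq_zero_iff_of_nonneg fun i _ => by rcases hζ i with h | h <;> simp [h]] at hsum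
    exact fun i _ => hsum i (Finset.mem_univ i)
  calc (Measure.pi ν).real {ζ | ∑ i, ζ i = 0}
      ≤ (Measure.pi ν).real (Set.univ.pi fun _ => {0}) :=
        ENNReal.toReal_mono (measure_ne_top _ _) hle
    _ = (1 - p) ^ Fintype.card ι := by
        rw [measureReal_def, Measure.pi_pi, ENNReal.toReal_prod]
        simp [← measureReal_def, h0]
    _ ≤ Real.exp (-p) ^ Fintype.card ι :=
        pow_le_pow_left₀ (by linarith) (by linarith [Real.add_one_le_exp (-p)]) _
    _ = _ := by rw [← Real.exp_nat_mul]; ring_nf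

end Family

/-! ### Conditioning on the data -/

section Transport

variable {M Ω : Type*} [MeasurableSpace M] [MeasurableSpace Ω] {P : Measure M}
  [IsProbabilityMeasure P] {μ : Measure Ω} [IsProbabilityMeasure μ] {n m N : ℕ}
  {X : Fin n → Ω → M} {Z : Idx n m → Ω → ℝ}

lemma IsBernoulliSampling.map_pair (hS : IsBernoulliSampling P μ N X Z) :
    μ.map (fun ω => (fun i => X i ω, fun i => Z i ω)) =
      (Measure.pi fun _ : Fin n => P).prod (Measure.pi fun i => μ.map (Z i)) := by
  have hX := (iIndepFun_iff_map_fun_eq_pi_map fun i => (hS.measurable_X i).aemeasurable).1 hS.indep_X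
  have hZ := (iIndepFun_iff_map_fun_eq_pi_map fun i => (hS.measurable_Z i).aemeasurable).1 hS.indep_Z
  have h := (indepFun_iff_map_prod_eq_prod_map_map
    (measurable_pi_lambda _ hS.measurable_X).aemeasurable
    (measurable_pi_lambda _ hS.measurable_Z).aemeasurable).1 hS.indep_X_Z
  rw [h, hX, hZ]
  simp only [hS.law_X]

lemma IsBernoulliSampling.measureReal_pair (hS : IsBernoulliSampling P μ N X Z)
    {S : Set ((Fin n → M) × (Idx n m → ℝ))} (hSm : MeasurableSet S) :
    Integrable (fun x => (Measure.pi fun i => μ.map (Z i)).real {ζ | (x, ζ) ∈ S})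
        (Measure.pi fun _ : Fin n => P) ∧
      μ.real {ω | (fun i => X i ω, fun i => Z i ω) ∈ S} =
        ∫ x, (Measure.pi fun i => μ.map (Z i)).real {ζ | (x, ζ) ∈ S}
          ∂(Measure.pi fun _ : Fin n => P) := by
  have : ∀ i, IsProbabilityMeasure (μ.map (Z i)) := fun i =>
    Measure.isProbabilityMeasure_map (hS.measurable_Z i).aemeasurable
  have hm : Measurable fun ω => ((fun i => X i ω, fun i => Z i ω) :
      (Fin n → M) × (Idx n m → ℝ)) :=
    (measurable_pi_lambda _ hS.measurable_X).prodMk (measurable_pi_lambda _ hS.measurable_Z)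
  have hi : Integrable (S.indicator (1 : (Fin n → M) × (Idx n m → ℝ) → ℝ))
      ((Measure.pi fun _ : Fin n => P).prod (Measure.pi fun i => μ.map (Z i))) :=
    (integrable_const (1 : ℝ)).indicator hSm
  have he : ∀ x, ∫ ζ, S.indicator (1 : (Fin n → M) × (Idx n m → ℝ) → ℝ) (x, ζ)
      ∂(Measure.pi fun i => μ.map (Z i)) =
      (Measure.pi fun i => μ.map (Z i)).real {ζ | (x, ζ) ∈ S} := fun x => by
    have e : (fun ζ => S.indicator (1 : (Fin n → M) × (Idx n m → ℝ) → ℝ) (x, ζ)) =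
        (Prod.mk x ⁻¹' S).indicator 1 := rfl
    rw [e, integral_indicator_one (measurable_prodMk_left hSm)]
    rfl
  have e1 : μ.real {ω | (fun i => X i ω, fun i => Z i ω) ∈ S} =
      (μ.map (fun ω => ((fun i => X i ω, fun i => Z i ω) :
        (Fin n → M) × (Idx n m → ℝ)))).real S := by
    rw [map_measureReal_apply hm hSm]; rfl
  have h1 := hi.integral_prod_left
  simp only [he] at h1
  refine ⟨h1, ?_⟩
  rw [e1, hS.map_pair, ← integral_indicator_one hSm, integral_prod _ hi]
  simp only [he]

lemma samplingProb_pos (hN : 0 < N) (hNC : N < n.choose m) : 0 < samplingProb n m N :=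
  div_pos (by exact_mod_cast hN) (by exact_mod_cast hN.trans hNC)

lemma samplingProb_lt_one (hNC : N < n.choose m) : samplingProb n m N < 1 :=
  (div_lt_one (by exact_mod_cast (Nat.zero_le N).trans_lt hNC)).2 (by exact_mod_cast hNC)

lemma IsBernoulliSampling.law_Z (hS : IsBernoulliSampling P μ N X Z) (i : Idx n m) :
    (μ.map (Z i)).real {1} = samplingProb n m N ∧
      (μ.map (Z i)).real {0} = 1 - samplingProb n m N := by
  rw [map_measureReal_apply (hS.measurable_Z i) (measurableSet_singleton _),
    map_measureReal_apply (hS.measurable_Z i) (measurableSet_singleton _)]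
  exact ⟨hS.law_Z_one i, hS.law_Z_zero i⟩

/-- Multiplying by `N̂ > 0` turns the ratio inequality into one that is linear in the samplers, so
the probability of the samplers given the data is that of a weighted Bernoulli sum. The error is the
probability of `N̂ = 0`. -/
lemma IsBernoulliSampling.cdf_sub_le (hS : IsBernoulliSampling P μ N X Z) (hN : 0 < N)
    (hNC : N < n.choose m) (hn : 0 < n) {h : (Fin m → M) → ℝ} (hh : Measurable h) {σ : ℝ}
    (hσ : 0 < σ) (z : ℝ) :
    Integrable (fun x => (Measure.pi fun i => μ.map (Z i)).real
        {ζ | ∑ i, ζ i * (h (fun k => x (i k)) - z * σ / √n) ≤ 0})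
        (Measure.pi fun _ : Fin n => P) ∧
    |μ.real {ω | √n * incompleteU h X Z ω / σ ≤ z} -
        ∫ x, (Measure.pi fun i => μ.map (Z i)).real
          {ζ | ∑ i, ζ i * (h (fun k => x (i k)) - z * σ / √n) ≤ 0}
          ∂(Measure.pi fun _ : Fin n => P)| ≤ 1 / √N := by
  have : ∀ i, IsProbabilityMeasure (μ.map (Z i)) := fun i =>
    Measure.isProbabilityMeasure_map (hS.measurable_Z i).aemeasurable
  set c := z * σ / √n with hc
  have hsn : 0 < √(n : ℝ) := Real.sqrt_pos.2 (by exact_mod_cast hn)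
  have hN1 : (1 : ℝ) ≤ N := by exact_mod_cast hN
  have hSm : MeasurableSet {q : (Fin n → M) × (Idx n m → ℝ) |
      ∑ i, q.2 i * (h (fun k => q.1 (i k)) - c) ≤ 0} := by
    refine measurableSet_le (Finset.measurable_sum _ fun i _ => ?_) measurable_const
    refine ((measurable_pi_apply i).comp measurable_snd).mul ((hh.comp ?_).sub measurable_const)
    exact measurable_pi_lambda _ fun k => (measurable_pi_apply _).comp measurable_fst
  obtain ⟨hint, heq⟩ := hS.measureReal_pair hSm
  refine ⟨hint, ?_⟩
  have heq' : ∫ x, (Measure.pi fun i => μ.map (Z i)).real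
      {ζ | ∑ i, ζ i * (h (fun k => x (i k)) - c) ≤ 0} ∂(Measure.pi fun _ : Fin n => P) =
      μ.real {ω | ∑ i, Z i ω * (h (fun k => X (i k) ω) - c) ≤ 0} := heq.symm
  rw [heq']
  have h0 : μ.real {ω | ∑ i, Z i ω = 0} ≤ 1 / √N := by
    have hZ := (iIndepFun_iff_map_fun_eq_pi_map
      fun i => (hS.measurable_Z i).aemeasurable).1 hS.indep_Z
    have e : μ.real {ω | ∑ i, Z i ω = 0} =
        (Measure.pi fun i => μ.map (Z i)).real {ζ | ∑ i, ζ i = 0} := by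
      rw [← hZ, map_measureReal_apply (measurable_pi_lambda _ hS.measurable_Z)]
      · rfl
      · exact measurableSet_eq_fun (Finset.measurable_sum _ fun i _ => measurable_pi_apply i)
          measurable_const
    rw [e]
    refine (measureReal_pi_sum_eq_zero_le (samplingProb_lt_one hNC).le
      (fun i => (hS.law_Z i).1) fun i => (hS.law_Z i).2).trans ?_
    have hC : (0 : ℝ) < n.choose m := by exact_mod_cast hN.trans hNC
    have : (Fintype.card (Idx n m) : ℝ) * samplingProb n m N = N := by
      rw [card_idx, samplingProb]
      field_simp
    rw [this, Real.exp_neg, ← one_div]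
    refine one_div_le_one_div_of_le (by positivity) ?_
    calc √(N : ℝ) ≤ N := Real.sqrt_le_self_iff.2 (Or.inr hN1)
      _ ≤ _ := by linarith [Real.add_one_le_exp (N : ℝ)]
  have hae : ∀ᵐ ω ∂μ, ∀ i, Z i ω = 0 ∨ Z i ω = 1 := by
    rw [ae_all_iff]
    exact fun i => ae_of_ae_map (hS.measurable_Z i).aemeasurable
      (ae_bernoulli (hS.law_Z i).1 (hS.law_Z i).2)
  have hiff : ∀ᵐ ω ∂μ, ∑ i, Z i ω ≠ 0 → (√n * incompleteU h X Z ω / σ ≤ z ↔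
      ∑ i, Z i ω * (h (fun k => X (i k) ω) - c) ≤ 0) := by
    filter_upwards [hae] with ω hω hne
    have hpos : 0 < ∑ i, Z i ω := lt_of_le_of_ne (Finset.sum_nonneg fun i _ => by
      rcases hω i with h | h <;> simp [h]) (Ne.symm hne)
    have e : ∑ i, Z i ω * (h (fun k => X (i k) ω) - c) =
        (∑ i, Z i ω * h fun k => X (i k) ω) - c * ∑ i, Z i ω := by
      rw [Finset.mul_sum, ← Finset.sum_sub_distrib]
      exact Finset.sum_congr rfl fun i _ => by ring
    rw [e, div_le_iff₀ hσ, ← le_div_iff₀' hsn, ← hc, incompleteU, inv_mul_le_iff₀ hpos,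
      sub_nonpos, mul_comm c]
  have hle : ∀ {A B : Set Ω}, (∀ᵐ ω ∂μ, ∑ i, Z i ω ≠ 0 → (ω ∈ A ↔ ω ∈ B)) →
      μ.real A ≤ μ.real B + 1 / √N := fun {A B} hAB => by
    calc μ.real A ≤ μ.real (B ∪ {ω | ∑ i, Z i ω = 0}) := by
          refine ENNReal.toReal_mono (measure_ne_top _ _) (measure_mono_ae ?_)
          filter_upwards [hAB] with ω hω hA
          by_cases h : ∑ i, Z i ω = 0
          · exact Or.inr h
          · exact Or.inl ((hω h).1 hA)
      _ ≤ μ.real B + μ.real {ω | ∑ i, Z i ω = 0} := measureReal_union_le _ _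
      _ ≤ _ := by linarith
  rw [abs_le]
  constructor
  · linarith [hle (A := {ω | ∑ i, Z i ω * (h (fun k => X (i k) ω) - c) ≤ 0})
      (B := {ω | √n * incompleteU h X Z ω / σ ≤ z})
      (hiff.mono fun ω h hne => (h hne).symm)]
  · linarith [hle (B := {ω | ∑ i, Z i ω * (h (fun k => X (i k) ω) - c) ≤ 0})
      (A := {ω | √n * incompleteU h X Z ω / σ ≤ z}) hiff]

end Transport

section UStatistic

variable {M : Type*} [MeasurableSpace M] {P : Measure M} [IsProbabilityMeasure P] {m n : ℕ}
  {k : (Fin m → M) → ℝ}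

lemma measurable_ustat (hk : Measurable k) : Measurable (ustat k n) :=
  (Finset.measurable_sum _ fun _ _ =>
    hk.comp (measurable_pi_lambda _ fun _ => measurable_pi_apply _)).const_mul _

lemma integral_ustat (hmn : m ≤ n) (hk : Integrable k (Measure.pi fun _ : Fin m => P)) :
    Integrable (ustat k n) (Measure.pi fun _ : Fin n => P) ∧
      ∫ x, ustat k n x ∂(Measure.pi fun _ : Fin n => P) = mean P k := by
  have hC : (n.choose m : ℝ) ≠ 0 := by exact_mod_cast (Nat.choose_pos hmn).ne'
  have hi : ∀ j : Idx n m, Integrable (fun x : Fin n → M => k fun l => x (j l))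
      (Measure.pi fun _ : Fin n => P) := fun j =>
    (measurePreserving_comp_injective (P := P) j.injective).integrable_comp_of_integrable hk
  have he : ∀ j : Idx n m, ∫ x : Fin n → M, k (fun l => x (j l)) ∂(Measure.pi fun _ : Fin n => P) =
      mean P k := fun j => by
    have h := measurePreserving_comp_injective (P := P) j.injective
    have hk' := hk.1
    rw [← h.map_eq] at hk'
    rw [mean, ← h.map_eq, integral_map h.measurable.aemeasurable hk']
  refine ⟨(integrable_finsetSum _ fun j _ => hi j).const_mul _, ?_⟩
  simp only [ustat]
  rw [integral_const_mul, integral_finsetSum _ fun j _ => hi j]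
  simp only [he, Finset.sum_const, Finset.card_univ, card_idx, nsmul_eq_mul]
  field_simp

end UStatistic

/-! ### The conditional normal approximation and its average over the data -/

section Conditional

variable {M : Type*} [MeasurableSpace M] {P : Measure M} [IsProbabilityMeasure P] {m n N : ℕ}
  {h : (Fin m → M) → ℝ}

variable (P h) in
/-- The standardised conditional mean of `∑ Z_i (c - h(X_i))` given the data. -/
noncomputable def condArg (n N : ℕ) (c : ℝ) (x : Fin n → M) : ℝ :=
  (c - ustat h n x) / (√(1 - samplingProb n m N) * sigmaH P h / √N)

variable (P h) in
/-- The Lyapunov-type factor of the conditional normal approximation. -/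
noncomputable def condRate (n N : ℕ) : ℝ :=
  (1 - 2 * samplingProb n m N + 2 * samplingProb n m N ^ 2) /
    (√(N * (1 - samplingProb n m N)) * sigmaH P h ^ 3)

lemma condRate_nonneg (ha : Admissible P h) : 0 ≤ condRate P h n N := by
  have := ha.sigmaH_pos
  have : 0 ≤ 1 - 2 * samplingProb n m N + 2 * samplingProb n m N ^ 2 := by nlinarith [sq_nonneg (1 - 2 * samplingProb n m N)]
  unfold condRate
  positivity

/-- If `|L + ρ| ≤ 1/2`, then `V ≥ σ_h²/2`, so the Bernoulli Berry-Esseen error can be expressed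
through `σ_h` with a factor 3 (`132 = 3 * 44`), and the change of scale supplies the first-order
term. Otherwise the right side dominates trivially. -/
lemma abs_cond_sub_le {ν : Idx n m → Measure ℝ} [∀ i, IsProbabilityMeasure (ν i)]
    (ha : Admissible P h) (hN : 0 < N) (hNC : N < n.choose m)
    (h1 : ∀ i, (ν i).real {1} = samplingProb n m N)
    (h0 : ∀ i, (ν i).real {0} = 1 - samplingProb n m N) (c : ℝ) (x : Fin n → M) {L ρ : ℝ}
    (hV : ustat (fun y => (h y - c) ^ 2) n x / varH P h = 1 + (L + ρ)) :
    |(Measure.pi ν).real {ζ | ∑ i, ζ i * (h (fun l => x (i l)) - c) ≤ 0} -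
        Phi (condArg P h n N c x) + 1 / 2 * (condArg P h n N c x * phi (condArg P h n N c x)) * L| ≤
      132 * (condRate P h n N * ustat (fun y => |h y - c| ^ 3) n x) +
        108 * (|L| ^ (3 / 2 : ℝ) + |ρ|) := by
  classical
  set p := samplingProb n m N with hp
  have hp0 : 0 < p := samplingProb_pos hN hNC
  have hp1 : p < 1 := samplingProb_lt_one hNC
  have hq : 0 < 1 - p := by linarith
  set v := varH P h with hv
  have hv0 : 0 < v := ha.varH_pos
  have hσ := ha.sigmaH_pos
  have hσ2 := ha.sigmaH_sq
  rw [← hv] at hσ2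
  set a := condArg P h n N c x with ha_def
  set V := ustat (fun y => (h y - c) ^ 2) n x with hVdef
  set T := ustat (fun y => |h y - c| ^ 3) n x with hTdef
  have hNr : (0 : ℝ) < N := by exact_mod_cast hN
  have hC : (0 : ℝ) < n.choose m := by exact_mod_cast hN.trans hNC
  have hpC : p * n.choose m = N := by rw [hp, samplingProb]; field_simp
  have hT0 : 0 ≤ T := mul_nonneg (by positivity) (Finset.sum_nonneg fun i _ => by positivity)
  have hQ := condRate_nonneg (n := n) (N := N) ha
  set F := (Measure.pi ν).real {ζ | ∑ i, ζ i * (h (fun l => x (i l)) - c) ≤ 0} with hF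
  have hF0 : 0 ≤ F := measureReal_nonneg
  have hF1 : F ≤ 1 := measureReal_le_one
  have hL0 : 0 ≤ |L| ^ (3 / 2 : ℝ) := by positivity
  rcases le_or_gt |L + ρ| (1 / 2) with hle | hlt
  · have hV2 : v / 2 ≤ V := by
      have e : V = (1 + (L + ρ)) * v := by rw [← hV]; field_simp
      rw [e]; nlinarith [(abs_le.1 hle).1]
    have hVpos : 0 < V := by linarith
    have e1 : ∑ i : Idx n m, (h (fun l => x (i l)) - c) = n.choose m * (ustat h n x - c) := by
      rw [Finset.sum_sub_distrib, ustat, Finset.sum_const, Finset.card_univ, card_idx, nsmul_eq_mul]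
      field_simp
    have e2 : ∑ i : Idx n m, (h (fun l => x (i l)) - c) ^ 2 = n.choose m * V := by
      rw [hVdef, ustat]; field_simp
    have e3 : ∑ i : Idx n m, |h (fun l => x (i l)) - c| ^ 3 = n.choose m * T := by
      rw [hTdef, ustat]; field_simp
    have key := bernoulli_berryEsseen hp0 hp1 h1 h0 (fun i : Idx n m => h (fun l => x (i l)) - c)
      (by rw [e2]; positivity)
    rw [e1, e2, e3, ← hF] at key
    have hs1 : √(p * (1 - p) * (n.choose m * V)) = √N * √(1 - p) * √V := by
      rw [← Real.sqrt_mul hNr.le, ← Real.sqrt_mul (by positivity), ← hpC]; ring_nf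
    have hsN : 0 < √(N : ℝ) := Real.sqrt_pos.2 hNr
    have hsq : 0 < √(1 - p) := Real.sqrt_pos.2 hq
    have hsV : 0 < √V := Real.sqrt_pos.2 hVpos
    have hN2 : √(N : ℝ) ^ 2 = N := Real.sq_sqrt hNr.le
    have earg : -(p * (n.choose m * (ustat h n x - c))) / √(p * (1 - p) * (n.choose m * V)) =
        a / √(1 + (L + ρ)) := by
      rw [← hV, Real.sqrt_div hVpos.le, hs1, ha_def, condArg, ← hp,
        show √v = sigmaH P h from rfl, ← mul_assoc, hpC]
      field_simp
      rw [hN2]; ring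
    have hrate : (1 - 2 * p + 2 * p ^ 2) * (n.choose m * T) /
        (√(p * (1 - p) * (n.choose m * V)) * (n.choose m * V)) ≤ 3 * (condRate P h n N * T) := by
      have hw : 0 ≤ 1 - 2 * p + 2 * p ^ 2 := by nlinarith [sq_nonneg (1 - 2 * p)]
      have hVV : sigmaH P h ^ 3 ≤ 3 * (√V * V) := by
        have h2 : sigmaH P h ≤ 3 / 2 * √V := by
          rw [sigmaH, ← hv]
          rw [Real.sqrt_le_left (by positivity), mul_pow, Real.sq_sqrt hVpos.le]
          linarith
        calc sigmaH P h ^ 3 = sigmaH P h * v := by rw [← hσ2]; ring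
          _ ≤ (3 / 2 * √V) * (2 * V) := mul_le_mul h2 (by linarith) hv0.le (by positivity)
          _ = _ := by ring
      rw [condRate, ← hp, hs1, Real.sqrt_mul hNr.le]
      have e : (1 - 2 * p + 2 * p ^ 2) * (n.choose m * T) / (√N * √(1 - p) * √V * (n.choose m * V)) =
          ((1 - 2 * p + 2 * p ^ 2) * T / (√N * √(1 - p))) * (1 / (√V * V)) := by field_simp
      have e' : 3 * ((1 - 2 * p + 2 * p ^ 2) / (√N * √(1 - p) * sigmaH P h ^ 3) * T) =
          ((1 - 2 * p + 2 * p ^ 2) * T / (√N * √(1 - p))) * (3 / sigmaH P h ^ 3) := by field_simp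
      rw [e, e']
      refine mul_le_mul_of_nonneg_left ?_ (by positivity)
      rw [div_le_div_iff₀ (by positivity) (by positivity)]
      linarith
    rw [earg] at key
    have h3 := abs_Phi_scale_le a L ρ
    have h4 := abs_add_le (F - Phi (a / √(1 + (L + ρ))))
      (Phi (a / √(1 + (L + ρ))) - Phi a + 1 / 2 * (a * phi a) * L)
    have e5 : F - Phi (a / √(1 + (L + ρ))) +
      (Phi (a / √(1 + (L + ρ))) - Phi a + 1 / 2 * (a * phi a) * L) =
      F - Phi a + 1 / 2 * (a * phi a) * L := by ring
    rw [e5] at h4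
    have := abs_nonneg ρ
    linarith
  · obtain ⟨h5, h6⟩ := one_le_of_half_lt_abs_add hlt
    have h7 : |F - Phi a| ≤ 1 := by
      rw [abs_le]; constructor <;> linarith [Phi_nonneg a, Phi_le_one a]
    have h8 : |1 / 2 * (a * phi a) * L| ≤ 1 / 2 * |L| := by
      rw [abs_mul, abs_mul, abs_of_pos (by norm_num : (0 : ℝ) < 1 / 2)]
      have := abs_mul_phi_le a
      have := abs_nonneg L
      nlinarith
    have h9 := abs_add_le (F - Phi a) (1 / 2 * (a * phi a) * L)
    have := abs_nonneg ρ
    have : 0 ≤ condRate P h n N * T := mul_nonneg hQ hT0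
    linarith

lemma measurable_condArg (ha : Admissible P h) (c : ℝ) : Measurable (condArg P h n N c) :=
  ((measurable_const.sub (measurable_ustat ha.measurable)).div_const _)

lemma integral_abs_sub_pow_three_le (ha : Admissible P h) (c : ℝ) :
    Integrable (fun y => |h y - c| ^ 3) (Measure.pi fun _ : Fin m => P) ∧
      mean P (fun y => |h y - c| ^ 3) ≤ 4 * ((mean P fun y => |h y| ^ 3) + |c| ^ 3) := by
  have hle : ∀ y, |h y - c| ^ 3 ≤ 4 * (|h y| ^ 3 + |c| ^ 3) := fun y => by
    calc |h y - c| ^ 3 ≤ (|h y| + |c|) ^ 3 := pow_le_pow_left₀ (abs_nonneg _) (abs_sub _ _) 3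
      _ ≤ _ := by
        have := abs_nonneg (h y)
        have := abs_nonneg c
        nlinarith [mul_nonneg (add_nonneg (abs_nonneg (h y)) (abs_nonneg c))
          (sq_nonneg (|h y| - |c|))]
  have hi : Integrable (fun y => 4 * (|h y| ^ 3 + |c| ^ 3)) (Measure.pi fun _ : Fin m => P) :=
    (ha.third_moment.add (integrable_const _)).const_mul _
  have hm := ha.measurable
  have hi2 : Integrable (fun y => |h y - c| ^ 3) (Measure.pi fun _ : Fin m => P) :=
    hi.mono' (by fun_prop) (Filter.Eventually.of_forall fun y => by
      rw [Real.norm_eq_abs, abs_of_nonneg (by positivity)]; exact hle y)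
  refine ⟨hi2, (integral_mono hi2 hi hle).trans (le_of_eq ?_)⟩
  rw [integral_const_mul, integral_add ha.third_moment (integrable_const _)]
  simp [mean]

/-- Integrates the pointwise approximation. The absolute value of the linear term is taken only
after integration, so that its cancellation remains available. The bound on `c` keeps the third
moment of `h - c` within eight times that of `h`. -/
lemma abs_integral_cond_sub_le {F : (Fin n → M) → ℝ} (ha : Admissible P h) (hm : 2 ≤ m)
    (hmn : 2 * m < n) (hN : 0 < N)
    (hNC : N < n.choose m) (hFi : Integrable F (Measure.pi fun _ : Fin n => P)) {c : ℝ}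
    (hc : |c| ^ 3 ≤ mean P fun y => |h y| ^ 3) {L ρ : (Fin n → M) → ℝ}
    (hL : MemLp L (3 / 2) (Measure.pi fun _ : Fin n => P))
    (hρ : Integrable ρ (Measure.pi fun _ : Fin n => P))
    (hF : ∀ x, |F x - Phi (condArg P h n N c x) +
        1 / 2 * (condArg P h n N c x * phi (condArg P h n N c x)) * L x| ≤
      132 * (condRate P h n N * ustat (fun y => |h y - c| ^ 3) n x) +
        108 * (|L x| ^ (3 / 2 : ℝ) + |ρ x|)) :
    |∫ x, F x ∂(Measure.pi fun _ : Fin n => P) -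
        Phi (c / √((m * sigmaG P h / √n) ^ 2 +
          (√(1 - samplingProb n m N) * sigmaH P h / √N) ^ 2))| ≤
      48 * B2 P h n + 1056 * (condRate P h n N * mean P fun y => |h y| ^ 3) +
        108 * (∫ x, |L x| ^ (3 / 2 : ℝ) ∂(Measure.pi fun _ : Fin n => P) +
          ∫ x, |ρ x| ∂(Measure.pi fun _ : Fin n => P)) +
        |∫ x, condArg P h n N c x * phi (condArg P h n N c x) * L x
          ∂(Measure.pi fun _ : Fin n => P)| := by
  set μ := Measure.pi fun _ : Fin n => P with hμ
  set a := condArg P h n N c with ha_def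
  have hq : 0 < 1 - samplingProb n m N := by linarith [samplingProb_lt_one hNC]
  have hn : 0 < √(n : ℝ) := Real.sqrt_pos.2 (by exact_mod_cast (by omega : 0 < n))
  have hm0 : (0 : ℝ) < m := by exact_mod_cast (by omega : 0 < m)
  have hs₁ : 0 < m * sigmaG P h / √n := by have := ha.sigmaG_pos; positivity
  have hs₂ : 0 < √(1 - samplingProb n m N) * sigmaH P h / √N := by
    have := ha.sigmaH_pos
    have := Real.sqrt_pos.2 hq
    have : 0 < √(N : ℝ) := Real.sqrt_pos.2 (by exact_mod_cast hN)
    positivity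
  have hU := abs_integral_Phi_sub_le (μ := μ) (measurable_ustat ha.measurable) hs₁ hs₂
    (B := 48 * B2 P h n) (fun u => by
      have := ustat_berryEsseen ha hm hmn u
      rwa [show u * (√n / (m * sigmaG P h)) = u / (m * sigmaG P h / √n) by field_simp] at this) c
  have ham : Measurable a := measurable_condArg ha c
  have hΦi : Integrable (fun x => Phi (a x)) μ :=
    Integrable.of_bound (continuous_Phi.measurable.comp ham).aestronglyMeasurable 1
      (Filter.Eventually.of_forall fun t => by
        rw [Real.norm_eq_abs, abs_of_nonneg (Phi_nonneg _)]; exact Phi_le_one _)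
  have hLi : Integrable L μ := hL.integrable (by
    rw [ENNReal.le_div_iff_mul_le (by simp) (by simp)]; norm_num)
  have haL : Integrable (fun x => a x * phi (a x) * L x) μ :=
    hLi.bdd_mul (c := 1) ((ham.mul (continuous_phi.measurable.comp ham)).aestronglyMeasurable)
      (Filter.Eventually.of_forall fun x => abs_mul_phi_le (a x))
  obtain ⟨hi3, he3⟩ := integral_abs_sub_pow_three_le ha c
  obtain ⟨hTi, hTe⟩ := integral_ustat (n := n) (by omega) hi3
  have hL32 := integrable_abs_rpow_three_halves hL
  have hR : Integrable (fun x => 132 * (condRate P h n N * ustat (fun y => |h y - c| ^ 3) n x) +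
        108 * (|L x| ^ (3 / 2 : ℝ) + |ρ x|)) μ :=
    ((hTi.const_mul _).const_mul _).add ((hL32.add hρ.abs).const_mul _)
  have hD : Integrable (fun x => F x - Phi (a x) + 1 / 2 * (a x * phi (a x)) * L x) μ := by
    refine (hFi.sub hΦi).add ((haL.const_mul (1 / 2)).congr (Filter.Eventually.of_forall fun x => ?_))
    simp only; ring
  have h1 : |∫ x, (F x - Phi (a x) + 1 / 2 * (a x * phi (a x)) * L x) ∂μ| ≤
      132 * (condRate P h n N * mean P fun y => |h y - c| ^ 3) +
        108 * (∫ x, |L x| ^ (3 / 2 : ℝ) ∂μ + ∫ x, |ρ x| ∂μ) := by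
    refine (abs_integral_le_integral_abs).trans ((integral_mono hD.abs hR hF).trans (le_of_eq ?_))
    have hs : Integrable (fun x => |L x| ^ (3 / 2 : ℝ) + |ρ x|) μ := hL32.add hρ.abs
    rw [integral_add ((hTi.const_mul _).const_mul _) (hs.const_mul _),
      integral_const_mul, integral_const_mul, integral_const_mul, integral_add hL32 hρ.abs, hTe]
  have h2 : ∫ x, (F x - Phi (a x) + 1 / 2 * (a x * phi (a x)) * L x) ∂μ =
      ∫ x, F x ∂μ - ∫ x, Phi (a x) ∂μ + 1 / 2 * ∫ x, a x * phi (a x) * L x ∂μ := by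
    have hs : Integrable (fun x => F x - Phi (a x)) μ := hFi.sub hΦi
    rw [← integral_const_mul, ← integral_sub hFi hΦi, ← integral_add hs (haL.const_mul _)]
    refine integral_congr_ae (Filter.Eventually.of_forall fun x => ?_)
    simp only; ring
  rw [h2] at h1
  have hQ := condRate_nonneg (n := n) (N := N) ha
  have h3 : condRate P h n N * mean P (fun y => |h y - c| ^ 3) ≤
      condRate P h n N * (8 * mean P fun y => |h y| ^ 3) :=
    mul_le_mul_of_nonneg_left (by linarith) hQ
  have hU' : |∫ x, Phi (a x) ∂μ - Phi (c / √((m * sigmaG P h / √n) ^ 2 +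
          (√(1 - samplingProb n m N) * sigmaH P h / √N) ^ 2))| ≤ 48 * B2 P h n := hU
  have hJ := neg_abs_le (∫ x, a x * phi (a x) * L x ∂μ)
  have hJ' := le_abs_self (∫ x, a x * phi (a x) * L x ∂μ)
  have hJ0 := abs_nonneg (∫ x, a x * phi (a x) * L x ∂μ)
  rw [abs_le] at h1 hU' ⊢
  constructor <;> linarith [h1.1, h1.2, hU'.1, hU'.2]

end Conditional

/-! ### Reduction to the fluctuation of the conditional variance -/

lemma sq_le_four_mul_choose {m n : ℕ} (hm : 2 ≤ m) (hmn : 2 * m < n) :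
    (n : ℝ) ^ 2 ≤ 4 * n.choose m := by
  have h1 : ∀ r, 2 ≤ r → 2 * r < n → n.choose 2 ≤ n.choose r := by
    intro r hr
    induction r, hr using Nat.le_induction with
    | base => exact fun _ => le_rfl
    | succ r hr ih => exact fun h => (ih (by omega)).trans (Nat.choose_le_succ_of_lt_half_left (by omega))
  have h2 : (n.choose 2 : ℝ) ≤ n.choose m := by exact_mod_cast h1 m hm hmn
  rw [Nat.cast_choose_two] at h2
  have h3 : (2 : ℝ) ≤ n := by exact_mod_cast (by omega : 2 ≤ n)
  nlinarith

/-- Beyond `ε^{-1/2}` the normal tail is at most `ε` by Chebyshev, and monotonicity carries the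
bound from the endpoints outwards. -/
lemma abs_cdf_sub_le_of_central {F : ℝ → ℝ} (hF : Monotone F) (hF0 : ∀ z, 0 ≤ F z)
    (hF1 : ∀ z, F z ≤ 1) {ε D : ℝ} (hε : 0 < ε)
    (hD : ∀ z, z ^ 2 ≤ 1 / ε → |F z - Phi z| ≤ D) (z : ℝ) : |F z - Phi z| ≤ D + ε := by
  set w := √(1 / ε) with hw
  have hw0 : 0 < w := Real.sqrt_pos.2 (by positivity)
  have hw2 : w ^ 2 = 1 / ε := Real.sq_sqrt (by positivity)
  have ht : 1 - Phi w ≤ ε := by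
    have := one_sub_Phi_le_one_div_sq hw0
    rwa [hw2, one_div_one_div] at this
  have hp := abs_le.1 (hD w hw2.le)
  have hn := abs_le.1 (hD (-w) (by rw [neg_sq, hw2]))
  rw [Phi_neg] at hn
  have h0 := Phi_nonneg z
  have h1 := Phi_le_one z
  have h2 := hF0 z
  have h3 := hF1 z
  rcases le_or_gt (z ^ 2) (1 / ε) with h | h
  · exact (hD z h).trans (by linarith)
  · rw [← hw2, sq_lt_sq, abs_of_pos hw0] at h
    rw [abs_le]
    rcases lt_abs.1 h with h | h
    · have := hF h.le
      have := Phi_mono h.le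
      constructor <;> linarith [hp.1, hp.2]
    · have := hF (by linarith : z ≤ -w)
      have h5 := Phi_mono (by linarith : z ≤ -w)
      rw [Phi_neg] at h5
      constructor <;> linarith [hn.1, hn.2]

section

variable {M Ω : Type*} [MeasurableSpace M] [MeasurableSpace Ω] {P : Measure M}
  [IsProbabilityMeasure P] {μ : Measure Ω} [IsProbabilityMeasure μ] {n m N : ℕ}
  {h : (Fin m → M) → ℝ} {X : Fin n → Ω → M} {Z : Idx n m → Ω → ℝ}

/-- The basic rate `(m/n + 1/N)^{1/2}`. -/
noncomputable def baseRate (n m N : ℕ) : ℝ := √((m : ℝ) / n + 1 / N)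

lemma Admissible.sigmaH_pow_three_le (ha : Admissible P h) :
    sigmaH P h ^ 3 ≤ mean P fun y => |h y| ^ 3 :=
  pow_three_le_integral_of_sq ha.memLp_three ha.varH_pos.le ha.varH_eq

/-- Since `1 - 2p + 2p² ≥ 1/2` and `𝔼|h|³ ≥ σ_h³`, errors of order `N^{-1/2}` are absorbed by the
first term of `B1`. -/
lemma one_div_sqrt_le (ha : Admissible P h) (hN : 0 < N) (hNC : N < n.choose m) :
    1 / √(N : ℝ) ≤ 2 * (condRate P h n N * mean P fun y => |h y| ^ 3) := by
  have hσ := ha.sigmaH_pos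
  have hp0 := samplingProb_pos hN hNC
  have hp1 := samplingProb_lt_one hNC
  have hH := ha.sigmaH_pow_three_le
  have hNr : (0 : ℝ) < N := by exact_mod_cast hN
  set p := samplingProb n m N with hp
  have hq : 0 < 1 - p := by linarith
  have hw : 1 / 2 ≤ 1 - 2 * p + 2 * p ^ 2 := by nlinarith [sq_nonneg (1 - 2 * p)]
  have hsq : √(N * (1 - p)) ≤ √N := Real.sqrt_le_sqrt (by nlinarith)
  have hs0 : 0 < √(N * (1 - p)) := Real.sqrt_pos.2 (by positivity)
  calc 1 / √(N : ℝ) ≤ 1 / √(N * (1 - p)) := one_div_le_one_div_of_le hs0 hsq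
    _ = 2 * ((1 / 2) / (√(N * (1 - p)) * sigmaH P h ^ 3) * sigmaH P h ^ 3) := by field_simp
    _ ≤ _ := by
      rw [condRate, ← hp]
      gcongr

lemma baseRate_le (ha : Admissible P h) (hn : 0 < n) (hN : 0 < N) (hNC : N < n.choose m) :
    baseRate n m N ≤ √m / √(n * (1 - samplingProb n m N)) +
      2 * (condRate P h n N * mean P fun y => |h y| ^ 3) := by
  have hp0 := samplingProb_pos hN hNC
  have hp1 := samplingProb_lt_one hNC
  have hnr : (0 : ℝ) < n := by exact_mod_cast hn
  have h1 : baseRate n m N ≤ √((m : ℝ) / n) + √(1 / N) := by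
    have := Real.sq_sqrt (by positivity : 0 ≤ (m : ℝ) / n)
    have := Real.sq_sqrt (by positivity : 0 ≤ 1 / (N : ℝ))
    have := mul_nonneg (Real.sqrt_nonneg ((m : ℝ) / n)) (Real.sqrt_nonneg (1 / (N : ℝ)))
    exact (Real.sqrt_le_left (by positivity)).2 (by nlinarith)
  have h2 : √(1 / (N : ℝ)) = 1 / √N := by rw [Real.sqrt_div zero_le_one, Real.sqrt_one]
  have h3 : √((m : ℝ) / n) ≤ √m / √(n * (1 - samplingProb n m N)) := by
    rw [Real.sqrt_div (Nat.cast_nonneg m)]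
    refine div_le_div_of_nonneg_left (Real.sqrt_nonneg _) (Real.sqrt_pos.2 (by nlinarith))
      (Real.sqrt_le_sqrt (by nlinarith))
  have h4 := one_div_sqrt_le ha hN hNC
  linarith

lemma baseRate_pos (hN : 0 < N) : 0 < baseRate n m N :=
  Real.sqrt_pos.2 (by have : (0 : ℝ) < N := by exact_mod_cast hN
                      positivity)

lemma baseRate_sq : baseRate n m N ^ 2 = (m : ℝ) / n + 1 / N := Real.sq_sqrt (by positivity)

lemma B2_nonneg : 0 ≤ B2 P h n :=
  add_nonneg (div_nonneg (integral_nonneg fun _ => by positivity)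
    (mul_nonneg (Real.sqrt_nonneg _) (pow_nonneg (Real.sqrt_nonneg _) 3))) (Real.sqrt_nonneg _)

lemma sigma_sq_div (ha : Admissible P h) (hn : 0 < n) :
    sigma P h n N ^ 2 / n = m ^ 2 * varG P h / n + varH P h / N := by
  have := ha.varG_pos
  have := ha.varH_pos
  have hnr : (0 : ℝ) < n := by exact_mod_cast hn
  rw [sigma, Real.sq_sqrt (by positivity)]
  field_simp

lemma sigma_pos (ha : Admissible P h) (hm : 0 < m) : 0 < sigma P h n N := by
  have h1 := ha.varG_pos
  have h2 := ha.varH_pos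
  have hmr : (0 : ℝ) < m := by exact_mod_cast hm
  exact Real.sqrt_pos.2 (by positivity)

lemma sigma_sq_div_le (ha : Admissible P h) (hm : 1 ≤ m) (hn : 0 < n) :
    sigma P h n N ^ 2 / n ≤ varH P h * baseRate n m N ^ 2 := by
  rw [sigma_sq_div ha hn, baseRate_sq]
  have h1 := ha.varG_le hm
  have hnr : (0 : ℝ) < n := by exact_mod_cast hn
  have hmr : (0 : ℝ) < m := by exact_mod_cast hm
  have h3 : m ^ 2 * varG P h / n ≤ varH P h * (m / n) := by
    rw [← mul_div_assoc]
    refine div_le_div_of_nonneg_right ?_ hnr.le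
    nlinarith
  have h4 : varH P h / N = varH P h * (1 / N) := by ring
  rw [mul_add]; linarith

/-- The factor `1 - p` in the conditional variance lowers `σ²/n` by `σ_h²/(n choose m)`. With `n
choose m ≥ n²/4` and `σ² ≥ m² σ_g²`, the relative loss is at most `4σ_h²/(n m² σ_g²) = 4/(mn) +
(4/m²) τ`, where `√τ` is the second term of `B2`. -/
lemma varH_div_choose_le (ha : Admissible P h) (hm : 2 ≤ m) (hmn : 2 * m < n) (hN : 0 < N)
    (hNC : N < n.choose m) (hε : baseRate n m N ≤ 1) (hB : B2 P h n ≤ 1) :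
    varH P h / n.choose m / (sigma P h n N ^ 2 / n) ≤ 2 * baseRate n m N + B2 P h n := by
  have hnr : (0 : ℝ) < n := by exact_mod_cast (by omega : 0 < n)
  have hNr : (0 : ℝ) < N := by exact_mod_cast hN
  have hm2 : (2 : ℝ) ≤ m := by exact_mod_cast hm
  have hC : (0 : ℝ) < n.choose m := by exact_mod_cast hN.trans hNC
  have hvG := ha.varG_pos
  have hvH := ha.varH_pos
  set τ := (m : ℝ) / n * (varH P h / (m * varG P h) - 1) with hτ
  have hmG : m * varG P h ≤ varH P h := ha.varG_le (by omega)
  have hτ0 : 0 ≤ τ := by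
    have : 1 ≤ varH P h / (m * varG P h) := by rw [le_div_iff₀ (by positivity)]; linarith
    exact mul_nonneg (by positivity) (by linarith)
  have hτB : √τ ≤ B2 P h n := by
    rw [B2, ← hτ]
    refine le_add_of_nonneg_left ?_
    exact div_nonneg (integral_nonneg fun _ => by positivity)
      (mul_nonneg (Real.sqrt_nonneg _) (pow_nonneg (Real.sqrt_nonneg _) 3))
  have hτ1 : τ ≤ B2 P h n := by
    have h1 := Real.sq_sqrt hτ0
    have h2 := Real.sqrt_nonneg τ
    nlinarith
  have hch := sq_le_four_mul_choose hm hmn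
  have hy2 : varH P h / n.choose m / (sigma P h n N ^ 2 / n) ≤ 4 / (m * n) + τ := by
    have hlow : m ^ 2 * varG P h / n ≤ sigma P h n N ^ 2 / n := by
      rw [sigma_sq_div ha (by omega)]
      have : 0 ≤ varH P h / N := by positivity
      linarith
    calc varH P h / n.choose m / (sigma P h n N ^ 2 / n)
        ≤ varH P h / ((n : ℝ) ^ 2 / 4) / (m ^ 2 * varG P h / n) := by
          exact div_le_div₀ (by positivity) (div_le_div_of_nonneg_left hvH.le (by positivity) (by linarith))
            (by positivity) hlow
      _ = 4 / (m * n) * (varH P h / (m * varG P h)) := by field_simp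
      _ = 4 / (m * n) + 4 / m ^ 2 * τ := by
          rw [hτ]; field_simp; ring
      _ ≤ _ := by
          have : 4 / (m : ℝ) ^ 2 ≤ 1 := by rw [div_le_one (by positivity)]; nlinarith
          nlinarith
  have h4 : 4 / ((m : ℝ) * n) ≤ 2 * baseRate n m N := by
    have h5 : 4 / ((m : ℝ) * n) ≤ 2 * (m / n) := by
      rw [← mul_div_assoc, div_le_div_iff₀ (by positivity) hnr]
      nlinarith [mul_le_mul hm2 hm2 (by norm_num) (by linarith)]
    have h6 : (m : ℝ) / n ≤ baseRate n m N ^ 2 := by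
      rw [baseRate_sq]
      have : 0 ≤ 1 / (N : ℝ) := by positivity
      linarith
    have h7 := baseRate_pos (n := n) (m := m) hN
    nlinarith
  linarith

lemma abs_Phi_rescale_le (ha : Admissible P h) (hm : 2 ≤ m) (hmn : 2 * m < n) (hN : 0 < N)
    (hNC : N < n.choose m) (hε : baseRate n m N ≤ 1) (hB : B2 P h n ≤ 1) (z : ℝ) :
    |Phi (z * sigma P h n N / √n / √((m * sigmaG P h / √n) ^ 2 +
        (√(1 - samplingProb n m N) * sigmaH P h / √N) ^ 2)) - Phi z| ≤
      200 * baseRate n m N + 100 * B2 P h n := by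
  have hnr : (0 : ℝ) < n := by exact_mod_cast (by omega : 0 < n)
  have hNr : (0 : ℝ) < N := by exact_mod_cast hN
  have hm2 : (2 : ℝ) ≤ m := by exact_mod_cast hm
  have hC : (0 : ℝ) < n.choose m := by exact_mod_cast hN.trans hNC
  have hp1 := samplingProb_lt_one hNC
  have hvG := ha.varG_pos
  have hvH := ha.varH_pos
  have hσ : 0 < sigma P h n N := sigma_pos ha (by omega)
  set S := (m * sigmaG P h / √n) ^ 2 + (√(1 - samplingProb n m N) * sigmaH P h / √N) ^ 2 with hS
  have hSe : S = sigma P h n N ^ 2 / n - varH P h / n.choose m := by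
    rw [hS, div_pow, div_pow, mul_pow, mul_pow, Real.sq_sqrt hnr.le, Real.sq_sqrt hNr.le,
      Real.sq_sqrt (by linarith), ha.sigmaG_sq, ha.sigmaH_sq, sigma_sq_div ha (by omega),
      samplingProb]
    field_simp
    ring
  set y := -(varH P h / n.choose m / (sigma P h n N ^ 2 / n)) with hy
  have hSy : 1 + (0 + y) = S / (sigma P h n N ^ 2 / n) := by
    rw [hSe, hy]; field_simp; ring
  have harg : z * sigma P h n N / √n / √S = z / √(1 + (0 + y)) := by
    have e : z * sigma P h n N / √n = z * √(sigma P h n N ^ 2 / n) := by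
      rw [Real.sqrt_div (sq_nonneg _), Real.sqrt_sq hσ.le]; ring
    have h0 : 0 ≤ S := by positivity
    have h1 : 0 < √(sigma P h n N ^ 2 / n) := Real.sqrt_pos.2 (by positivity)
    rw [hSy, Real.sqrt_div h0, e]
    field_simp
  have hscale := abs_Phi_scale_le z 0 y
  rw [← harg] at hscale
  simp only [mul_zero, add_zero, abs_zero] at hscale
  rw [Real.zero_rpow (by norm_num), zero_add] at hscale
  refine hscale.trans ?_
  have hy1 : |y| ≤ 2 * baseRate n m N + B2 P h n := by
    rw [hy, abs_neg, abs_of_nonneg (by positivity)]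
    exact varH_div_choose_le ha hm hmn hN hNC hε hB
  linarith

/-- Everything common to the two bounds. It remains to split the relative fluctuation of the
conditional variance into `L`, treated to first order, and `ρ`, treated in mean, for shifts `c` that
come from the central range of `z`. -/
theorem kolmogorovDist_le_of_conditional (hS : IsBernoulliSampling P μ N X Z)
    (ha : Admissible P h) (hm : 2 ≤ m) (hmn : 2 * m < n) (hN : 0 < N) (hNC : N < n.choose m)
    {B : ℝ} (hB0 : 0 ≤ B)
    (hB : ∀ c : ℝ, c ^ 2 ≤ varH P h * baseRate n m N → baseRate n m N ≤ 1 →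
      ∃ L ρ : (Fin n → M) → ℝ, MemLp L (3 / 2) (Measure.pi fun _ : Fin n => P) ∧
        Integrable ρ (Measure.pi fun _ : Fin n => P) ∧
        (∀ x, ustat (fun y => (h y - c) ^ 2) n x / varH P h = 1 + (L x + ρ x)) ∧
        108 * (∫ x, |L x| ^ (3 / 2 : ℝ) ∂(Measure.pi fun _ : Fin n => P) +
          ∫ x, |ρ x| ∂(Measure.pi fun _ : Fin n => P)) +
        |∫ x, condArg P h n N c x * phi (condArg P h n N c x) * L x
          ∂(Measure.pi fun _ : Fin n => P)| ≤ B) :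
    kolmogorovDistNormal μ (fun ω => √n * incompleteU h X Z ω / sigma P h n N) ≤
      B + 2000 * ((condRate P h n N * mean P fun y => |h y| ^ 3) + B2 P h n +
        √m / √(n * (1 - samplingProb n m N))) := by
  have hε := baseRate_le ha (by omega) hN hNC
  have hε0 := baseRate_pos (n := n) (m := m) hN
  have hB20 := B2_nonneg (P := P) (h := h) (n := n)
  set ε := baseRate n m N with hεdef
  set Q := condRate P h n N * mean P fun y => |h y| ^ 3 with hQ
  have hH0 : 0 ≤ mean P fun y => |h y| ^ 3 := integral_nonneg fun _ => by positivity
  have hQ0 : 0 ≤ Q := mul_nonneg (condRate_nonneg ha) hH0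
  have hr0 : 0 ≤ √(m : ℝ) / √(n * (1 - samplingProb n m N)) := by positivity
  set F : ℝ → ℝ := fun z => μ.real {ω | √n * incompleteU h X Z ω / sigma P h n N ≤ z} with hF
  have hF0 : ∀ z, 0 ≤ F z := fun z => measureReal_nonneg
  have hF1 : ∀ z, F z ≤ 1 := fun z => measureReal_le_one
  refine Real.iSup_le (fun z => ?_) (by positivity)
  change |F z - Phi z| ≤ _
  have htriv : |F z - Phi z| ≤ 1 := by
    rw [abs_le]; constructor <;> linarith [Phi_nonneg z, Phi_le_one z, hF0 z, hF1 z]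
  rcases le_or_gt 1 ε with h1 | h1
  · linarith
  rcases le_or_gt 1 (B2 P h n) with h2 | h2
  · linarith
  have hmono : Monotone F := fun a b hab => measureReal_mono fun ω hω => le_trans hω hab
  -- Here `1056 Q` and `48 B2` come from the conditional step, `200 ε` and `100 B2` from the change
  -- of scale, and `2 Q` from `N̂ = 0`. Only central `z` remain, for which `c² ≤ σ_h² ε`.
  have key := abs_cdf_sub_le_of_central hmono hF0 hF1 hε0
    (D := B + 1060 * Q + 148 * B2 P h n + 200 * ε) (fun z hz => ?_) z
  · linarith
  set c := z * sigma P h n N / √n with hc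
  have hnr : (0 : ℝ) < n := by exact_mod_cast (by omega : 0 < n)
  have hv := ha.varH_pos
  have hc2 : c ^ 2 ≤ varH P h * ε := by
    rw [hc, div_pow, mul_pow, Real.sq_sqrt hnr.le, mul_div_assoc]
    calc z ^ 2 * (sigma P h n N ^ 2 / n) ≤ 1 / ε * (varH P h * ε ^ 2) :=
          mul_le_mul hz (sigma_sq_div_le ha (by omega) (by omega)) (by positivity) (by positivity)
      _ = _ := by field_simp
  have hc3 : |c| ^ 3 ≤ mean P fun y => |h y| ^ 3 := by
    refine le_trans (pow_le_pow_left₀ (abs_nonneg _) ?_ 3) ha.sigmaH_pow_three_le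
    refine Real.abs_le_sqrt (hc2.trans ?_)
    nlinarith
  obtain ⟨L, ρ, hL, hρ, hV, hLB⟩ := hB c hc2 h1.le
  have : ∀ i, IsProbabilityMeasure (μ.map (Z i)) := fun i =>
    Measure.isProbabilityMeasure_map (hS.measurable_Z i).aemeasurable
  obtain ⟨hFi, hFe⟩ := hS.cdf_sub_le hN hNC (by omega) ha.measurable
    (sigma_pos (n := n) (N := N) ha (by omega)) z
  have h3 := abs_integral_cond_sub_le ha hm hmn hN hNC hFi hc3 hL hρ fun x =>
    abs_cond_sub_le ha hN hNC (fun i => (hS.law_Z i).1) (fun i => (hS.law_Z i).2) c x (hV x)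
  have h4 := abs_Phi_rescale_le ha hm hmn hN hNC h1.le h2.le z
  have h5 := one_div_sqrt_le ha hN hNC
  rw [abs_le] at hFe h3 h4 ⊢
  constructor <;> linarith [hFe.1, hFe.2, h3.1, h3.2, h4.1, h4.2]

end

section

variable {M : Type*} [MeasurableSpace M] {P : Measure M} [IsProbabilityMeasure P] {m n N : ℕ}
  {k h : (Fin m → M) → ℝ}

lemma memLp_ustat {p : ENNReal} (hk : MemLp k p (Measure.pi fun _ : Fin m => P)) :
    MemLp (ustat k n) p (Measure.pi fun _ : Fin n => P) :=
  (memLp_finsetSum _ fun j _ => hk.comp_measurePreserving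
    (measurePreserving_comp_injective (P := P) j.injective)).const_mul _

lemma integral_abs_ustat_sub_le (hm : 1 ≤ m) (hmn : m ≤ n) (hk : Measurable k)
    (hs : IsSymmKernel k) (hL : MemLp k 2 (Measure.pi fun _ : Fin m => P)) :
    ∫ x, |ustat k n x - mean P k| ∂(Measure.pi fun _ : Fin n => P) ≤
      √((m : ℝ) / n * mean P fun y => (k y - mean P k) ^ 2) := by
  have h2 : ∫ x, (ustat k n x - mean P k) ^ 2 ∂(Measure.pi fun _ : Fin n => P) ≤
      (m : ℝ) / n * mean P fun y => (k y - mean P k) ^ 2 := by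
    have := integral_sq_sum_weight_le (q := 1) hmn hk hs hL
    simpa only [← ustat_sub_mean hm hmn, pow_one, ← integral_sq_sub_mean hm hk hs hL] using this
  have h0 : 0 ≤ (m : ℝ) / n * mean P fun y => (k y - mean P k) ^ 2 :=
    mul_nonneg (by positivity) (integral_nonneg fun _ => sq_nonneg _)
  -- The slack `δ` keeps the comparison constant positive even if the variance vanishes.
  refine le_of_forall_pos_le_add fun δ hδ => ?_
  refine integral_abs_le_of_integral_sq_le (by positivity)
    ((memLp_ustat hL).sub (memLp_const _)) (h2.trans ?_)
  nlinarith [Real.sq_sqrt h0, Real.sqrt_nonneg ((m : ℝ) / n * mean P fun y => (k y - mean P k) ^ 2)]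

lemma ustat_sub_sq (hmn : m ≤ n) (c : ℝ) (x : Fin n → M) :
    ustat (fun y => (h y - c) ^ 2) n x =
      ustat (fun y => h y ^ 2) n x + (c ^ 2 - 2 * c * ustat h n x) := by
  have hC : (n.choose m : ℝ) ≠ 0 := by exact_mod_cast (Nat.choose_pos hmn).ne'
  have e : ∑ j : Idx n m, (h (fun l => x (j l)) - c) ^ 2 = ∑ j : Idx n m, h (fun l => x (j l)) ^ 2 +
      (n.choose m * c ^ 2 - 2 * c * ∑ j : Idx n m, h fun l => x (j l)) := by
    rw [Finset.mul_sum, ← card_idx, ← Finset.card_univ, ← nsmul_eq_mul, ← Finset.sum_const,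
      ← Finset.sum_sub_distrib, ← Finset.sum_add_distrib]
    exact Finset.sum_congr rfl fun j _ => by ring
  simp only [ustat]
  rw [e]
  field_simp

/-- The effect on the conditional variance of replacing `h` by `h - c`. The square gives `ε` by the
choice of the central range; the cross term gives `2ε` from `|c| ≤ σ_h` and `𝔼|U_n| ≤ ε σ_h`. -/
lemma integral_abs_shift_le (ha : Admissible P h) (hm : 1 ≤ m) (hmn : m ≤ n) {c : ℝ}
    (hc : c ^ 2 ≤ varH P h * baseRate n m N) (hε : baseRate n m N ≤ 1) :
    Integrable (fun x => (c ^ 2 - 2 * c * ustat h n x) / varH P h)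
        (Measure.pi fun _ : Fin n => P) ∧
      ∫ x, |(c ^ 2 - 2 * c * ustat h n x) / varH P h| ∂(Measure.pi fun _ : Fin n => P) ≤
        3 * baseRate n m N := by
  have hv := ha.varH_pos
  have hUi : Integrable (ustat h n) (Measure.pi fun _ : Fin n => P) :=
    (memLp_ustat ha.memLp_two).integrable (by norm_num)
  have hi : Integrable (fun x => (c ^ 2 - 2 * c * ustat h n x) / varH P h)
      (Measure.pi fun _ : Fin n => P) := ((integrable_const _).sub (hUi.const_mul _)).div_const _
  refine ⟨hi, ?_⟩
  have hU := integral_abs_ustat_sub_le (n := n) hm hmn ha.measurable ha.symm ha.memLp_two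
  simp only [ha.mean_zero, sub_zero, ← ha.varH_eq] at hU
  set ε := baseRate n m N with hεdef
  have hε0 : 0 ≤ ε := Real.sqrt_nonneg _
  have hU2 : ∫ x, |ustat h n x| ∂(Measure.pi fun _ : Fin n => P) ≤ ε * √(varH P h) := by
    rw [Real.sqrt_mul (by positivity)] at hU
    refine hU.trans (mul_le_mul_of_nonneg_right ?_ (Real.sqrt_nonneg _))
    refine Real.sqrt_le_sqrt ?_
    have : 0 ≤ 1 / (N : ℝ) := by positivity
    linarith
  have hc1 : |c| ≤ √(varH P h) := Real.abs_le_sqrt (by nlinarith)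
  have hle : ∀ x, |(c ^ 2 - 2 * c * ustat h n x) / varH P h| ≤
      ε + 2 * |c| / varH P h * |ustat h n x| := fun x => by
    rw [abs_div, abs_of_pos hv, div_le_iff₀ hv]
    calc |c ^ 2 - 2 * c * ustat h n x| ≤ |c ^ 2| + |2 * c * ustat h n x| := abs_sub _ _
      _ = c ^ 2 + 2 * |c| * |ustat h n x| := by
        rw [abs_of_nonneg (sq_nonneg c), abs_mul, abs_mul, abs_two]
      _ ≤ varH P h * ε + 2 * |c| * |ustat h n x| := by linarith
      _ = _ := by field_simp
  have hi2 : Integrable (fun x => ε + 2 * |c| / varH P h * |ustat h n x|)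
      (Measure.pi fun _ : Fin n => P) := (integrable_const _).add (hUi.abs.const_mul _)
  refine (integral_mono hi.abs hi2 hle).trans ?_
  rw [integral_add (integrable_const _) (hUi.abs.const_mul _), integral_const_mul]
  have h2 : 2 * |c| / varH P h * ∫ x, |ustat h n x| ∂(Measure.pi fun _ : Fin n => P) ≤ 2 * ε := by
    calc _ ≤ 2 * √(varH P h) / varH P h * (ε * √(varH P h)) := by
          have : 0 ≤ ∫ x, |ustat h n x| ∂(Measure.pi fun _ : Fin n => P) :=
            integral_nonneg fun _ => abs_nonneg _
          gcongr
      _ = 2 * ε * (√(varH P h) ^ 2 / varH P h) := by ring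
      _ = 2 * ε := by rw [Real.sq_sqrt hv.le, div_self hv.ne', mul_one]
  simp
  linarith

lemma condRate_mul_le_B1 : condRate P h n N * (mean P fun y => |h y| ^ 3) ≤ B1 P h n N := by
  rw [B1, condRate]
  refine le_trans (le_of_eq ?_) (le_add_of_nonneg_right (Real.exp_nonneg _))
  ring

end

/-! ### The bound under a fourth moment -/

section

variable {M Ω : Type*} [MeasurableSpace M] [MeasurableSpace Ω] {P : Measure M}
  [IsProbabilityMeasure P] {μ : Measure Ω} [IsProbabilityMeasure μ] {n m N : ℕ}
  {h : (Fin m → M) → ℝ} {X : Fin n → Ω → M} {Z : Idx n m → Ω → ℝ}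

theorem kolmogorovDist_le_bound4 (hS : IsBernoulliSampling P μ N X Z)
    (ha : Admissible P h) (hm : 2 ≤ m) (hmn : 2 * m < n) (hN : 0 < N) (hNC : N < n.choose m)
    (h4 : Integrable (fun x => h x ^ 4) (Measure.pi fun _ : Fin m => P)) :
    kolmogorovDistNormal μ (fun ω => √n * incompleteU h X Z ω / sigma P h n N) ≤
      3000 * bound4 P h n N := by
  have hv := ha.varH_pos
  have hmeas := ha.measurable
  have hL2 : MemLp (fun y => h y ^ 2) 2 (Measure.pi fun _ : Fin m => P) := by
    rw [memLp_two_iff_integrable_sq (by fun_prop)]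
    exact h4.congr (Filter.Eventually.of_forall fun y => by ring)
  have hsym : IsSymmKernel fun y => h y ^ 2 := fun τ x => by simp only [ha.symm τ x]
  set E := √(m * mean P fun x => (h x ^ 2 - varH P h) ^ 2) / (√n * varH P h) with hE
  have hE0 : 0 ≤ E := by positivity
  have hε0 := (baseRate_pos (n := n) (m := m) hN).le
  have key := kolmogorovDist_le_of_conditional hS ha hm hmn hN hNC
    (B := 108 * (E + 3 * baseRate n m N)) (by positivity) fun c hc hε => by
      obtain ⟨hηi, hη⟩ := integral_abs_shift_le (n := n) ha (by omega) (by omega) hc hε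
      have hWi : Integrable (fun x => (ustat (fun y => h y ^ 2) n x - varH P h) / varH P h)
          (Measure.pi fun _ : Fin n => P) :=
        (((memLp_ustat hL2).integrable (by norm_num)).sub (integrable_const _)).div_const _
      -- With `h²` square integrable, the whole fluctuation of its U-statistic has mean absolute
      -- value at most `E`, so no first-order term is needed.
      refine ⟨fun _ => 0, fun x => (ustat (fun y => h y ^ 2) n x - varH P h) / varH P h +
        (c ^ 2 - 2 * c * ustat h n x) / varH P h, MemLp.zero', hWi.add hηi, fun x => ?_, ?_⟩
      · rw [ustat_sub_sq (by omega)]; field_simp; ring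
      · have hW : ∫ x, |(ustat (fun y => h y ^ 2) n x - varH P h) / varH P h|
            ∂(Measure.pi fun _ : Fin n => P) ≤ E := by
          have := integral_abs_ustat_sub_le (n := n) (by omega) (by omega) (hmeas.pow_const 2) hsym hL2
          rw [← ha.varH_eq] at this
          simp only [abs_div, abs_of_pos hv]
          rw [integral_div, hE, ← div_div]
          refine div_le_div_of_nonneg_right (this.trans (le_of_eq ?_)) hv.le
          rw [← Real.sqrt_div' _ (Nat.cast_nonneg n)]
          congr 1; ring
        have hsum : ∫ x, |(ustat (fun y => h y ^ 2) n x - varH P h) / varH P h +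
            (c ^ 2 - 2 * c * ustat h n x) / varH P h| ∂(Measure.pi fun _ : Fin n => P) ≤
            E + 3 * baseRate n m N := by
          refine (integral_mono (hWi.add hηi).abs (hWi.abs.add hηi.abs)
            fun x => abs_add_le _ _).trans ?_
          simp only [Pi.add_apply]
          rw [integral_add hWi.abs hηi.abs]
          linarith
        simp only [mul_zero, abs_zero, integral_zero, add_zero]
        rw [Real.zero_rpow (by norm_num), integral_zero]
        linarith
  refine key.trans ?_
  have h1 := baseRate_le ha (by omega) hN hNC
  have h2 := condRate_mul_le_B1 (P := P) (h := h) (n := n) (N := N)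
  have h3 : 0 ≤ condRate P h n N * mean P fun y => |h y| ^ 3 :=
    mul_nonneg (condRate_nonneg ha) (integral_nonneg fun _ => by positivity)
  have h5 := B2_nonneg (P := P) (h := h) (n := n)
  have h6 : 0 ≤ √(m : ℝ) / √(n * (1 - samplingProb n m N)) := by positivity
  have h7 : 0 ≤ (N : ℝ) / ((n : ℝ) ^ 2 * (1 - samplingProb n m N)) := by
    have : 0 < 1 - samplingProb n m N := by linarith [samplingProb_lt_one hNC]
    positivity
  rw [bound4, ← hE]
  linarith

end

/-! ### The bound under a third moment: linear part, remainder and decoupling -/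

section

variable {Ω : Type*} [MeasurableSpace Ω] {μ : Measure Ω} [IsProbabilityMeasure μ]

lemma integral_abs_rpow_le {f : Ω → ℝ} (hf : MemLp f (3 / 2) μ) :
    (∫ ω, |f ω| ∂μ) ^ (3 / 2 : ℝ) ≤ ∫ ω, |f ω| ^ (3 / 2 : ℝ) ∂μ :=
  (convexOn_rpow (by norm_num : (1 : ℝ) ≤ 3 / 2)).map_integral_le
    (Real.continuous_rpow_const (by norm_num)).continuousOn isClosed_Ici
    (Filter.Eventually.of_forall fun ω => abs_nonneg (f ω))
    (hf.integrable (by rw [ENNReal.le_div_iff_mul_le (by simp) (by simp)]; norm_num)).abs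
    (integrable_abs_rpow_three_halves hf)

lemma integral_abs_le_rpow {f : Ω → ℝ} (hf : MemLp f (3 / 2) μ) :
    ∫ ω, |f ω| ∂μ ≤ (∫ ω, |f ω| ^ (3 / 2 : ℝ) ∂μ) ^ (2 / 3 : ℝ) := by
  have h0 : 0 ≤ ∫ ω, |f ω| ∂μ := integral_nonneg fun _ => abs_nonneg _
  calc ∫ ω, |f ω| ∂μ = ((∫ ω, |f ω| ∂μ) ^ (3 / 2 : ℝ)) ^ (2 / 3 : ℝ) := by
        rw [← Real.rpow_mul h0]; norm_num
    _ ≤ _ := Real.rpow_le_rpow (by positivity) (integral_abs_rpow_le hf) (by norm_num)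

end

section

variable {M : Type*} [MeasurableSpace M] {P : Measure M} [IsProbabilityMeasure P] {m n N : ℕ}
  {k h : (Fin m → M) → ℝ}

/-- Of all Hoeffding components of `k`, only that of `{l}` correlates with a function of `y l`; any
other contains a coordinate other than `l` in which it is degenerate. This plays the role of
conditioning on `y l`. -/
lemma integral_comp_eval_mul_sub_mean (hm : 1 ≤ m) (hk : Measurable k) (hs : IsSymmKernel k)
    (hL : MemLp k (3 / 2) (Measure.pi fun _ : Fin m => P)) {f : M → ℝ} (hf : Measurable f)
    (hf3 : MemLp f 3 P) (l : Fin m) :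
    ∫ y, f (y l) * (k y - mean P k) ∂(Measure.pi fun _ : Fin m => P) =
      ∫ t, f t * (partialMean P k 1 (fun _ => t) - mean P k) ∂P := by
  have h1 : (1 : ENNReal) ≤ 3 / 2 := by rw [ENNReal.le_div_iff_mul_le (by simp) (by simp)]; norm_num
  have h2 : (3 / 2 : ENNReal) ≠ ⊤ := ENNReal.div_ne_top (by simp) (by simp)
  have hi : Integrable k (Measure.pi fun _ : Fin m => P) := hL.integrable h1
  have hfl : MemLp (fun y : Fin m → M => f (y l)) 3 (Measure.pi fun _ : Fin m => P) :=
    (memLp_comp_eval hf l).2 hf3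
  have hint : ∀ A : Finset (Fin m), Integrable (fun y => f (y l) * component P k A y)
      (Measure.pi fun _ : Fin m => P) := fun A =>
    IncompleteU.MemLp.integrable_mul_three_halves hfl (memLp_component h1 h2 hL A)
  simp only [sub_mean_eq_sum hm, Finset.mul_sum]
  rw [integral_finsetSum _ fun A _ => hint A, Finset.sum_eq_single {l}]
  · simp only [component_singleton]
    exact integral_comp_eval (f := fun t => f t * (partialMean P k 1 (fun _ => t) - mean P k))
      (hf.mul ((measurable_partialMean_one hk).sub_const _)) l
  · intro A hA hne
    obtain ⟨hA1, hA2⟩ := mem_cardBetween.1 hA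
    obtain ⟨i, hiA, hil⟩ : ∃ i ∈ A, i ≠ l := by
      by_contra! hcon
      exact hne (Finset.eq_singleton_iff_nonempty_unique_mem.2
        ⟨Finset.card_pos.1 hA1, hcon⟩)
    refine integral_mul_eq_zero_of_degenerate (i := i) (fun x t => ?_)
      (component_degenerate hs hi A hA2 i hiA) (hint A)
    rw [Function.update_of_ne hil.symm]
  · intro hl
    exact absurd (mem_cardBetween.2 ⟨by simp, by simpa using hm⟩) hl

lemma integral_comp_eval_mul (hm : 1 ≤ m) (hk : Measurable k) (hs : IsSymmKernel k)
    (hL : MemLp k (3 / 2) (Measure.pi fun _ : Fin m => P)) {f : M → ℝ} (hf : Measurable f)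
    (hf3 : MemLp f 3 P) (l : Fin m) :
    ∫ y, f (y l) * k y ∂(Measure.pi fun _ : Fin m => P) =
      ∫ t, f t * partialMean P k 1 (fun _ => t) ∂P := by
  have h1 : (1 : ENNReal) ≤ 3 / 2 := by rw [ENNReal.le_div_iff_mul_le (by simp) (by simp)]; norm_num
  have h2 : (3 / 2 : ENNReal) ≠ ⊤ := ENNReal.div_ne_top (by simp) (by simp)
  have hfl : MemLp (fun y : Fin m → M => f (y l)) 3 (Measure.pi fun _ : Fin m => P) :=
    (memLp_comp_eval hf l).2 hf3
  have hfi := hf3.integrable (by norm_num)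
  have hfli := hfl.integrable (by norm_num)
  have h := integral_comp_eval_mul_sub_mean hm hk hs hL hf hf3 l
  have i1 := IncompleteU.MemLp.integrable_mul_three_halves hfl hL
  have i2 := IncompleteU.MemLp.integrable_mul_three_halves hf3
    (memLp_partialMean_one h1 h2 hk hL)
  simp only [mul_sub] at h
  rw [integral_sub i1 (hfli.mul_const _), integral_sub i2 (hfi.mul_const _), integral_mul_const,
    integral_mul_const, integral_comp_eval hf] at h
  linarith

lemma IsSymmKernel.sq (hs : IsSymmKernel h) : IsSymmKernel fun y => h y ^ 2 :=
  fun τ x => by simp only [hs τ x]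

lemma Admissible.memLp_sq (ha : Admissible P h) :
    MemLp (fun y => h y ^ 2) (3 / 2) (Measure.pi fun _ : Fin m => P) := by
  have hmeas := ha.measurable
  rw [memLp_three_halves_iff (by fun_prop)]
  refine ha.third_moment.congr (Filter.Eventually.of_forall fun y => ?_)
  simp only
  rw [rpow_three_halves (abs_nonneg _), abs_of_nonneg (sq_nonneg (h y)), Real.sqrt_sq_eq_abs,
    ← sq_abs (h y)]
  ring

lemma Psi1_nonneg (t : M) : 0 ≤ Psi1 P h t := integral_nonneg fun _ => sq_nonneg _

lemma Admissible.measurable_Psi1 (ha : Admissible P h) : Measurable (Psi1 P h) :=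
  measurable_partialMean_one (ha.measurable.pow_const 2)

lemma Admissible.memLp_Psi1 (ha : Admissible P h) : MemLp (Psi1 P h) (3 / 2) P :=
  memLp_partialMean_one (by rw [ENNReal.le_div_iff_mul_le (by simp) (by simp)]; norm_num)
    (ENNReal.div_ne_top (by simp) (by simp)) (ha.measurable.pow_const 2) ha.memLp_sq

lemma Admissible.integral_Psi1 (ha : Admissible P h) (hm : 1 ≤ m) :
    ∫ t, Psi1 P h t ∂P = varH P h := by
  have h1 : (1 : ENNReal) ≤ 3 / 2 := by rw [ENNReal.le_div_iff_mul_le (by simp) (by simp)]; norm_num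
  have h0 : ∫ t, (Psi1 P h t - mean P fun y => h y ^ 2) ∂P = 0 :=
    integral_partialMean_one hm (ha.measurable.pow_const 2) ha.symm.sq (ha.memLp_sq.integrable h1)
  rw [← ha.varH_eq, integral_sub (ha.memLp_Psi1.integrable h1) (integrable_const _)] at h0
  simp only [integral_const, probReal_univ, one_smul] at h0
  linarith

lemma Admissible.integrable_Psi1_rpow (ha : Admissible P h) :
    Integrable (fun t => Psi1 P h t ^ (3 / 2 : ℝ)) P := by
  simpa only [abs_of_nonneg (Psi1_nonneg (P := P) (h := h) _)] using
    integrable_abs_rpow_three_halves ha.memLp_Psi1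

lemma Admissible.varH_rpow_le_Psi1 (ha : Admissible P h) (hm : 1 ≤ m) :
    varH P h ^ (3 / 2 : ℝ) ≤ ∫ t, Psi1 P h t ^ (3 / 2 : ℝ) ∂P := by
  have := integral_abs_rpow_le ha.memLp_Psi1
  simpa only [abs_of_nonneg (Psi1_nonneg (P := P) (h := h) _), ha.integral_Psi1 hm] using this

lemma Admissible.max_Psi1 (ha : Admissible P h) (hm : 1 ≤ m) :
    Integrable (fun t => max (Psi1 P h t) (varH P h) ^ (3 / 2 : ℝ)) P ∧
      ∫ t, max (Psi1 P h t) (varH P h) ^ (3 / 2 : ℝ) ∂P ≤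
        2 * ∫ t, Psi1 P h t ^ (3 / 2 : ℝ) ∂P := by
  have hv := ha.varH_pos
  have hmΨ := ha.measurable_Psi1
  have hle : ∀ t, max (Psi1 P h t) (varH P h) ^ (3 / 2 : ℝ) ≤
      Psi1 P h t ^ (3 / 2 : ℝ) + varH P h ^ (3 / 2 : ℝ) := fun t => by
    have h1 : 0 ≤ Psi1 P h t ^ (3 / 2 : ℝ) := Real.rpow_nonneg (Psi1_nonneg t) _
    have h2 : 0 ≤ varH P h ^ (3 / 2 : ℝ) := by positivity
    rcases max_cases (Psi1 P h t) (varH P h) with h | h <;> rw [h.1] <;> linarith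
  have hi := ha.integrable_Psi1_rpow.add (integrable_const (varH P h ^ (3 / 2 : ℝ)))
  have hi2 : Integrable (fun t => max (Psi1 P h t) (varH P h) ^ (3 / 2 : ℝ)) P :=
    hi.mono' ((hmΨ.max measurable_const).pow_const _).aestronglyMeasurable (Filter.Eventually.of_forall fun t => by
      rw [Real.norm_eq_abs, abs_of_nonneg (by positivity)]; exact hle t)
  refine ⟨hi2, (integral_mono hi2 hi hle).trans ?_⟩
  simp only [Pi.add_apply]
  rw [integral_add ha.integrable_Psi1_rpow (integrable_const _)]
  have := ha.varH_rpow_le_Psi1 hm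
  simp
  linarith

lemma abs_Psi1_sub_le (ha : Admissible P h) (t : M) :
    |Psi1 P h t - varH P h| ≤ max (Psi1 P h t) (varH P h) := by
  have h1 := Psi1_nonneg (P := P) (h := h) t
  have h2 := ha.varH_pos
  have h3 := le_max_left (Psi1 P h t) (varH P h)
  have h4 := le_max_right (Psi1 P h t) (varH P h)
  rw [abs_le]; constructor <;> linarith

lemma Admissible.memLp_Psi1_sub (ha : Admissible P h) :
    MemLp (fun t => Psi1 P h t - varH P h) (3 / 2) P := ha.memLp_Psi1.sub (memLp_const _)

lemma integral_abs_Psi1_sub_rpow_le (ha : Admissible P h) (hm : 1 ≤ m) :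
    ∫ t, |Psi1 P h t - varH P h| ^ (3 / 2 : ℝ) ∂P ≤ 2 * ∫ t, Psi1 P h t ^ (3 / 2 : ℝ) ∂P := by
  obtain ⟨h1, h2⟩ := ha.max_Psi1 hm
  exact (integral_mono (integrable_abs_rpow_three_halves ha.memLp_Psi1_sub) h1 fun t =>
    Real.rpow_le_rpow (abs_nonneg _) (abs_Psi1_sub_le ha t) (by norm_num)).trans h2

/-- With `s = max Ψ₁ σ_h²`, AM-GM weighted by `√s` gives `|h| s ≤ (√s h² + s^{3/2})/2`. Conditioning
on `y l` replaces `h²` by `Ψ₁ ≤ s`, so only `𝔼[s^{3/2}] ≤ 2 𝔼[Ψ₁^{3/2}]` is needed. -/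
lemma integral_abs_mul_abs_Psi1_sub_le (ha : Admissible P h) (hm : 1 ≤ m) (l : Fin m) :
    Integrable (fun y => |h y| * |Psi1 P h (y l) - varH P h|) (Measure.pi fun _ : Fin m => P) ∧
      mean P (fun y => |h y| * |Psi1 P h (y l) - varH P h|) ≤
        2 * ∫ t, Psi1 P h t ^ (3 / 2 : ℝ) ∂P := by
  have hv := ha.varH_pos
  have hmΨ := ha.measurable_Psi1
  obtain ⟨hsi, hsle⟩ := ha.max_Psi1 hm
  set s : M → ℝ := fun t => max (Psi1 P h t) (varH P h) with hs
  have hs0 : ∀ t, 0 ≤ s t := fun t => hv.le.trans (le_max_right _ _)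
  have hsm : Measurable s := hmΨ.max measurable_const
  have hrp : ∀ t, s t ^ (3 / 2 : ℝ) = s t * √(s t) := fun t => rpow_three_halves (hs0 t)
  have hsq3 : MemLp (fun t => √(s t)) 3 P := by
    rw [← integrable_norm_rpow_iff (by fun_prop) (by simp) (by simp)]
    refine hsi.congr (Filter.Eventually.of_forall fun t => ?_)
    simp only [Real.norm_eq_abs, abs_of_nonneg (Real.sqrt_nonneg _)]
    change s t ^ (3 / 2 : ℝ) = _
    rw [hrp, show (ENNReal.toReal 3) = ((3 : ℕ) : ℝ) by simp, Real.rpow_natCast, pow_succ,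
      Real.sq_sqrt (hs0 t)]
  have hi : Integrable (fun y => |h y| * |Psi1 P h (y l) - varH P h|)
      (Measure.pi fun _ : Fin m => P) :=
    IncompleteU.MemLp.integrable_mul_three_halves ha.memLp_three.abs
      ((memLp_comp_eval (hmΨ.sub_const _) l).2 ha.memLp_Psi1_sub).abs
  have hi1 : Integrable (fun y => √(s (y l)) * h y ^ 2) (Measure.pi fun _ : Fin m => P) :=
    IncompleteU.MemLp.integrable_mul_three_halves
      ((memLp_comp_eval (f := fun t => √(s t)) (by fun_prop) l).2 hsq3) ha.memLp_sq
  have hi2 : Integrable (fun y => s (y l) ^ (3 / 2 : ℝ)) (Measure.pi fun _ : Fin m => P) :=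
    ((measurePreserving_eval (fun _ : Fin m => P) l).integrable_comp_of_integrable hsi)
  refine ⟨hi, (integral_mono hi ((hi1.add hi2).div_const 2) fun y => ?_).trans ?_⟩
  · have h1 : |h y| * |Psi1 P h (y l) - varH P h| ≤ |h y| * s (y l) :=
      mul_le_mul_of_nonneg_left (abs_Psi1_sub_le ha _) (abs_nonneg _)
    have h2 := mul_nonneg (Real.sqrt_nonneg (s (y l))) (sq_nonneg (√(s (y l)) - |h y|))
    have h3 := Real.sq_sqrt (hs0 (y l))
    have h4 : √(s (y l)) * (√(s (y l)) - |h y|) ^ 2 =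
        s (y l) * √(s (y l)) - 2 * (|h y| * s (y l)) + √(s (y l)) * h y ^ 2 := by
      rw [sub_sq, h3, sq_abs]
      calc _ = √(s (y l)) * s (y l) - 2 * (|h y| * √(s (y l)) ^ 2) + √(s (y l)) * h y ^ 2 := by ring
        _ = _ := by rw [h3]; ring
    simp only [Pi.add_apply, hrp]
    linarith
  · rw [integral_div]
    simp only [Pi.add_apply]
    rw [integral_add hi1 hi2, integral_comp_eval (f := fun t => s t ^ (3 / 2 : ℝ)) (by fun_prop) l,
      integral_comp_eval_mul (f := fun t => √(s t)) hm (ha.measurable.pow_const 2) ha.symm.sq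
        ha.memLp_sq (by fun_prop) hsq3 l]
    have h5 : ∫ t, √(s t) * partialMean P (fun y => h y ^ 2) 1 (fun _ => t) ∂P ≤
        ∫ t, s t ^ (3 / 2 : ℝ) ∂P := by
      refine integral_mono (IncompleteU.MemLp.integrable_mul_three_halves hsq3 ha.memLp_Psi1) hsi
        fun t => ?_
      simp only
      change _ ≤ s t ^ (3 / 2 : ℝ)
      rw [hrp, mul_comm (s t)]
      exact mul_le_mul_of_nonneg_left (le_max_left _ _) (Real.sqrt_nonneg _)
    linarith

end

section

variable {M : Type*} [MeasurableSpace M] {P : Measure M} [IsProbabilityMeasure P] {m n N : ℕ}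
  {h : (Fin m → M) → ℝ}

lemma one_le_three_halves : (1 : ENNReal) ≤ 3 / 2 := by
  rw [ENNReal.le_div_iff_mul_le (by simp) (by simp)]; norm_num

lemma three_halves_ne_top : (3 / 2 : ENNReal) ≠ ⊤ := ENNReal.div_ne_top (by simp) (by simp)

lemma remainder_eq (ha : Admissible P h) (x : Fin n → M) :
    remainder P h n x = (∑ A ∈ cardBetween n 2 m,
      weight n m A.card * component P (fun y => h y ^ 2) A x) / varH P h := by
  rw [sum_cardBetween, remainder, Finset.sum_div]
  refine Finset.sum_congr rfl fun r _ => ?_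
  have h1 := sum_idx_eq (RelEmbedding.refl _ : Fin n ↪o Fin n) r
    (fun s y => hproj P (fun y => h y ^ 2) s y) x
  have e : (Finset.univ : Finset (Fin n)).map
      (RelEmbedding.refl _ : Fin n ↪o Fin n).toEmbedding = Finset.univ := by
    ext; simp
  rw [e] at h1
  have h2 : ∑ j : Idx n r, hoeffdingProj P h r (fun l => x (j l)) =
      ∑ A ∈ Finset.powersetCard r Finset.univ, component P (fun y => h y ^ 2) A x := by
    simp only [hoeffdingProj_eq_hproj P ha.varH_eq]
    exact h1
  rw [← Finset.sum_div, h2, ← mul_div_assoc, Finset.mul_sum]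
  congr 1
  refine Finset.sum_congr rfl fun A hA => ?_
  rw [(Finset.mem_powersetCard.1 hA).2, weight, div_eq_mul_inv]

lemma memLp_remainder (ha : Admissible P h) :
    MemLp (remainder P h n) (3 / 2) (Measure.pi fun _ : Fin n => P) := by
  have : MemLp (fun x => (∑ A ∈ cardBetween n 2 m,
      weight n m A.card * component P (fun y => h y ^ 2) A x) * (varH P h)⁻¹) (3 / 2)
      (Measure.pi fun _ : Fin n => P) :=
    (memLp_finsetSum _ fun A _ => (memLp_component one_le_three_halves three_halves_ne_top
      ha.memLp_sq A).const_mul _).mul_const _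
  refine this.ae_eq (Filter.Eventually.of_forall fun x => ?_)
  simp only [remainder_eq ha, div_eq_mul_inv]

variable (P h) in
/-- The linear part of the Hoeffding decomposition of the U-statistic of `h²`. -/
noncomputable def linearPart (n : ℕ) (x : Fin n → M) : ℝ :=
  (m : ℝ) / (n * varH P h) * ∑ i, (Psi1 P h (x i) - varH P h)

lemma ustat_sq_div (ha : Admissible P h) (hm : 1 ≤ m) (hmn : m ≤ n) (x : Fin n → M) :
    ustat (fun y => h y ^ 2) n x / varH P h = 1 + (linearPart P h n x + remainder P h n x) := by
  have hv := ha.varH_pos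
  have h1 := ustat_decomposition (P := P) (k := fun y => h y ^ 2) hm hmn x
  rw [← ha.varH_eq] at h1
  have h2 : ∑ i, (Psi1 P h (x i) - varH P h) =
      ∑ i, (partialMean P (fun y => h y ^ 2) 1 (fun _ => x i) - varH P h) := rfl
  have hnr : (0 : ℝ) < n := by exact_mod_cast (by omega : 0 < n)
  rw [remainder_eq ha, linearPart, h2, sub_eq_iff_eq_add.1 h1]
  field_simp
  ring

/-- The von Bahr-Esseen inequality for the singleton components. The sum has `3/2`-moment of order
`n`, and the prefactor `(m/(nσ_h²))^{3/2}` brings this down to `n^{-1/2}`; the 6 is `3 * 2`. -/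
lemma integral_abs_linearPart_rpow_le (ha : Admissible P h) (hm : 1 ≤ m) (hn : 0 < n) :
    ∫ x, |linearPart P h n x| ^ (3 / 2 : ℝ) ∂(Measure.pi fun _ : Fin n => P) ≤
      6 * ((m : ℝ) ^ (3 / 2 : ℝ) * (∫ t, Psi1 P h t ^ (3 / 2 : ℝ) ∂P) / (√n * sigmaH P h ^ 3)) := by
  have hv := ha.varH_pos
  have hnr : (0 : ℝ) < n := by exact_mod_cast hn
  have hmeas := (ha.measurable_Psi1.sub_const (varH P h))
  have hL : MemLp (fun y => h y ^ 2) (3 / 2) (Measure.pi fun _ : Fin m => P) := ha.memLp_sq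
  have h1 := integral_abs_sum_rpow_three_halves_le (P := P) (F := component P (fun y => h y ^ 2))
    (𝒥 := Finset.powersetCard 1 (Finset.univ : Finset (Fin n)))
    (fun J _ => memLp_component one_le_three_halves three_halves_ne_top hL J)
    (fun J _ i hi => component_indepOfCoord hi)
    (fun J hJ => component_degenerate ha.symm.sq (hL.integrable one_le_three_halves) J
      (by rw [(Finset.mem_powersetCard.1 hJ).2]; exact hm))
  rw [Finset.powersetCard_one, Finset.sum_map] at h1
  simp only [Finset.sum_map, Function.Embedding.coeFn_mk, component_singleton, ← ha.varH_eq,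
    Finset.card_singleton, pow_one] at h1
  have h2 : ∀ i : Fin n, ∫ x : Fin n → M, |Psi1 P h (x i) - varH P h| ^ (3 / 2 : ℝ)
      ∂(Measure.pi fun _ : Fin n => P) ≤ 2 * ∫ t, Psi1 P h t ^ (3 / 2 : ℝ) ∂P := fun i => by
    rw [integral_comp_eval (f := fun t => |Psi1 P h t - varH P h| ^ (3 / 2 : ℝ))
      (hmeas.abs.pow_const _) i]
    exact integral_abs_Psi1_sub_rpow_le ha hm
  have h3 : ∫ x : Fin n → M, |∑ i, (Psi1 P h (x i) - varH P h)| ^ (3 / 2 : ℝ)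
      ∂(Measure.pi fun _ : Fin n => P) ≤ n * (3 * (2 * ∫ t, Psi1 P h t ^ (3 / 2 : ℝ) ∂P)) := by
    refine h1.trans ((Finset.sum_le_sum fun i _ => mul_le_mul_of_nonneg_left (h2 i)
      (by norm_num)).trans (le_of_eq ?_))
    simp
  have hc : 0 ≤ (m : ℝ) / (n * varH P h) := by positivity
  have h4 : ∀ x, |linearPart P h n x| ^ (3 / 2 : ℝ) = ((m : ℝ) / (n * varH P h)) ^ (3 / 2 : ℝ) *
      |∑ i, (Psi1 P h (x i) - varH P h)| ^ (3 / 2 : ℝ) := fun x => by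
    rw [linearPart, abs_mul, abs_of_nonneg hc, Real.mul_rpow hc (abs_nonneg _)]
  simp only [h4]
  rw [integral_const_mul]
  refine (mul_le_mul_of_nonneg_left h3 (by positivity)).trans (le_of_eq ?_)
  rw [Real.div_rpow (by positivity) (by positivity), Real.mul_rpow hnr.le hv.le,
    rpow_three_halves hnr.le, rpow_three_halves hv.le, sigmaH]
  have h5 : √(varH P h) ^ 3 = varH P h * √(varH P h) := by
    rw [pow_succ, Real.sq_sqrt hv.le]
  rw [h5]
  have := Real.sqrt_pos.2 hv
  have := Real.sqrt_pos.2 hnr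
  field_simp
  ring

lemma memLp_linearPart (ha : Admissible P h) :
    MemLp (linearPart P h n) (3 / 2) (Measure.pi fun _ : Fin n => P) :=
  (memLp_finsetSum _ fun i _ => (memLp_comp_eval (ha.measurable_Psi1.sub_const _) i).2
    ha.memLp_Psi1_sub).const_mul _

lemma sum_card_filter_mem_range :
    ∑ i : Fin n, (Finset.univ.filter fun I : Idx n m => ∃ l, I l = i).card = m * n.choose m := by
  have h1 := Finset.sum_card_bipartiteAbove_eq_sum_card_bipartiteBelow
    (s := (Finset.univ : Finset (Fin n))) (t := (Finset.univ : Finset (Idx n m)))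
    (fun i I => ∃ l, I l = i)
  simp only [Finset.bipartiteAbove, Finset.bipartiteBelow] at h1
  have h2 : ∀ I : Idx n m, (Finset.univ.filter fun i : Fin n => ∃ l, I l = i).card = m := fun I => by
    have e : (Finset.univ.filter fun i : Fin n => ∃ l, I l = i) = Finset.univ.image I := by
      ext; simp
    rw [e, Finset.card_image_of_injective _ I.injective, Finset.card_univ, Fintype.card_fin]
  rw [h1, Finset.sum_congr rfl fun I _ => h2 I, Finset.sum_const, Finset.card_univ, card_idx,
    smul_eq_mul, mul_comm]

/-- If `w` is Lipschitz, `w(U)` is almost uncorrelated with centred functions of one observation: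
only the part of `U` that involves this observation matters. -/
lemma abs_integral_comp_ustat_mul_le (ha : Admissible P h) (hm : 1 ≤ m) {w : ℝ → ℝ} {Λ B : ℝ}
    (hΛ : ∀ a b, |w a - w b| ≤ Λ * |a - b|) (hw : Measurable w) (hB : ∀ a, |w a| ≤ B) (i : Fin n) :
    |∫ x, w (ustat h n x) * (Psi1 P h (x i) - varH P h) ∂(Measure.pi fun _ : Fin n => P)| ≤
      Λ * ((n.choose m : ℝ)⁻¹ * ((Finset.univ.filter fun I : Idx n m => ∃ l, I l = i).card *
        (2 * ∫ t, Psi1 P h t ^ (3 / 2 : ℝ) ∂P))) := by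
  have hmeas := ha.measurable
  set μ := Measure.pi fun _ : Fin n => P with hμ
  set S := Finset.univ.filter fun I : Idx n m => ∃ l, I l = i with hS
  set S' := Finset.univ.filter fun I : Idx n m => ¬ ∃ l, I l = i with hS'
  -- The U-statistic without the tuples through `i`. It does not see `x i`, hence `w(V)` is
  -- uncorrelated with the centred `ψ`, and only the Lipschitz error from the tuples in `S` remains.
  set V : (Fin n → M) → ℝ := fun x => (n.choose m : ℝ)⁻¹ * ∑ I ∈ S', h fun l => x (I l) with hV
  set ψ : (Fin n → M) → ℝ := fun x => Psi1 P h (x i) - varH P h with hψ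
  have hψm : Measurable fun t => Psi1 P h t - varH P h := ha.measurable_Psi1.sub_const _
  have hψL : MemLp ψ (3 / 2) μ := (memLp_comp_eval hψm i).2 ha.memLp_Psi1_sub
  have hψi := hψL.integrable one_le_three_halves
  have hhm : ∀ I : Idx n m, Measurable fun x : Fin n → M => h fun l => x (I l) := fun I =>
    hmeas.comp (measurable_pi_lambda _ fun _ => measurable_pi_apply _)
  have hVm : Measurable V := (Finset.measurable_sum _ fun I _ => hhm I).const_mul _
  have hUm : Measurable (ustat h n) := measurable_ustat hmeas
  have hbdd : ∀ G : (Fin n → M) → ℝ, Measurable G → Integrable (fun x => w (G x) * ψ x) μ :=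
    fun G hG => hψi.bdd_mul (c := B) (hw.comp hG).aestronglyMeasurable
      (Filter.Eventually.of_forall fun x => hB _)
  have hV0 : ∫ x, w (V x) * ψ x ∂μ = 0 := by
    refine integral_mul_eq_zero_of_degenerate (i := i) (fun x t => ?_) ?_ (hbdd V hVm)
    · refine congrArg w (congrArg ((n.choose m : ℝ)⁻¹ * ·) (Finset.sum_congr rfl fun I hI => ?_))
      congr 1; ext l
      rw [Function.update_of_ne]
      exact fun hl => (Finset.mem_filter.1 hI).2 ⟨l, hl⟩
    · have h1 := component_degenerate (n := n) ha.symm.sq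
        (ha.memLp_sq.integrable one_le_three_halves) {i} (by simpa using hm) i (by simp)
      have e : component P (fun y => h y ^ 2) {i} = ψ := by
        ext x; rw [component_singleton, ← ha.varH_eq]; rfl
      rwa [e] at h1
  have hint : ∀ I : Idx n m, Integrable (fun x => |h fun l => x (I l)| * |ψ x|) μ := fun I =>
    IncompleteU.MemLp.integrable_mul_three_halves (ha.memLp_three.comp_measurePreserving
      (measurePreserving_comp_injective (P := P) I.injective)).abs hψL.abs
  have hle : ∀ I ∈ S, ∫ x, |h fun l => x (I l)| * |ψ x| ∂μ ≤
      2 * ∫ t, Psi1 P h t ^ (3 / 2 : ℝ) ∂P := fun I hI => by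
    obtain ⟨l, hl⟩ := (Finset.mem_filter.1 hI).2
    obtain ⟨h1, h2⟩ := integral_abs_mul_abs_Psi1_sub_le ha hm l
    refine le_trans (le_of_eq ?_) h2
    have hp := measurePreserving_comp_injective (P := P) I.injective
    have h1' := h1.1
    rw [← hp.map_eq] at h1'
    rw [mean, ← hp.map_eq, integral_map hp.measurable.aemeasurable h1']
    simp only [hl, hψ]
    rfl
  have hpt : ∀ x, |w (ustat h n x) * ψ x - w (V x) * ψ x| ≤
      Λ * ((n.choose m : ℝ)⁻¹ * ∑ I ∈ S, |h fun l => x (I l)| * |ψ x|) := fun x => by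
    have e : ustat h n x - V x = (n.choose m : ℝ)⁻¹ * ∑ I ∈ S, h fun l => x (I l) := by
      rw [ustat, hV, ← mul_sub, ← Finset.sum_filter_add_sum_filter_not Finset.univ
        (fun I : Idx n m => ∃ l, I l = i), add_sub_cancel_right]
    have hΛ0 : 0 ≤ Λ := by
      have := hΛ 0 1
      have h2 := abs_nonneg (w 0 - w 1)
      simp at this
      linarith
    rw [← sub_mul, abs_mul, ← Finset.sum_mul, ← mul_assoc, ← mul_assoc]
    refine mul_le_mul_of_nonneg_right ((hΛ _ _).trans ?_) (abs_nonneg _)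
    rw [e, abs_mul, abs_of_nonneg (by positivity), mul_assoc]
    exact mul_le_mul_of_nonneg_left (mul_le_mul_of_nonneg_left (Finset.abs_sum_le_sum_abs _ _)
      (by positivity)) hΛ0
  have hR : Integrable (fun x => Λ * ((n.choose m : ℝ)⁻¹ * ∑ I ∈ S, |h fun l => x (I l)| * |ψ x|))
      μ := ((integrable_finsetSum _ fun I _ => hint I).const_mul _).const_mul _
  have hΛ0 : 0 ≤ Λ := by
    have := hΛ 0 1
    have h2 := abs_nonneg (w 0 - w 1)
    simp at this
    linarith
  have hD := (hbdd _ hUm).sub (hbdd V hVm)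
  calc |∫ x, w (ustat h n x) * ψ x ∂μ|
      = |∫ x, (w (ustat h n x) * ψ x - w (V x) * ψ x) ∂μ| := by
        rw [integral_sub (hbdd _ hUm) (hbdd V hVm), hV0, sub_zero]
    _ ≤ ∫ x, Λ * ((n.choose m : ℝ)⁻¹ * ∑ I ∈ S, |h fun l => x (I l)| * |ψ x|) ∂μ :=
        abs_integral_le_integral_abs.trans (integral_mono hD.abs hR hpt)
    _ = Λ * ((n.choose m : ℝ)⁻¹ * ∑ I ∈ S, ∫ x, |h fun l => x (I l)| * |ψ x| ∂μ) := by
        rw [integral_const_mul, integral_const_mul, integral_finsetSum _ fun I _ => hint I]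
    _ ≤ _ := by
        refine mul_le_mul_of_nonneg_left (mul_le_mul_of_nonneg_left ?_ (by positivity)) hΛ0
        refine (Finset.sum_le_sum hle).trans (le_of_eq ?_)
        rw [Finset.sum_const, nsmul_eq_mul]

end

section

variable {M : Type*} [MeasurableSpace M] {P : Measure M} [IsProbabilityMeasure P] {m n N : ℕ}
  {h : (Fin m → M) → ℝ}

/-- As a function of `U_n`, the factor `a φ(a)` has Lipschitz constant `9/s`, where `s` is the
conditional standard deviation; this is the origin of `√N / √(1-p)`. Summed over `i`, the tuples
through `i` number `m * (n choose m)`. -/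
lemma abs_integral_condArg_mul_linearPart_le (ha : Admissible P h) (hm : 1 ≤ m) (hmn : m ≤ n)
    (hN : 0 < N) (hNC : N < n.choose m) (c : ℝ) :
    |∫ x, condArg P h n N c x * phi (condArg P h n N c x) * linearPart P h n x
        ∂(Measure.pi fun _ : Fin n => P)| ≤
      18 * (√(m * N) / √(n * (1 - samplingProb n m N)) *
        ((m : ℝ) ^ (3 / 2 : ℝ) * (∫ t, Psi1 P h t ^ (3 / 2 : ℝ) ∂P) / (√n * sigmaH P h ^ 3))) := by
  have hv := ha.varH_pos
  have hσ := ha.sigmaH_pos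
  have hσ2 := ha.sigmaH_sq
  have hq : 0 < 1 - samplingProb n m N := by linarith [samplingProb_lt_one hNC]
  have hnr : (0 : ℝ) < n := by exact_mod_cast (by omega : 0 < n)
  have hmr : (0 : ℝ) < m := by exact_mod_cast (by omega : 0 < m)
  have hNr : (0 : ℝ) < N := by exact_mod_cast hN
  have hC : (0 : ℝ) < n.choose m := by exact_mod_cast hN.trans hNC
  have hsq := Real.sqrt_pos.2 hq
  have hsN := Real.sqrt_pos.2 hNr
  have hsn := Real.sqrt_pos.2 hnr
  have hsm := Real.sqrt_pos.2 hmr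
  set M₀ := ∫ t, Psi1 P h t ^ (3 / 2 : ℝ) ∂P with hM₀
  set s := √(1 - samplingProb n m N) * sigmaH P h / √N with hs
  have hs0 : 0 < s := by positivity
  set w : ℝ → ℝ := fun u => (c - u) / s * phi ((c - u) / s) with hw
  have hwm : Measurable w := by
    have : Measurable fun u : ℝ => (c - u) / s := by fun_prop
    exact this.mul (continuous_phi.measurable.comp this)
  have hΛ : ∀ a b, |w a - w b| ≤ 9 / s * |a - b| := fun a b => by
    refine (abs_mul_phi_sub_le _ _).trans (le_of_eq ?_)
    rw [← sub_div, abs_div, abs_of_pos hs0, sub_sub_sub_cancel_left, abs_sub_comm]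
    ring
  have hcov := fun i : Fin n => abs_integral_comp_ustat_mul_le ha hm hΛ hwm
    (B := 1) (fun a => abs_mul_phi_le _) i
  have hψi : ∀ i : Fin n, Integrable (fun x => w (ustat h n x) * (Psi1 P h (x i) - varH P h))
      (Measure.pi fun _ : Fin n => P) := fun i =>
    (((memLp_comp_eval (ha.measurable_Psi1.sub_const _) i).2
      ha.memLp_Psi1_sub).integrable one_le_three_halves).bdd_mul (c := 1)
      (hwm.comp (measurable_ustat ha.measurable)).aestronglyMeasurable
      (Filter.Eventually.of_forall fun x => abs_mul_phi_le _)
  have e1 : ∫ x, condArg P h n N c x * phi (condArg P h n N c x) * linearPart P h n x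
      ∂(Measure.pi fun _ : Fin n => P) = m / (n * varH P h) *
        ∑ i, ∫ x, w (ustat h n x) * (Psi1 P h (x i) - varH P h)
          ∂(Measure.pi fun _ : Fin n => P) := by
    rw [← integral_finsetSum _ fun i _ => hψi i, ← integral_const_mul]
    refine integral_congr_ae (Filter.Eventually.of_forall fun x => ?_)
    simp only [linearPart, ← Finset.mul_sum]
    change w (ustat h n x) * _ = _
    ring
  have hsum : ∑ i : Fin n, ((Finset.univ.filter fun I : Idx n m => ∃ l, I l = i).card : ℝ) =
      m * n.choose m := by exact_mod_cast sum_card_filter_mem_range (n := n) (m := m)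
  rw [e1, abs_mul, abs_of_nonneg (by positivity)]
  calc m / (n * varH P h) * |∑ i, ∫ x, w (ustat h n x) * (Psi1 P h (x i) - varH P h)
          ∂(Measure.pi fun _ : Fin n => P)|
      ≤ m / (n * varH P h) * ∑ i : Fin n, 9 / s * ((n.choose m : ℝ)⁻¹ *
        ((Finset.univ.filter fun I : Idx n m => ∃ l, I l = i).card * (2 * M₀))) :=
        mul_le_mul_of_nonneg_left ((Finset.abs_sum_le_sum_abs _ _).trans
          (Finset.sum_le_sum fun i _ => hcov i)) (by positivity)
    _ = m / (n * varH P h) * (9 / s * ((n.choose m : ℝ)⁻¹ * (m * n.choose m * (2 * M₀)))) := by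
        rw [← Finset.mul_sum, ← Finset.mul_sum, ← Finset.sum_mul, hsum]
    _ = 18 * (m ^ 2 * √N * M₀ / (n * √(1 - samplingProb n m N) * sigmaH P h ^ 3)) := by
        rw [hs, ← hσ2]
        field_simp
        ring
    _ = _ := by
        rw [Real.sqrt_mul hmr.le, Real.sqrt_mul hnr.le, rpow_three_halves hmr.le]
        have h1 := Real.sq_sqrt hmr.le
        have h2 := Real.sq_sqrt hnr.le
        congr 1
        calc m ^ 2 * √N * M₀ / (n * √(1 - samplingProb n m N) * sigmaH P h ^ 3)
            = m * √m ^ 2 * √N * M₀ / (√n ^ 2 * √(1 - samplingProb n m N) * sigmaH P h ^ 3) := by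
              rw [h1, h2]; ring
          _ = _ := by field_simp

end

section

variable {M Ω : Type*} [MeasurableSpace M] [MeasurableSpace Ω] {P : Measure M}
  [IsProbabilityMeasure P] {μ : Measure Ω} [IsProbabilityMeasure μ] {n m N : ℕ}
  {h : (Fin m → M) → ℝ} {X : Fin n → Ω → M} {Z : Idx n m → Ω → ℝ}

theorem kolmogorovDist_le_bound3 (hS : IsBernoulliSampling P μ N X Z)
    (ha : Admissible P h) (hm : 2 ≤ m) (hmn : 2 * m < n) (hN : 0 < N) (hNC : N < n.choose m) :
    kolmogorovDistNormal μ (fun ω => √n * incompleteU h X Z ω / sigma P h n N) ≤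
      3000 * bound3 P h n N := by
  have hσ := ha.sigmaH_pos
  set T := (m : ℝ) ^ (3 / 2 : ℝ) * (∫ t, Psi1 P h t ^ (3 / 2 : ℝ) ∂P) / (√n * sigmaH P h ^ 3)
    with hT
  set q := √(m * N) / √(n * (1 - samplingProb n m N)) with hq
  have hT0 : 0 ≤ T := by
    have : 0 ≤ ∫ t, Psi1 P h t ^ (3 / 2 : ℝ) ∂P :=
      integral_nonneg fun t => Real.rpow_nonneg (Psi1_nonneg t) _
    positivity
  have hq0 : 0 ≤ q := by positivity
  have hR0 : 0 ≤ remainderNorm P h n :=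
    Real.rpow_nonneg (integral_nonneg fun _ => by positivity) _
  have hε0 := (baseRate_pos (n := n) (m := m) hN).le
  have key := kolmogorovDist_le_of_conditional hS ha hm hmn hN hNC
    (B := 108 * (6 * T + (remainderNorm P h n + 3 * baseRate n m N)) + 18 * (q * T))
    (by positivity) fun c hc hε => by
      obtain ⟨hηi, hη⟩ := integral_abs_shift_le (n := n) ha (by omega) (by omega) hc hε
      have hRL := memLp_remainder (n := n) ha
      have hRi := hRL.integrable one_le_three_halves
      -- Only the linear Hoeffding term is kept to first order. The degenerate remainder and the
      -- shift by `c` are small in mean.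
      refine ⟨linearPart P h n, fun x => remainder P h n x +
        (c ^ 2 - 2 * c * ustat h n x) / varH P h, memLp_linearPart ha, hRi.add hηi,
        fun x => ?_, ?_⟩
      · rw [ustat_sub_sq (by omega), add_div, ustat_sq_div ha (by omega) (by omega)]
        ring
      · have h1 := integral_abs_linearPart_rpow_le (n := n) ha (by omega) (by omega)
        have h2 := abs_integral_condArg_mul_linearPart_le ha (by omega) (by omega) hN hNC c
        have h3 : ∫ x, |remainder P h n x| ∂(Measure.pi fun _ : Fin n => P) ≤
          remainderNorm P h n := integral_abs_le_rpow hRL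
        have h4 : ∫ x, |remainder P h n x + (c ^ 2 - 2 * c * ustat h n x) / varH P h|
            ∂(Measure.pi fun _ : Fin n => P) ≤ remainderNorm P h n + 3 * baseRate n m N := by
          refine (integral_mono (hRi.add hηi).abs (hRi.abs.add hηi.abs)
            fun x => abs_add_le _ _).trans ?_
          simp only [Pi.add_apply]
          rw [integral_add hRi.abs hηi.abs]
          linarith
        rw [← hT] at h1 h2
        rw [← hq] at h2
        linarith
  refine key.trans ?_
  have h1 := baseRate_le ha (by omega) hN hNC
  have h2 := condRate_mul_le_B1 (P := P) (h := h) (n := n) (N := N)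
  have h3 : 0 ≤ condRate P h n N * mean P fun y => |h y| ^ 3 :=
    mul_nonneg (condRate_nonneg ha) (integral_nonneg fun _ => by positivity)
  have h5 := B2_nonneg (P := P) (h := h) (n := n)
  have h6 : 0 ≤ √(m : ℝ) / √(n * (1 - samplingProb n m N)) := by positivity
  have h7 : 0 ≤ q * T := by positivity
  rw [bound3, ← hT, ← hq, add_mul, one_mul]
  linarith

end

/-! ### The rate when `n` and `N` are comparable -/

section

variable {M : Type*} [MeasurableSpace M] {P : Measure M} [IsProbabilityMeasure P] {m n N : ℕ}
  {h : (Fin m → M) → ℝ}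

/-- For `n ≥ 8K` the bound `n choose m ≥ n²/4` gives `p ≤ 4K/n ≤ 1/2`. For smaller `n`, integrality
gives `(n choose m)(1 - p) = (n choose m) - N ≥ 1`, and `n choose m ≤ 2^n` is bounded. -/
lemma one_le_mul_one_sub_samplingProb {K : ℝ} (hm : 2 ≤ m) (hmn : 2 * m < n)
    (hNC : N < n.choose m) (hK : (N : ℝ) ≤ K * n) :
    1 ≤ (2 + 2 ^ ⌈8 * K⌉₊) * (1 - samplingProb n m N) := by
  have hnr : (0 : ℝ) < n := by exact_mod_cast (by omega : 0 < n)
  have hC : (0 : ℝ) < n.choose m := by exact_mod_cast (Nat.zero_le N).trans_lt hNC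
  have hp1 := samplingProb_lt_one hNC
  have h2 : (0 : ℝ) < 2 ^ ⌈8 * K⌉₊ := by positivity
  rcases le_or_gt (8 * K) n with h | h
  · have hch := sq_le_four_mul_choose hm hmn
    have hp : samplingProb n m N ≤ 1 / 2 := by
      rw [samplingProb, div_le_iff₀ hC]
      nlinarith
    nlinarith
  · have hn : n ≤ ⌈8 * K⌉₊ := by exact_mod_cast h.le.trans (Nat.le_ceil _)
    have hC2 : (n.choose m : ℝ) ≤ 2 ^ ⌈8 * K⌉₊ := by
      have h1 := (Nat.choose_le_two_pow n m).trans (Nat.pow_le_pow_right (by norm_num : 0 < 2) hn)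
      exact_mod_cast h1
    have h1 : 1 ≤ n.choose m * (1 - samplingProb n m N) := by
      have h3 : (n.choose m : ℝ) * (1 - samplingProb n m N) = n.choose m - N := by
        rw [samplingProb]; field_simp
      have h4 : (N : ℝ) + 1 ≤ n.choose m := by exact_mod_cast hNC
      linarith
    nlinarith

/-- In the von Bahr-Esseen bound, order `r` carries `(n choose r) * weight^{3/2} = (m choose r)
√weight`, and `√weight ≤ m/n` because `r ≥ 2`. The numerator does not depend on `n`. -/
lemma integral_abs_remainder_rpow_le (ha : Admissible P h) (hmn : 2 * m < n) :
    mean P (fun x : Fin n → M => |remainder P h n x| ^ (3 / 2 : ℝ)) ≤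
      (∑ r ∈ Finset.Icc 2 m, m.choose r * m * 3 ^ r * (varH P h ^ (3 / 2 : ℝ))⁻¹ *
        mean P fun y => |hproj P (fun y => h y ^ 2) r y| ^ (3 / 2 : ℝ)) / n := by
  have hv := ha.varH_pos
  have hnr : (0 : ℝ) < n := by exact_mod_cast (by omega : 0 < n)
  have hmn' : (m : ℝ) ≤ n := by exact_mod_cast (by omega : m ≤ n)
  have hm1 : (m : ℝ) / n ≤ 1 := by rw [div_le_one hnr]; exact hmn'
  have hL := ha.memLp_sq
  have hi := hL.integrable one_le_three_halves
  have hcomp := fun J : Finset (Fin n) =>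
    memLp_component (P := P) one_le_three_halves three_halves_ne_top hL J
  have h1 := integral_abs_sum_rpow_three_halves_le (P := P)
    (F := fun A x => weight n m A.card / varH P h * component P (fun y => h y ^ 2) A x)
    (𝒥 := cardBetween n 2 m) (fun J _ => (hcomp J).const_mul _)
    (fun J _ i hiJ x t => by simp only [component_indepOfCoord hiJ x t])
    (fun J hJ i hiJ => by
      filter_upwards [component_degenerate ha.symm.sq hi J (mem_cardBetween.1 hJ).2 i hiJ]
        with x hx
      rw [integral_const_mul, hx, mul_zero])
  have e1 : ∀ x : Fin n → M, ∑ A ∈ cardBetween n 2 m,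
      weight n m A.card / varH P h * component P (fun y => h y ^ 2) A x = remainder P h n x :=
    fun x => by
      rw [remainder_eq ha, Finset.sum_div]
      exact Finset.sum_congr rfl fun A _ => by ring
  have e2 : ∀ A : Finset (Fin n),
      ∫ x, |weight n m A.card / varH P h * component P (fun y => h y ^ 2) A x| ^ (3 / 2 : ℝ)
        ∂(Measure.pi fun _ : Fin n => P) = (weight n m A.card / varH P h) ^ (3 / 2 : ℝ) *
        mean P fun y => |hproj P (fun y => h y ^ 2) A.card y| ^ (3 / 2 : ℝ) := fun A => by
    have hw : 0 ≤ weight n m A.card / varH P h := div_nonneg (weight_nonneg _ _ _) hv.le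
    simp only [abs_mul, abs_of_nonneg hw, Real.mul_rpow hw (abs_nonneg _)]
    rw [integral_const_mul, integral_comp_component (g := fun t => |t| ^ (3 / 2 : ℝ))
      (by exact measurable_id.abs.pow_const _) (ha.measurable.pow_const 2)]
  simp only [e1, e2] at h1
  refine h1.trans ?_
  rw [sum_cardBetween_card (fun r => 3 ^ r * ((weight n m r / varH P h) ^ (3 / 2 : ℝ) *
        mean P fun y => |hproj P (fun y => h y ^ 2) r y| ^ (3 / 2 : ℝ))), Finset.sum_div]
  refine Finset.sum_le_sum fun r hr => ?_
  obtain ⟨hr2, hrm⟩ := Finset.mem_Icc.1 hr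
  have hD : 0 ≤ mean P fun y => |hproj P (fun y => h y ^ 2) r y| ^ (3 / 2 : ℝ) :=
    integral_nonneg fun _ => by positivity
  have hw := weight_nonneg n m r
  have hsw : √(weight n m r) ≤ m / n := by
    rw [Real.sqrt_le_left (by positivity)]
    exact (weight_le_pow hrm (by omega)).trans (pow_le_pow_of_le_one (by positivity) hm1 hr2)
  have hcw := choose_mul_weight (n := n) (m := m) (r := r) (by omega)
  calc (n.choose r : ℝ) * (3 ^ r * ((weight n m r / varH P h) ^ (3 / 2 : ℝ) *
        mean P fun y => |hproj P (fun y => h y ^ 2) r y| ^ (3 / 2 : ℝ)))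
      = (n.choose r * weight n m r) * √(weight n m r) * (3 ^ r * (varH P h ^ (3 / 2 : ℝ))⁻¹ *
        mean P fun y => |hproj P (fun y => h y ^ 2) r y| ^ (3 / 2 : ℝ)) := by
        rw [Real.div_rpow hw hv.le, rpow_three_halves hw]; ring
    _ ≤ m.choose r * (m / n) * (3 ^ r * (varH P h ^ (3 / 2 : ℝ))⁻¹ *
        mean P fun y => |hproj P (fun y => h y ^ 2) r y| ^ (3 / 2 : ℝ)) := by
        rw [hcw]
        exact mul_le_mul_of_nonneg_right (mul_le_mul_of_nonneg_left hsw (by positivity))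
          (by positivity)
    _ = _ := by ring

lemma exists_remainderNorm_le (ha : Admissible P h) :
    ∃ R : ℝ, 0 ≤ R ∧ ∀ n : ℕ, 2 * m < n → remainderNorm P h n ≤ R / √n := by
  set D := ∑ r ∈ Finset.Icc 2 m, m.choose r * m * 3 ^ r * (varH P h ^ (3 / 2 : ℝ))⁻¹ *
        mean P fun y => |hproj P (fun y => h y ^ 2) r y| ^ (3 / 2 : ℝ) with hD
  have hv := ha.varH_pos
  have hD0 : 0 ≤ D := Finset.sum_nonneg fun r _ =>
    mul_nonneg (by positivity) (integral_nonneg fun _ => by positivity)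
  refine ⟨D ^ (2 / 3 : ℝ), by positivity, fun n hmn => ?_⟩
  have hn1 : (1 : ℝ) ≤ n := by exact_mod_cast (by omega : 1 ≤ n)
  refine (Real.rpow_le_rpow (integral_nonneg fun _ => by positivity)
    (integral_abs_remainder_rpow_le ha hmn) (by norm_num)).trans ?_
  rw [← hD, Real.div_rpow hD0 (by positivity)]
  -- The `3/2`-moment is of order `1/n`, so the norm is of order `n^{-2/3}`, which is more than
  -- needed.
  refine div_le_div_of_nonneg_left (by positivity) (by positivity) ?_
  rw [Real.sqrt_eq_rpow]
  exact Real.rpow_le_rpow_of_exponent_le hn1 (by norm_num)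

end

section

variable {M : Type*} [MeasurableSpace M] {P : Measure M} [IsProbabilityMeasure P] {m n N : ℕ}
  {h : (Fin m → M) → ℝ} {K A q : ℝ}

lemma div_sqrt_mul_le {a x : ℝ} (ha : 0 ≤ a) (hx : 0 < x) (hA : 0 ≤ A) (hq : 0 < q)
    (hAq : 1 ≤ A * q) : a / √(x * q) ≤ a * √A / √x := by
  have h1 : 1 ≤ √A * √q := by
    rw [← Real.sqrt_mul hA, Real.one_le_sqrt]; exact hAq
  have hsx := Real.sqrt_pos.2 hx
  have hsq := Real.sqrt_pos.2 hq
  rw [Real.sqrt_mul hx.le, div_le_div_iff₀ (by positivity) hsx]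
  have := mul_le_mul_of_nonneg_left h1 (mul_nonneg ha hsx.le)
  linarith

lemma one_div_sqrt_le_of_le_mul (hn : 0 < n) (hN : 0 < N) (hK : 0 ≤ K) (h : (n : ℝ) ≤ K * N) :
    1 / √(N : ℝ) ≤ √K / √n := by
  have h1 := Real.sqrt_pos.2 (by exact_mod_cast hn : (0 : ℝ) < n)
  have h2 := Real.sqrt_pos.2 (by exact_mod_cast hN : (0 : ℝ) < N)
  rw [div_le_div_iff₀ h2 h1, one_mul, ← Real.sqrt_mul hK]
  exact Real.sqrt_le_sqrt h

lemma B1_le (ha : Admissible P h) (hm : 0 < m) (hn : 0 < n) (hN : 0 < N) (hNC : N < n.choose m)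
    (hK : 0 ≤ K) (hA : 0 ≤ A) (hAq : 1 ≤ A * (1 - samplingProb n m N)) (hnK : (n : ℝ) ≤ K * N) :
    B1 P h n N ≤ ((mean P fun x => |h x| ^ 3) / sigmaH P h ^ 3 * (√A * √K) +
      24 * m * (mean P fun x => |h x| ^ 3) ^ 2 / sigmaH P h ^ 6) / √n := by
  have hσ := ha.sigmaH_pos
  have hp0 := samplingProb_pos hN hNC
  have hp1 := samplingProb_lt_one hNC
  set p := samplingProb n m N with hp
  have hq : 0 < 1 - p := by linarith
  set H := mean P fun x => |h x| ^ 3 with hH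
  have hH0 : 0 < H := lt_of_lt_of_le (by positivity) ha.sigmaH_pow_three_le
  have hnr : (1 : ℝ) ≤ n := by exact_mod_cast hn
  have hNr : (0 : ℝ) < N := by exact_mod_cast hN
  have hmr : (0 : ℝ) < m := by exact_mod_cast hm
  have hsn : 0 < √(n : ℝ) := Real.sqrt_pos.2 (by linarith)
  rw [B1, ← hp, ← hH, add_div]
  refine add_le_add ?_ ?_
  · have h1 : 1 / √(N * (1 - p)) ≤ √A * (√K / √n) := by
      refine (div_sqrt_mul_le zero_le_one hNr hA hq hAq).trans ?_
      rw [one_mul, ← mul_one_div]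
      exact mul_le_mul_of_nonneg_left (one_div_sqrt_le_of_le_mul hn hN hK hnK) (Real.sqrt_nonneg _)
    have hw : 1 - 2 * p + 2 * p ^ 2 ≤ 1 := by nlinarith
    calc H * (1 - 2 * p + 2 * p ^ 2) / (√(N * (1 - p)) * sigmaH P h ^ 3)
        ≤ H * 1 / (√(N * (1 - p)) * sigmaH P h ^ 3) := by gcongr
      _ = H / sigmaH P h ^ 3 * (1 / √(N * (1 - p))) := by field_simp
      _ ≤ H / sigmaH P h ^ 3 * (√A * (√K / √n)) := mul_le_mul_of_nonneg_left h1 (by positivity)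
      _ = _ := by ring
  -- The exponential term is handled by `exp (-t) ≤ 1/t`, which already gives order `1/n`.
  · have ht : 0 < n * sigmaH P h ^ 6 / (24 * m * H ^ 2) := by positivity
    rw [neg_div, Real.exp_neg]
    calc (Real.exp (n * sigmaH P h ^ 6 / (24 * m * H ^ 2)))⁻¹
        ≤ (n * sigmaH P h ^ 6 / (24 * m * H ^ 2))⁻¹ :=
          inv_anti₀ ht (by linarith [Real.add_one_le_exp (n * sigmaH P h ^ 6 / (24 * m * H ^ 2))])
      _ = 24 * m * H ^ 2 / sigmaH P h ^ 6 / n := by field_simp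
      _ ≤ _ := div_le_div_of_nonneg_left (by positivity) hsn
          (Real.sqrt_le_self_iff.2 (Or.inr hnr))

lemma B2_eq (hn : 0 < n) (ha : Admissible P h) :
    B2 P h n = ((∫ x, |g P h x| ^ 3 ∂P) / sigmaG P h ^ 3 +
      √(m * (varH P h / (m * varG P h) - 1))) / √n := by
  have hσ := ha.sigmaG_pos
  have hsn := Real.sqrt_pos.2 (by exact_mod_cast hn : (0 : ℝ) < n)
  rw [B2, add_div, ← Real.sqrt_div' _ (Nat.cast_nonneg n)]
  congr 1
  · field_simp
  · congr 1; ring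

/-- The sampling-size factor of the linear term is bounded when `n` and `N` are comparable. -/
lemma sqrt_mul_div_sqrt_le (hn : 0 < n) (hK : 0 ≤ K) (hA : 0 ≤ A) (hq : 0 < q) (hAq : 1 ≤ A * q)
    (hNK : (N : ℝ) ≤ K * n) : √(m * N) / √(n * q) ≤ √m * √K * √A := by
  have hnr : (0 : ℝ) < n := by exact_mod_cast hn
  have hsn := Real.sqrt_pos.2 hnr
  refine (div_sqrt_mul_le (Real.sqrt_nonneg _) hnr hA hq hAq).trans ?_
  rw [div_le_iff₀ hsn, Real.sqrt_mul (Nat.cast_nonneg m)]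
  have : √(N : ℝ) ≤ √K * √n := by rw [← Real.sqrt_mul hK]; exact Real.sqrt_le_sqrt hNK
  calc √m * √N * √A ≤ √m * (√K * √n) * √A := by gcongr
    _ = _ := by ring

theorem exists_bounds_le (ha : Admissible P h) (hm : 2 ≤ m) (K : ℝ) :
    ∃ K' : ℝ, ∀ n N : ℕ, 2 * m < n → 0 < N → N < n.choose m →
      max ((n : ℝ) / N) ((N : ℝ) / n) < K →
      bound3 P h n N ≤ K' / √n ∧
        (Integrable (fun x => h x ^ 4) (Measure.pi fun _ : Fin m => P) →
          bound4 P h n N ≤ K' / √n) := by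
  obtain ⟨R, hR0, hR⟩ := exists_remainderNorm_le ha
  have hσ := ha.sigmaH_pos
  have hv := ha.varH_pos
  set A : ℝ := 2 + 2 ^ ⌈8 * K⌉₊ with hA
  have hA0 : 0 ≤ A := by positivity
  set b₁ := (mean P fun x => |h x| ^ 3) / sigmaH P h ^ 3 * (√A * √K) +
      24 * m * (mean P fun x => |h x| ^ 3) ^ 2 / sigmaH P h ^ 6 with hb₁
  set b₂ := (∫ x, |g P h x| ^ 3 ∂P) / sigmaG P h ^ 3 +
      √(m * (varH P h / (m * varG P h) - 1)) with hb₂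
  set T := (m : ℝ) ^ (3 / 2 : ℝ) * (∫ t, Psi1 P h t ^ (3 / 2 : ℝ) ∂P) / sigmaH P h ^ 3 with hT
  set E := √(m * mean P fun x => (h x ^ 2 - varH P h) ^ 2) / varH P h with hE
  have hT0 : 0 ≤ T := by
    have : 0 ≤ ∫ t, Psi1 P h t ^ (3 / 2 : ℝ) ∂P :=
      integral_nonneg fun t => Real.rpow_nonneg (Psi1_nonneg t) _
    positivity
  have hE0 : 0 ≤ E := by positivity
  -- One constant serves both bounds: it adds up the coefficients of all terms. The sign of `K` is
  -- known only once some pair `n, N` satisfies the constraint, hence `|K|`.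
  refine ⟨b₁ + b₂ + √m * √A + (1 + √m * √K * √A) * T + R + |K| * A + E,
    fun n N hmn hN hNC hK => ?_⟩
  have hn : 0 < n := by omega
  have hnr : (0 : ℝ) < n := by exact_mod_cast hn
  have hn1 : (1 : ℝ) ≤ n := by exact_mod_cast hn
  have hNr : (0 : ℝ) < N := by exact_mod_cast hN
  have hsn := Real.sqrt_pos.2 hnr
  have hnK : (n : ℝ) ≤ K * N := by
    rw [← div_le_iff₀ hNr]; exact (le_max_left _ _).trans hK.le
  have hNK : (N : ℝ) ≤ K * n := by
    rw [← div_le_iff₀ hnr]; exact (le_max_right _ _).trans hK.le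
  have hK0 : 0 ≤ K := (by positivity : (0 : ℝ) ≤ n / N).trans ((le_max_left _ _).trans hK.le)
  have hq : 0 < 1 - samplingProb n m N := by linarith [samplingProb_lt_one hNC]
  have hAq : 1 ≤ A * (1 - samplingProb n m N) :=
    one_le_mul_one_sub_samplingProb hm hmn hNC hNK
  have h1 := B1_le ha (by omega) hn hN hNC hK0 hA0 hAq hnK
  have h2 := B2_eq hn ha
  have h3 := div_sqrt_mul_le (Real.sqrt_nonneg m) hnr hA0 hq hAq
  have h4 : (1 + √(m * N) / √(n * (1 - samplingProb n m N))) *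
      ((m : ℝ) ^ (3 / 2 : ℝ) * (∫ t, Psi1 P h t ^ (3 / 2 : ℝ) ∂P) / (√n * sigmaH P h ^ 3)) ≤
      (1 + √m * √K * √A) * T / √n := by
    have e : (m : ℝ) ^ (3 / 2 : ℝ) * (∫ t, Psi1 P h t ^ (3 / 2 : ℝ) ∂P) /
        (√n * sigmaH P h ^ 3) = T / √n := by rw [hT]; field_simp
    rw [e, mul_div_assoc]
    exact mul_le_mul_of_nonneg_right
      (by linarith [sqrt_mul_div_sqrt_le (m := m) hn hK0 hA0 hq hAq hNK]) (by positivity)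
  have h5 := hR n hmn
  have h6 : (N : ℝ) / ((n : ℝ) ^ 2 * (1 - samplingProb n m N)) ≤ |K| * A / √n := by
    rw [abs_of_nonneg hK0]
    calc (N : ℝ) / ((n : ℝ) ^ 2 * (1 - samplingProb n m N)) ≤ K * A / n := by
          rw [div_le_div_iff₀ (by positivity) hnr]
          have e : K * A * ((n : ℝ) ^ 2 * (1 - samplingProb n m N)) =
            K * n * n * (A * (1 - samplingProb n m N)) := by ring
          rw [e]
          calc (N : ℝ) * n ≤ K * n * n * 1 := by rw [mul_one]; gcongr
            _ ≤ _ := mul_le_mul_of_nonneg_left hAq (by positivity)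
      _ ≤ _ := div_le_div_of_nonneg_left (by positivity) hsn
          (Real.sqrt_le_self_iff.2 (Or.inr hn1))
  have h7 : √(m * mean P fun x => (h x ^ 2 - varH P h) ^ 2) / (√n * varH P h) = E / √n := by
    rw [hE]; field_simp
  have p1 : 0 ≤ (1 + √m * √K * √A) * T / √n := by positivity
  have p2 : 0 ≤ R / √n := by positivity
  have p3 : 0 ≤ |K| * A / √n := by positivity
  have p4 : 0 ≤ E / √n := by positivity
  simp only [add_div]
  refine ⟨?_, fun _ => ?_⟩
  · rw [bound3, h2, ← hb₂]
    linarith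
  · rw [bound4, h2, ← hb₂, h7]
    linarith

end

end IncompleteU

/-! ### The theorem -/

theorem theorem4 :
    (∃ C : ℝ, 0 < C ∧
      ∀ (M : Type*) [MeasurableSpace M] (P : Measure M) [IsProbabilityMeasure P]
        (Ω : Type*) [MeasurableSpace Ω] (μ : Measure Ω) [IsProbabilityMeasure μ]
        (n m N : ℕ) (h : (Fin m → M) → ℝ)
        (X : Fin n → Ω → M) (Z : IncompleteU.Idx n m → Ω → ℝ),
        2 ≤ m → 2 * m < n → 0 < N → N < n.choose m →
        IncompleteU.Admissible P h →
        IncompleteU.IsBernoulliSampling P μ N X Z →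
        IncompleteU.kolmogorovDistNormal μ
            (fun ω => √n * IncompleteU.incompleteU h X Z ω / IncompleteU.sigma P h n N) ≤
          C * IncompleteU.bound3 P h n N ∧
        (Integrable (fun x => h x ^ 4) (Measure.pi fun _ : Fin m => P) →
          IncompleteU.kolmogorovDistNormal μ
              (fun ω => √n * IncompleteU.incompleteU h X Z ω / IncompleteU.sigma P h n N) ≤
            C * IncompleteU.bound4 P h n N)) ∧
    (∀ (M : Type*) [MeasurableSpace M] (P : Measure M) [IsProbabilityMeasure P]
        (m : ℕ) (h : (Fin m → M) → ℝ) (K : ℝ),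
        2 ≤ m → IncompleteU.Admissible P h →
        ∃ K' : ℝ, ∀ n N : ℕ, 2 * m < n → 0 < N → N < n.choose m →
          max ((n : ℝ) / N) ((N : ℝ) / n) < K →
          IncompleteU.bound3 P h n N ≤ K' / √n ∧
          (Integrable (fun x => h x ^ 4) (Measure.pi fun _ : Fin m => P) →
            IncompleteU.bound4 P h n N ≤ K' / √n)) := by
  refine ⟨⟨3000, by norm_num, ?_⟩, ?_⟩
  · intro M _ P _ Ω _ μ _ n m N h X Z hm hmn hN hNC ha hS
    exact ⟨IncompleteU.kolmogorovDist_le_bound3 hS ha hm hmn hN hNC,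
      IncompleteU.kolmogorovDist_le_bound4 hS ha hm hmn hN hNC⟩
  · intro M _ P _ m h K hm ha
    exact IncompleteU.exists_bounds_le ha hm K
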